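/- Let $\mathcal H$ be the Hilbert space of one bosonic mode, with orthonormal number basis $\{|n\rangle\}_{n\in\mathbb N}$, ladder operator $\hat a|n\rangle=\sqrt n\,|n-1\rangle$ and quadratures $\hat q=(\hat a+\hat a^\dagger)/\sqrt2$, $\hat p=(\hat a-\hat a^\dagger)/(\sqrt2\,\mathrm i)$. For $d_0\ge 0$ put $$V_1=\sum_{n\ge d_0}|n\rangle\langle n|,\qquad U_1=\tfrac12P^{q^2\ge d_0/2}+\tfrac12P^{p^2\ge d_0/2},$$ where $P^{q^2\ge d_0/2}$ and $P^{p^2\ge d_0/2}$ are the spectral projections of $\hat q$ and $\hat p$ on $\{x\in\mathbb R: x^2\ge d_0/2\}$. Let $k\ge1$, $1\le j\le k$, let $U$ be a unitary operator on $\mathcal H^{\otimes k}$, and let $\tilde V_1^j=UV_1^{j}U^\dagger$ and $\tilde U_1^j=UU_1^{j}U^\dagger$, where $V_1^{j}$, $U_1^{j}$ denote $V_1$, $U_1$ acting on the $j$-th of the $k$ modes. Let $c_0=1-\frac1{\sqrt2}$. Let $K',N,R,Q$ be integers with $N\ge 2K'$, $0<R<K'$, let $d_0=\frac1{c_0^2}\ln\frac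 NR$, and suppose $$N\left(\frac{4R}{K'}+\frac{1}{c_0\sqrt{\pi d_0}}\,\frac RN\right)<Q<N .$$ Let $\rho$ be a density operator on $(\mathcal H^{\otimes k})^{\otimes(K'+N)}$ that is invariant under all permutations of the $K'+N$ registers. Measure the POVM $\{\mathbb 1-\tilde U_1^j,\tilde U_1^j\}$ on each of the first $K'$ registers, with outcomes $z_1,\dots,z_{K'}\in\{0,1\}$, and the POVM $\{\mathbb 1-\tilde V_1^j,\tilde V_1^j\}$ on each of the other $N$ registers, with outcomes $y_1,\dots,y_N\in\{0,1\}$ (in both cases the outcome $0$ belongs to the first element and $1$ to the second). Then $$\Pr\left(\sum_{i=1}^{K'}z_i\le R\ \text{ and }\ \sum_{i=1}^{N}y_i>Q\right)\le 4\exp\left(-\frac{K'^2}{25(K'+1)}\left(\frac{3Q}{5N}-\frac{4R}{K'}\right)^2\right).$$ -/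

import Mathlib

open MeasureTheory

noncomputable section

namespace CVVerification

/-! ### Fock spaces: `ℓ²` over the set of occupation-number labels -/

/-- The Hilbert space with orthonormal basis `|b⟩`, `b : β`.  One mode is `FockSpace ℕ`, a register
of `k` modes is `FockSpace (Fin k → ℕ)` (that is `𝓗^{⊗k}` in its number basis), and `n` registers
are `FockSpace (Fin n → Fin k → ℕ)` (that is `𝓗^{⊗kn}`). -/
abbrev FockSpace (β : Type) : Type := lp (fun _ : β => ℂ) 2

/-- Bounded operators on `FockSpace β`. -/
abbrev Op (β : Type) : Type := FockSpace β →L[ℂ] FockSpace β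

/-- The basis vector `|b⟩`. -/
def ket {β : Type} [DecidableEq β] (b : β) : FockSpace β := lp.single 2 b (1 : ℂ)

theorem summable_sq {β : Type} (ψ : FockSpace β) : Summable fun b => ‖ψ b‖ ^ 2 := by
  have h := (lp.memℓp ψ).summable (by simp)
  simpa using h

theorem le_of_sq_le_sq {a b : ℝ} (h : a ^ 2 ≤ b ^ 2) (hb : 0 ≤ b) : a ≤ b :=
  abs_le_of_sq_le_sq' h hb |>.2

theorem memlp_of_summable_sq {β : Type} {f : β → ℂ} (h : Summable fun b => ‖f b‖ ^ 2) :
    Memℓp f 2 := by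
  apply memℓp_gen
  simpa using h

theorem norm_sq_eq {β : Type} (ψ : FockSpace β) : ‖ψ‖ ^ 2 = ∑' b, ‖ψ b‖ ^ 2 := by
  have h := lp.norm_rpow_eq_tsum (p := 2) (by simp) ψ
  simpa using h

/-! ### Operators acting on one tensor factor, and tensor products of operators -/

section Site

variable {ι β : Type} [DecidableEq ι]

/-- For fixed labels `a` of the other factors, the vector `b ↦ ψ (a with i-th label b)`. -/
def slice (i : ι) (ψ : FockSpace (ι → β)) (a : ι → β) : FockSpace β :=
  ⟨fun b => ψ (Function.update a i b),
    memlp_of_summable_sq ((summable_sq ψ).comp_injective (Function.update_injective a i))⟩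

theorem slice_apply (i : ι) (ψ : FockSpace (ι → β)) (a : ι → β) (b : β) :
    slice i ψ a b = ψ (Function.update a i b) := rfl

theorem update_split_symm (i : ι) (c : {j // j ≠ i} → β) (b b' : β) :
    Function.update ((Equiv.funSplitAt i β).symm (b, c)) i b'
      = (Equiv.funSplitAt i β).symm (b', c) := by
  funext j
  by_cases h : j = i
  · subst h; simp
  · simp [h]

theorem slice_split_symm (i : ι) (ψ : FockSpace (ι → β)) (c : {j // j ≠ i} → β) (b b' : β) :
    slice i ψ ((Equiv.funSplitAt i β).symm (b, c))
      = slice i ψ ((Equiv.funSplitAt i β).symm (b', c)) := by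
  ext x
  rw [slice_apply, slice_apply, update_split_symm, update_split_symm]

theorem site_bound (i : ι) (A : Op β) (ψ : FockSpace (ι → β)) :
    Summable (fun a : ι → β => ‖A (slice i ψ a) (a i)‖ ^ 2) ∧
      ∑' a : ι → β, ‖A (slice i ψ a) (a i)‖ ^ 2 ≤ (‖A‖ * ‖ψ‖) ^ 2 := by
  classical
  rcases isEmpty_or_nonempty β with hβ | ⟨⟨b₀⟩⟩
  · have : IsEmpty (ι → β) := ⟨fun a => hβ.false (a i)⟩
    exact ⟨summable_empty, by simp⟩
  set e : ({j // j ≠ i} → β) × β ≃ (ι → β) :=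
    (Equiv.prodComm _ _).trans (Equiv.funSplitAt i β).symm with he
  set s : ({j // j ≠ i} → β) → FockSpace β := fun c => slice i ψ (e (c, b₀)) with hs
  have hF : ∀ c b, A (slice i ψ (e (c, b))) (e (c, b) i) = A (s c) b := by
    intro c b
    have h1 : e (c, b) i = b := by simp [he]
    have h2 : slice i ψ (e (c, b)) = s c := slice_split_symm i ψ c b b₀
    rw [h1, h2]
  have hG : ∀ c b, ψ (e (c, b)) = s c b := by
    intro c b
    rw [hs]
    simp only [slice_apply]
    rw [he]
    exact congrArg (fun t => ψ t) (update_split_symm i c b₀ b).symm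
  have hpos₁ : 0 ≤ fun p : ({j // j ≠ i} → β) × β => ‖s p.1 p.2‖ ^ 2 :=
    fun p => sq_nonneg ‖s p.1 p.2‖
  have hpos₂ : 0 ≤ fun p : ({j // j ≠ i} → β) × β => ‖A (s p.1) p.2‖ ^ 2 :=
    fun p => sq_nonneg ‖A (s p.1) p.2‖
  have sumψ : Summable fun p : ({j // j ≠ i} → β) × β => ‖s p.1 p.2‖ ^ 2 := by
    have := (summable_sq ψ).comp_injective e.injective
    refine this.congr fun p => ?_
    simp only [Function.comp_apply]
    rw [← hG]
  have hsum_s : Summable fun c => ‖s c‖ ^ 2 := by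
    have := ((summable_prod_of_nonneg
      (f := fun p : ({j // j ≠ i} → β) × β => ‖s p.1 p.2‖ ^ 2) hpos₁).1 sumψ).2
    exact this.congr fun c => (norm_sq_eq (s c)).symm
  have hle : ∀ c, ‖A (s c)‖ ^ 2 ≤ ‖A‖ ^ 2 * ‖s c‖ ^ 2 := by
    intro c
    rw [← mul_pow]
    exact pow_le_pow_left₀ (norm_nonneg _) (A.le_opNorm _) 2
  have hsum_A : Summable fun c => ‖A (s c)‖ ^ 2 :=
    Summable.of_nonneg_of_le (fun c => by positivity) hle (hsum_s.mul_left _)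
  have sumF : Summable fun p : ({j // j ≠ i} → β) × β => ‖A (s p.1) p.2‖ ^ 2 := by
    refine (summable_prod_of_nonneg
      (f := fun p : ({j // j ≠ i} → β) × β => ‖A (s p.1) p.2‖ ^ 2) hpos₂).2
      ⟨fun c => summable_sq (A (s c)), ?_⟩
    exact hsum_A.congr fun c => norm_sq_eq (A (s c))
  have hcomp : ((fun a : ι → β => ‖A (slice i ψ a) (a i)‖ ^ 2) ∘ e)
      = fun p => ‖A (s p.1) p.2‖ ^ 2 := by
    funext p
    simp only [Function.comp_apply]
    rw [← hF p.1 p.2]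
  have hsummable : Summable (fun a : ι → β => ‖A (slice i ψ a) (a i)‖ ^ 2) := by
    rw [← e.summable_iff, hcomp]
    exact sumF
  refine ⟨hsummable, ?_⟩
  have hψ : ‖ψ‖ ^ 2 = ∑' c, ‖s c‖ ^ 2 := by
    rw [norm_sq_eq, ← e.tsum_eq]
    have h1 : ∀ p : ({j // j ≠ i} → β) × β, ‖ψ (e p)‖ ^ 2 = ‖s p.1 p.2‖ ^ 2 := fun p => by rw [← hG]
    rw [tsum_congr h1, sumψ.tsum_prod]
    exact tsum_congr fun c => (norm_sq_eq (s c)).symm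
  calc ∑' a : ι → β, ‖A (slice i ψ a) (a i)‖ ^ 2
      = ∑' p : ({j // j ≠ i} → β) × β, ‖A (s p.1) p.2‖ ^ 2 := by
        rw [← e.tsum_eq]
        exact tsum_congr fun p => congrFun hcomp p
    _ = ∑' c, ‖A (s c)‖ ^ 2 := by
        rw [sumF.tsum_prod]
        exact tsum_congr fun c => (norm_sq_eq (A (s c))).symm
    _ ≤ ∑' c, ‖A‖ ^ 2 * ‖s c‖ ^ 2 := hsum_A.tsum_le_tsum hle (hsum_s.mul_left _)
    _ = (‖A‖ * ‖ψ‖) ^ 2 := by rw [tsum_mul_left, mul_pow, hψ]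

/-- `atSite i A` is the operator `1 ⊗ ⋯ ⊗ A ⊗ ⋯ ⊗ 1`, with `A` acting on the `i`-th factor. -/
def atSite (i : ι) (A : Op β) : Op (ι → β) :=
  LinearMap.mkContinuous
    { toFun := fun ψ => ⟨fun a => A (slice i ψ a) (a i), memlp_of_summable_sq (site_bound i A ψ).1⟩
      map_add' := fun ψ φ => by
        ext a
        have : slice i (ψ + φ) a = slice i ψ a + slice i φ a := rfl
        change A (slice i (ψ + φ) a) (a i) = A (slice i ψ a) (a i) + A (slice i φ a) (a i)
        rw [this, map_add]
        rfl
      map_smul' := fun c ψ => by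
        ext a
        have : slice i (c • ψ) a = c • slice i ψ a := rfl
        change A (slice i (c • ψ) a) (a i) = c • A (slice i ψ a) (a i)
        rw [this, map_smul]
        rfl }
    ‖A‖ (fun ψ => by
      refine le_of_sq_le_sq ?_ (by positivity)
      rw [norm_sq_eq]
      exact (site_bound i A ψ).2)

end Site

theorem atSite_apply {ι β : Type} [DecidableEq ι] (i : ι) (A : Op β) (ψ : FockSpace (ι → β))
    (a : ι → β) : atSite i A ψ a = A (slice i ψ a) (a i) := rfl

/-- The tensor product `A₀ ⊗ A₁ ⊗ ⋯ ⊗ A_{n-1}`, as the product of the (commuting) operators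
`1 ⊗ ⋯ ⊗ Aᵢ ⊗ ⋯ ⊗ 1`. -/
def tensorOp {n : ℕ} {β : Type} (A : Fin n → Op β) : Op (Fin n → β) :=
  (List.ofFn fun i => atSite i (A i)).prod

/-! ### States, traces and permutation invariance -/

/-- The trace `∑ₐ ⟨a|T|a⟩`. -/
def trace {β : Type} [DecidableEq β] (T : Op β) : ℂ := ∑' a, inner ℂ (ket a) (T (ket a))

/-- Density operators: positive with trace one. -/
structure IsState {β : Type} [DecidableEq β] (ρ : Op β) : Prop where
  isPositive : ρ.IsPositive
  hasTrace_one : HasSum (fun a => inner ℂ (ket a) (ρ (ket a))) 1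

/-- The unitary permuting the `n` tensor factors according to `π`. -/
def permOp {n : ℕ} {β : Type} (π : Equiv.Perm (Fin n)) : Op (Fin n → β) :=
  LinearMap.mkContinuous
    { toFun := fun ψ => ⟨fun a => ψ (a ∘ π), memlp_of_summable_sq
        ((summable_sq ψ).comp_injective
          (i := fun a : Fin n → β => a ∘ π) (π.surjective.injective_comp_right))⟩
      map_add' := fun _ _ => rfl
      map_smul' := fun _ _ => rfl }
    1 (fun ψ => by
      refine le_of_sq_le_sq ?_ (by positivity)
      rw [norm_sq_eq, one_mul, norm_sq_eq]
      exact (((Equiv.arrowCongr π (Equiv.refl β)).symm.tsum_eq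
        fun a : Fin n → β => ‖ψ a‖ ^ 2)).le)

/-- `P_π ρ P_π† = ρ` for every permutation `π` of the `n` registers. -/
def IsPermInvariant {n : ℕ} {β : Type} (ρ : Op (Fin n → β)) : Prop :=
  ∀ π : Equiv.Perm (Fin n), permOp π * ρ = ρ * permOp π

/-! ### Position and momentum representations of one mode -/

/-- The position wave function of the number state `|n⟩` (`ħ = 1`, `q̂ = (â + â†)/√2`):
`(n! √π)^{-1/2} Heₙ(√2 x) exp(-x²/2)`, where `Heₙ` is the probabilists' Hermite polynomial. -/
def hermiteFun (n : ℕ) (x : ℝ) : ℝ :=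
  Polynomial.aeval (√2 * x) (Polynomial.hermite n) * Real.exp (-x ^ 2 / 2)
    / √((n.factorial : ℝ) * √Real.pi)

theorem derivative_hermite_succ (n : ℕ) :
    Polynomial.derivative (Polynomial.hermite (n + 1))
      = (n + 1 : Polynomial ℤ) * Polynomial.hermite n := by
  induction n with
  | zero => simp
  | succ n ih =>
    rw [Polynomial.hermite_succ (n + 1), Polynomial.derivative_sub, Polynomial.derivative_mul, ih,
      Polynomial.derivative_X, Polynomial.derivative_mul, Polynomial.hermite_succ n]
    have : Polynomial.derivative ((n : Polynomial ℤ) + 1) = 0 := by simp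
    rw [this]
    push_cast
    ring

theorem normConst_pos (n : ℕ) : 0 < (n.factorial : ℝ) * √Real.pi := by positivity

theorem normConst_succ (n : ℕ) : √(((n + 1).factorial : ℝ) * √Real.pi)
    = √((n : ℝ) + 1) * √((n.factorial : ℝ) * √Real.pi) := by
  rw [← Real.sqrt_mul (by positivity), Nat.factorial_succ]
  push_cast
  ring_nf

theorem hasDerivAt_hermiteFun_raw (n : ℕ) (x : ℝ) :
    HasDerivAt (hermiteFun n)
      ((√2 * Polynomial.aeval (√2 * x) (Polynomial.derivative (Polynomial.hermite n))
          - x * Polynomial.aeval (√2 * x) (Polynomial.hermite n)) * Real.exp (-x ^ 2 / 2)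
        / √((n.factorial : ℝ) * √Real.pi)) x := by
  have h1 : HasDerivAt (fun y : ℝ => √2 * y) (√2) x := by
    simpa using (hasDerivAt_id x).const_mul (√2)
  have h2 : HasDerivAt (fun y : ℝ => Polynomial.aeval (√2 * y) (Polynomial.hermite n))
      (Polynomial.aeval (√2 * x) (Polynomial.derivative (Polynomial.hermite n)) * √2) x :=
    HasDerivAt.comp x ((Polynomial.hermite n).hasDerivAt_aeval (√2 * x)) h1
  have h3 : HasDerivAt (fun y : ℝ => Real.exp (-y ^ 2 / 2)) (Real.exp (-x ^ 2 / 2) * (-x)) x := by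
    have : HasDerivAt (fun y : ℝ => -y ^ 2 / 2) (-x) x := by
      have := ((hasDerivAt_pow 2 x).neg).div_const 2
      exact this.congr_deriv (by norm_num; ring)
    exact this.exp
  have := (h2.mul h3).div_const (√((n.factorial : ℝ) * √Real.pi))
  exact this.congr_deriv (by ring)

theorem up_hermiteFun (n : ℕ) (x : ℝ) : √((n : ℝ) + 1) * hermiteFun (n + 1) x
    = Polynomial.aeval (√2 * x) (Polynomial.hermite (n + 1)) * Real.exp (-x ^ 2 / 2)
      / √((n.factorial : ℝ) * √Real.pi) := by
  have h : 0 < √((n : ℝ) + 1) := by positivity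
  have h' : 0 < √((n.factorial : ℝ) * √Real.pi) := Real.sqrt_pos.2 (normConst_pos n)
  rw [hermiteFun, normConst_succ]
  field_simp

theorem down_hermiteFun (n : ℕ) (x : ℝ) : √(n : ℝ) * hermiteFun (n - 1) x
    = Polynomial.aeval (√2 * x) (Polynomial.derivative (Polynomial.hermite n))
      * Real.exp (-x ^ 2 / 2) / √((n.factorial : ℝ) * √Real.pi) := by
  cases n with
  | zero => simp
  | succ n =>
    have h : 0 < √((n : ℝ) + 1) := by positivity
    have h' : 0 < √((n.factorial : ℝ) * √Real.pi) := Real.sqrt_pos.2 (normConst_pos n)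
    have h2 : √((n : ℝ) + 1) * √((n : ℝ) + 1) = (n : ℝ) + 1 := Real.mul_self_sqrt (by positivity)
    rw [Nat.add_sub_cancel, hermiteFun, normConst_succ, derivative_hermite_succ]
    simp only [map_mul, map_add, map_natCast, map_one]
    push_cast
    rw [mul_div_assoc', div_eq_div_iff h'.ne' (by positivity)]
    linear_combination (Polynomial.aeval (√2 * x) (Polynomial.hermite n)
      * Real.exp (-x ^ 2 / 2) * √((n.factorial : ℝ) * √Real.pi)) * h2

/-- `q̂ = (â + â†)/√2` acts on the position wave functions as multiplication by `x`
(`â|n⟩ = √n|n-1⟩`, `â†|n⟩ = √(n+1)|n+1⟩`). -/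
theorem mul_hermiteFun (n : ℕ) (x : ℝ) :
    x * hermiteFun n x
      = (√(n : ℝ) * hermiteFun (n - 1) x + √((n : ℝ) + 1) * hermiteFun (n + 1) x) / √2 := by
  have h2 : √2 * √2 = (2 : ℝ) := Real.mul_self_sqrt (by norm_num)
  have h0 : √2 ≠ (0 : ℝ) := by positivity
  rw [up_hermiteFun, down_hermiteFun, hermiteFun, Polynomial.hermite_succ]
  simp only [map_mul, map_sub, Polynomial.aeval_X]
  field_simp
  ring

theorem hasDerivAt_hermiteFun (n : ℕ) (x : ℝ) :
    HasDerivAt (hermiteFun n)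
      ((√(n : ℝ) * hermiteFun (n - 1) x - √((n : ℝ) + 1) * hermiteFun (n + 1) x) / √2) x := by
  have h2 : √2 * √2 = (2 : ℝ) := Real.mul_self_sqrt (by norm_num)
  have h0 : √2 ≠ (0 : ℝ) := by positivity
  refine (hasDerivAt_hermiteFun_raw n x).congr_deriv ?_
  rw [up_hermiteFun, down_hermiteFun, Polynomial.hermite_succ]
  simp only [map_mul, map_sub, Polynomial.aeval_X]
  generalize Polynomial.aeval (√2 * x) (Polynomial.derivative (Polynomial.hermite n)) = D
  generalize Polynomial.aeval (√2 * x) (Polynomial.hermite n) = H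
  have : √((n.factorial : ℝ) * √Real.pi) ≠ 0 := (Real.sqrt_pos.2 (normConst_pos n)).ne'
  field_simp
  linear_combination D * h2

theorem integrable_poly_gauss (p : Polynomial ℝ) :
    Integrable fun x : ℝ => p.eval x * Real.exp (-x ^ 2) := by
  induction p using Polynomial.induction_on' with
  | add p q hp hq =>
    refine (hp.add hq).congr (Filter.Eventually.of_forall fun x => ?_)
    simp [add_mul]
  | monomial n a =>
    have h := (integrable_rpow_mul_exp_neg_mul_sq (b := 1) one_pos (s := (n : ℝ))
      (by have : (0 : ℝ) ≤ n := n.cast_nonneg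
          linarith)).const_mul a
    refine h.congr (Filter.Eventually.of_forall fun x => ?_)
    simp [mul_assoc]

theorem hermiteFun_eq_poly (n : ℕ) : ∃ p : Polynomial ℝ, ∀ x,
    hermiteFun n x = p.eval x * Real.exp (-x ^ 2 / 2) := by
  refine ⟨Polynomial.C (√((n.factorial : ℝ) * √Real.pi))⁻¹ *
    ((Polynomial.hermite n).map (Int.castRingHom ℝ)).comp
      (Polynomial.C (√2) * Polynomial.X), fun x => ?_⟩
  have : Polynomial.aeval (√2 * x) (Polynomial.hermite n)
      = ((Polynomial.hermite n).map (Int.castRingHom ℝ)).eval (√2 * x) := by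
    rw [Polynomial.eval_map, Polynomial.aeval_def]
    rfl
  simp only [hermiteFun, this, Polynomial.eval_mul, Polynomial.eval_C, Polynomial.eval_comp,
    Polynomial.eval_X]
  ring

theorem integrable_hermiteFun_mul (n m : ℕ) :
    Integrable fun x : ℝ => hermiteFun n x * hermiteFun m x := by
  obtain ⟨p, hp⟩ := hermiteFun_eq_poly n
  obtain ⟨q, hq⟩ := hermiteFun_eq_poly m
  refine (integrable_poly_gauss (p * q)).congr (Filter.Eventually.of_forall fun x => ?_)
  have : Real.exp (-x ^ 2) = Real.exp (-x ^ 2 / 2) * Real.exp (-x ^ 2 / 2) := by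
    rw [← Real.exp_add]
    ring_nf
  simp only [hp, hq, Polynomial.eval_mul, this]
  ring

theorem continuous_hermiteFun (n : ℕ) : Continuous (hermiteFun n) :=
  continuous_iff_continuousAt.2 fun x => (hasDerivAt_hermiteFun n x).continuousAt

theorem integral_ladder (n m : ℕ) :
    √((n : ℝ) + 1) * ∫ x, hermiteFun (n + 1) x * hermiteFun m x
      = √(m : ℝ) * ∫ x, hermiteFun n x * hermiteFun (m - 1) x := by
  have I := integrable_hermiteFun_mul
  have h0 : √2 ≠ (0 : ℝ) := by positivity
  have lin : ∀ (a b c : ℝ) (k l k' l' : ℕ),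
      Integrable (fun x => (a * (hermiteFun k x * hermiteFun l x)
        + b * (hermiteFun k' x * hermiteFun l' x)) / c) := fun a b c k l k' l' =>
    (((I k l).const_mul a).add ((I k' l').const_mul b)).div_const c
  have linI : ∀ (a b c : ℝ) (k l k' l' : ℕ),
      ∫ x, (a * (hermiteFun k x * hermiteFun l x)
        + b * (hermiteFun k' x * hermiteFun l' x)) / c
      = (a * (∫ x, hermiteFun k x * hermiteFun l x)
        + b * ∫ x, hermiteFun k' x * hermiteFun l' x) / c := fun a b c k l k' l' => by
    rw [integral_div, integral_add ((I k l).const_mul a) ((I k' l').const_mul b),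
      integral_const_mul, integral_const_mul]
  have e1 : ∀ x, hermiteFun n x *
      ((√(m : ℝ) * hermiteFun (m - 1) x - √((m : ℝ) + 1) * hermiteFun (m + 1) x) / √2)
      = (√(m : ℝ) * (hermiteFun n x * hermiteFun (m - 1) x)
        + (-√((m : ℝ) + 1)) * (hermiteFun n x * hermiteFun (m + 1) x)) / √2 := fun x => by ring
  have e2 : ∀ x,
      ((√(n : ℝ) * hermiteFun (n - 1) x - √((n : ℝ) + 1) * hermiteFun (n + 1) x) / √2)
        * hermiteFun m x
      = (√(n : ℝ) * (hermiteFun (n - 1) x * hermiteFun m x)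
        + (-√((n : ℝ) + 1)) * (hermiteFun (n + 1) x * hermiteFun m x)) / √2 := fun x => by ring
  have parts := integral_mul_deriv_eq_deriv_mul_of_integrable
    (fun x _ => hasDerivAt_hermiteFun n x) (fun x _ => hasDerivAt_hermiteFun m x)
    ((lin (√(m : ℝ)) (-√((m : ℝ) + 1)) (√2) n (m - 1) n (m + 1)).congr
      (Filter.Eventually.of_forall fun x => (e1 x).symm))
    ((lin (√(n : ℝ)) (-√((n : ℝ) + 1)) (√2) (n - 1) m (n + 1) m).congr
      (Filter.Eventually.of_forall fun x => (e2 x).symm))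
    (I n m)
  simp only [e1, e2] at parts
  rw [linI, linI] at parts
  have mult : ∫ x, (√(m : ℝ) * (hermiteFun n x * hermiteFun (m - 1) x)
        + √((m : ℝ) + 1) * (hermiteFun n x * hermiteFun (m + 1) x)) / √2
      = ∫ x, (√(n : ℝ) * (hermiteFun (n - 1) x * hermiteFun m x)
        + √((n : ℝ) + 1) * (hermiteFun (n + 1) x * hermiteFun m x)) / √2 := by
    refine integral_congr_ae (Filter.Eventually.of_forall fun x => ?_)
    have a1 := mul_hermiteFun n x
    have a2 := mul_hermiteFun m x
    simp only
    calc _ = hermiteFun n x * (x * hermiteFun m x) := by rw [a2]; ring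
      _ = (x * hermiteFun n x) * hermiteFun m x := by ring
      _ = _ := by rw [a1]; ring
  rw [linI, linI] at mult
  field_simp at parts mult
  linarith

theorem integral_hermiteFun_mul (n m : ℕ) :
    ∫ x, hermiteFun n x * hermiteFun m x = if n = m then 1 else 0 := by
  induction n generalizing m with
  | zero =>
    cases m with
    | zero =>
      have h1 : ∀ x, hermiteFun 0 x * hermiteFun 0 x = Real.exp (-1 * x ^ 2) / √Real.pi := by
        intro x
        have h2 : √(√Real.pi) * √(√Real.pi) = √Real.pi := Real.mul_self_sqrt (by positivity)
        have h3 : Real.exp (-1 * x ^ 2) = Real.exp (-x ^ 2 / 2) * Real.exp (-x ^ 2 / 2) := by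
          rw [← Real.exp_add]
          ring_nf
        rw [h3, ← h2]
        simp only [hermiteFun, Polynomial.hermite_zero, Nat.factorial_zero, Nat.cast_one, one_mul,
          map_one]
        rw [div_mul_div_comm]
      simp only [h1]
      rw [integral_div, integral_gaussian]
      have : 0 < √Real.pi := by positivity
      simp [this.ne']
    | succ m =>
      have h := integral_ladder m 0
      have h' : 0 < √((m : ℝ) + 1) := by positivity
      simp only [Nat.cast_zero, Real.sqrt_zero, zero_mul, mul_eq_zero, h'.ne', false_or] at h
      simp only [mul_comm (hermiteFun 0 _), h]
      simp
  | succ n ih =>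
    have h' : 0 < √((n : ℝ) + 1) := by positivity
    have h := integral_ladder n m
    cases m with
    | zero =>
      simp only [Nat.cast_zero, Real.sqrt_zero, zero_mul, mul_eq_zero, h'.ne', false_or] at h
      simp [h]
    | succ m =>
      rw [Nat.add_sub_cancel, ih] at h
      by_cases hnm : n = m
      · subst hnm
        simp only [if_true, mul_one] at h
        push_cast at h
        simp only [if_true]
        exact mul_left_cancel₀ h'.ne' (by rw [h, mul_one])
      · simp only [hnm, if_false, mul_zero, mul_eq_zero, h'.ne', false_or] at h
        simp [h, hnm]

/-- `L²(ℝ)`, the space of wave functions of one mode. -/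
abbrev WaveFunctions : Type := Lp ℂ 2 (volume : Measure ℝ)

theorem memLp_hermiteFun (n : ℕ) :
    MemLp (fun x : ℝ => (hermiteFun n x : ℂ)) 2 (volume : Measure ℝ) := by
  have hm : AEStronglyMeasurable (fun x : ℝ => (hermiteFun n x : ℂ)) volume :=
    (Complex.continuous_ofReal.comp (continuous_hermiteFun n)).aestronglyMeasurable
  rw [memLp_two_iff_integrable_sq_norm hm]
  refine (integrable_hermiteFun_mul n n).congr (Filter.Eventually.of_forall fun x => ?_)
  simp [pow_two]

/-- The position wave function of `|n⟩`, as an element of `L²(ℝ)`. -/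
def fockWave (n : ℕ) : WaveFunctions := (memLp_hermiteFun n).toLp _

theorem orthonormal_fockWave : Orthonormal ℂ fockWave := by
  classical
  rw [orthonormal_iff_ite]
  intro n m
  rw [L2.inner_def]
  have h : ∀ᵐ x : ℝ, inner ℂ (fockWave n x) (fockWave m x)
      = ((hermiteFun n x * hermiteFun m x : ℝ) : ℂ) := by
    filter_upwards [(memLp_hermiteFun n).coeFn_toLp, (memLp_hermiteFun m).coeFn_toLp] with x h1 h2
    rw [fockWave, fockWave, h1, h2]
    simp [mul_comm]
  rw [integral_congr_ae h, integral_complex_ofReal, integral_hermiteFun_mul]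
  split_ifs <;> simp

/-- The momentum wave function of `|n⟩` is `(-i)ⁿ` times its position wave function (the Fourier
transform with kernel `(2π)^{-1/2} e^{-ipx}` of the `n`-th Hermite function). -/
theorem orthonormal_fockWave_momentum :
    Orthonormal ℂ fun n : ℕ => (-Complex.I) ^ n • fockWave n := by
  refine ⟨fun n => ?_, fun n m hnm => ?_⟩
  · rw [norm_smul, orthonormal_fockWave.1 n]
    simp
  · change inner ℂ ((-Complex.I) ^ n • fockWave n) ((-Complex.I) ^ m • fockWave m) = 0
    rw [inner_smul_left, inner_smul_right, orthonormal_fockWave.2 hnm]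
    simp

/-- The position representation `|n⟩ ↦ hₙ`, in which `q̂` is multiplication by `x`. -/
def positionRep : FockSpace ℕ →ₗᵢ[ℂ] WaveFunctions :=
  orthonormal_fockWave.orthogonalFamily.linearIsometry

/-- The momentum representation `|n⟩ ↦ (-i)ⁿ hₙ`, in which `p̂` is multiplication by `x`. -/
def momentumRep : FockSpace ℕ →ₗᵢ[ℂ] WaveFunctions :=
  orthonormal_fockWave_momentum.orthogonalFamily.linearIsometry

theorem positionRep_ket (n : ℕ) : positionRep (ket n) = fockWave n := by
  rw [positionRep, ket, OrthogonalFamily.linearIsometry_apply_single]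
  simp

theorem momentumRep_ket (n : ℕ) : momentumRep (ket n) = (-Complex.I) ^ n • fockWave n := by
  rw [momentumRep, ket, OrthogonalFamily.linearIsometry_apply_single]
  simp

/-- `â|n⟩ = √n |n-1⟩`. -/
def lowerKet (n : ℕ) : FockSpace ℕ := (√(n : ℝ) : ℂ) • ket (n - 1)

/-- `â†|n⟩ = √(n+1) |n+1⟩`. -/
def raiseKet (n : ℕ) : FockSpace ℕ := (√((n : ℝ) + 1) : ℂ) • ket (n + 1)

/-- `q̂ = (â + â†)/√2` is multiplication by `x` in the position representation. -/
theorem positionRep_quadrature (n : ℕ) :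
    positionRep ((1 / (√2 : ℂ)) • (lowerKet n + raiseKet n))
      =ᵐ[volume] fun x => (x : ℂ) * positionRep (ket n) x := by
  simp only [lowerKet, raiseKet, map_smul, map_add, positionRep_ket]
  filter_upwards [Lp.coeFn_smul (1 / (√2 : ℂ)) ((√(n : ℝ) : ℂ) • fockWave (n - 1)
      + (√((n : ℝ) + 1) : ℂ) • fockWave (n + 1)),
    Lp.coeFn_add ((√(n : ℝ) : ℂ) • fockWave (n - 1)) ((√((n : ℝ) + 1) : ℂ) • fockWave (n + 1)),
    Lp.coeFn_smul (√(n : ℝ) : ℂ) (fockWave (n - 1)),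
    Lp.coeFn_smul (√((n : ℝ) + 1) : ℂ) (fockWave (n + 1)),
    (memLp_hermiteFun n).coeFn_toLp, (memLp_hermiteFun (n - 1)).coeFn_toLp,
    (memLp_hermiteFun (n + 1)).coeFn_toLp] with x h1 h2 h3 h4 h5 h6 h7
  rw [h1, Pi.smul_apply, h2, Pi.add_apply, h3, h4, Pi.smul_apply, Pi.smul_apply, fockWave, fockWave,
    fockWave, h5, h6, h7, ← Complex.ofReal_mul, mul_hermiteFun]
  simp only [smul_eq_mul]
  push_cast
  ring

/-- `p̂ = (â - â†)/(√2 i)` is multiplication by `x` in the momentum representation. -/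
theorem momentumRep_quadrature (n : ℕ) :
    momentumRep ((1 / ((√2 : ℂ) * Complex.I)) • (lowerKet n - raiseKet n))
      =ᵐ[volume] fun x => (x : ℂ) * momentumRep (ket n) x := by
  have key : momentumRep ((1 / ((√2 : ℂ) * Complex.I)) • (lowerKet n - raiseKet n))
      = (-Complex.I) ^ n • positionRep ((1 / (√2 : ℂ)) • (lowerKet n + raiseKet n)) := by
    simp only [lowerKet, raiseKet, map_smul, map_add, map_sub, positionRep_ket, momentumRep_ket]
    cases n with
    | zero =>
      have hs : (√2 : ℂ) ≠ 0 := by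
        exact_mod_cast (by positivity : (√2 : ℝ) ≠ 0)
      have hI0 := Complex.I_ne_zero
      simp only [Nat.cast_zero, Real.sqrt_zero, Complex.ofReal_zero, zero_smul, zero_sub,
        zero_add, Real.sqrt_one, Complex.ofReal_one, one_smul, pow_one, pow_zero, smul_neg,
        neg_smul, neg_neg, smul_smul, zero_mul]
      congr 1
      field_simp
    | succ n =>
      simp only [Nat.add_sub_cancel, smul_add, smul_smul, sub_eq_add_neg, ← neg_smul]
      have hI : Complex.I * Complex.I = -1 := Complex.I_mul_I
      have hI0 := Complex.I_ne_zero
      have hs : (√2 : ℂ) ≠ 0 := by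
        exact_mod_cast (by positivity : (√2 : ℝ) ≠ 0)
      congr 2
      · rw [pow_succ]
        field_simp
        linear_combination hI
      · rw [pow_succ, pow_succ]
        field_simp
  rw [key, momentumRep_ket]
  filter_upwards [positionRep_quadrature n,
    Lp.coeFn_smul ((-Complex.I) ^ n) (positionRep ((1 / (√2 : ℂ)) • (lowerKet n + raiseKet n))),
    Lp.coeFn_smul ((-Complex.I) ^ n) (fockWave n)] with x h1 h2 h3
  rw [h2, h3, Pi.smul_apply, Pi.smul_apply, h1, positionRep_ket]
  simp only [smul_eq_mul]
  ring

/-- For a representation `W` in which a quadrature is multiplication by `x`, the spectral projection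
`W† 1_B W` of that quadrature on `B`: `⟨ψ, spectralProj W B ψ⟩ = ∫_B |Wψ|²`. -/
def spectralProj (W : FockSpace ℕ →ₗᵢ[ℂ] WaveFunctions) (B : Set ℝ) : Op ℕ :=
  let T : FockSpace ℕ →L[ℂ] Lp ℂ 2 ((volume : Measure ℝ).restrict B) :=
    (LpToLpRestrictCLM ℝ ℂ ℂ volume 2 B).comp W.toContinuousLinearMap
  (ContinuousLinearMap.adjoint T).comp T

/-! ### The two tests -/

/-- `U₁ = ½ P^{q² ≥ d₀/2} + ½ P^{p² ≥ d₀/2}`: homodyne detection of a random one of `q̂`, `p̂`, with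
threshold `d₀/2` for the square of the outcome. -/
def homodyneEffect (d₀ : ℝ) : Op ℕ :=
  (1 / 2 : ℂ) • spectralProj positionRep {x | d₀ / 2 ≤ x ^ 2}
    + (1 / 2 : ℂ) • spectralProj momentumRep {x | d₀ / 2 ≤ x ^ 2}

open Classical in
/-- `V₁ = ∑_{n ≥ d₀} |n⟩⟨n|`: photon number at least `d₀`. -/
def photonEffect (d₀ : ℝ) : Op ℕ :=
  LinearMap.mkContinuous
    { toFun := fun ψ => ⟨fun n => if d₀ ≤ (n : ℝ) then ψ n else 0, memlp_of_summable_sq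
        (Summable.of_nonneg_of_le (fun n => sq_nonneg _)
          (fun n => by split_ifs <;> simp) (summable_sq ψ))⟩
      map_add' := fun ψ φ => by
        ext n
        change (if d₀ ≤ (n : ℝ) then ψ n + φ n else 0)
          = (if d₀ ≤ (n : ℝ) then ψ n else 0) + (if d₀ ≤ (n : ℝ) then φ n else 0)
        split_ifs <;> simp
      map_smul' := fun c ψ => by
        ext n
        change (if d₀ ≤ (n : ℝ) then c * ψ n else 0) = c * (if d₀ ≤ (n : ℝ) then ψ n else 0)
        split_ifs <;> simp }
    1 (fun ψ => by
      rw [one_mul]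
      refine lp.norm_mono (by simp) fun n => ?_
      change ‖(if d₀ ≤ (n : ℝ) then ψ n else 0 : ℂ)‖ ≤ ‖ψ n‖
      split_ifs <;> simp)

/-- `U A^{(j)} U†`: the one-mode operator `A` acting on the `j`-th of the `k` modes of a register,
conjugated by the `k`-mode unitary `U`. -/
def registerEffect {k : ℕ} (U : Op (Fin k → ℕ)) (j : Fin k) (A : Op ℕ) : Op (Fin k → ℕ) :=
  U * atSite j A * star U

/-- The two-outcome POVM `{1 - E, E}`, with outcome `0` for `1 - E` and outcome `1` for `E`. -/
def binaryPOVM {β : Type} (E : Op β) : Fin 2 → Op β := ![1 - E, E]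

/-- The probability `tr(ρ · M_{z₁} ⊗ ⋯ ⊗ M_{z_K} ⊗ M'_{y₁} ⊗ ⋯ ⊗ M'_{y_N})` of the outcomes
`(z, y)`, when the POVM `{1 - E, E}` is measured on each of the first `K` registers and the POVM
`{1 - F, F}` on each of the other `N` registers of the state `ρ`. -/
def outcomeProb {K N : ℕ} {β : Type} [DecidableEq β] (ρ : Op (Fin (K + N) → β)) (E F : Op β)
    (z : Fin K → Fin 2) (y : Fin N → Fin 2) : ℝ :=
  (trace (ρ * tensorOp (Fin.append (fun i => binaryPOVM E (z i)) (fun i => binaryPOVM F (y i))))).re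

/-- The probability of the event `∑ᵢ zᵢ ≤ R` and `∑ᵢ yᵢ > Q`. -/
def jointProb {K N : ℕ} {β : Type} [DecidableEq β] (ρ : Op (Fin (K + N) → β)) (E F : Op β)
    (R Q : ℕ) : ℝ :=
  ∑ zy : (Fin K → Fin 2) × (Fin N → Fin 2) with
      (∑ i, (zy.1 i : ℕ)) ≤ R ∧ Q < ∑ i, (zy.2 i : ℕ),
    outcomeProb ρ E F zy.1 zy.2

/-- `c₀ = 1 - 1/√2`. -/
def c₀ : ℝ := 1 - 1 / √2

end CVVerification

end

noncomputable section

namespace CVVerification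

/-! ### Operators in the number basis -/

section Basis

variable {β : Type} [DecidableEq β]

/-! The heart is an operator inequality for one mode, `smul_photonEffect_le`: `p V₁ ≤ 2(1-e) U₁ +
2e`, with `p` above `1/2` and `e` small. It comes from the Husimi function. Its position marginal is
the position density convolved with a Gaussian of variance `1/2`, and a quarter turn of phase space
gives the same for momentum. Outside the disc of radius `√2 b` at least one of `q² ≥ b²`, `p² ≥ b²`
holds, so the Husimi weight there is bounded by the two homodyne tails plus the probability `e` that
the Gaussian noise carries a point from `x² < d₀/2` to `x² ≥ b²`. Rotation invariance makes this
weight diagonal in the number basis. For `n ≥ d₀` the radial density peaks near `√(2n)`, beyond `√2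
b`, so `|n⟩` has more than half of its mass outside. The value of `c₀` makes `√(2d₀) = √2 (√(d₀/2) +
L)` with `L² = ln (N/R)`: between the homodyne threshold and the photon threshold there is room for
a noise of size `L`, whose probability is of order `R/N`.

The inequality passes to a register by conjugation with `U`. Tests of type `U₁` and `V₁` need not
commute, so they cannot be sampled from one joint distribution. Instead the event is bounded by an
exponential moment (`jointProb_le_exp_mul`), which is the expectation of a tensor product of
positive operators. On the first `K` registers the factor `1 - (1 - e^{-λ})E` is dominated by an
affine function of `F`, and positivity of the state on tensor products allows this replacement
factor by factor (`IsSymmetricState.mono`). Then only the test `F` is left, on all registers. Its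
outcomes are exchangeable, and a Maclaurin type inequality for sampling without replacement
(`sum_perm_prod_le`) bounds the moment; this is `jointProb_le`.

It remains to choose parameters. With `r = R/K` and `t = Q/N` the exponent per test register is `λ r
+ (1 - e^{-λ}) e / (1 - e) - m t`. As `p ≈ 1/2`, the gain `m` is about `λ/4` for small `λ`, which is
why the threshold is `t = 4r`. There the leading terms cancel, and the sign is decided at second
order, where the excess of `p` over `1/2` must beat the leakage `e`. All estimates are made in the
single variable `s` with `r = 2 exp(-1/s²)`, taking `λ = s/4`, or `λ = 1/2` if `s` is small and `t >
8r` (`exists_exponent`). -/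

theorem ket_apply (b c : β) : ket b c = if c = b then 1 else 0 := by
  rw [ket, lp.single_apply]
  split_ifs with h
  · subst h; simp
  · simp [h]

theorem inner_ket (b : β) (ψ : FockSpace β) : inner ℂ (ket b) ψ = ψ b := by
  rw [ket, lp.inner_single_left]
  simp

theorem op_ext {A B : Op β} (h : ∀ b, A (ket b) = B (ket b)) : A = B := by
  refine lp.ext_continuousLinearMap (by norm_num) fun b => ?_
  ext1
  simpa [lp.singleContinuousLinearMap_apply, ket] using h b

theorem star_apply_ket (A : Op β) (a c : β) :
    (star A) (ket a) c = (starRingEnd ℂ) (A (ket c) a) := by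
  rw [← inner_ket c, ContinuousLinearMap.star_eq_adjoint, ContinuousLinearMap.adjoint_inner_right,
    ← inner_conj_symm, inner_ket]

end Basis

/-! ### `atSite` is a `*`-homomorphism -/

section Site

variable {ι β : Type} [DecidableEq ι]

theorem slice_update (i : ι) (ψ : FockSpace (ι → β)) (a : ι → β) (b : β) :
    slice i ψ (Function.update a i b) = slice i ψ a := by
  ext c
  simp [slice_apply]

theorem atSite_add (i : ι) (A B : Op β) : atSite i (A + B) = atSite i A + atSite i B := by
  ext ψ a
  rfl

theorem atSite_smul (i : ι) (c : ℂ) (A : Op β) : atSite i (c • A) = c • atSite i A := by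
  ext ψ a
  rfl

theorem atSite_one (i : ι) : atSite i (1 : Op β) = 1 := by
  ext ψ a
  simp [atSite_apply, slice_apply]

theorem slice_atSite (i : ι) (A : Op β) (ψ : FockSpace (ι → β)) (a : ι → β) :
    slice i (atSite i A ψ) a = A (slice i ψ a) := by
  ext b
  rw [slice_apply, atSite_apply, slice_update]
  simp

theorem atSite_mul (i : ι) (A B : Op β) : atSite i (A * B) = atSite i A * atSite i B := by
  ext ψ a
  rw [atSite_apply, mul_apply_eq_comp, mul_apply_eq_comp, atSite_apply,
    slice_atSite]

/-- `atSite i` as a linear map. -/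
def atSiteLinear (i : ι) : Op β →ₗ[ℂ] Op (ι → β) where
  toFun := atSite i
  map_add' := atSite_add i
  map_smul' := atSite_smul i

section Ket

variable [DecidableEq β] [DecidableEq (ι → β)]

open Classical in
theorem slice_ket (i : ι) (a c : ι → β) :
    slice i (ket a) c = if ∀ j, j ≠ i → c j = a j then ket (a i) else 0 := by
  ext b
  rw [slice_apply, ket_apply]
  by_cases h : ∀ j, j ≠ i → c j = a j
  · rw [if_pos h, ket_apply]
    refine if_congr ⟨fun h' => by simpa using congrFun h' i, fun h' => ?_⟩ rfl rfl
    funext j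
    by_cases hj : j = i
    · subst hj; simpa using h'
    · simpa [hj] using h j hj
  · rw [if_neg h, if_neg]
    · rfl
    · intro h'
      refine h fun j hj => ?_
      simpa [hj] using congrFun h' j

open Classical in
theorem atSite_ket_apply (i : ι) (A : Op β) (a c : ι → β) :
    atSite i A (ket a) c = if ∀ j, j ≠ i → c j = a j then A (ket (a i)) (c i) else 0 := by
  rw [atSite_apply, slice_ket]
  split_ifs <;> simp

open Classical in
-- These matrix elements are symmetric under exchange of `(i, A)` and `(j, B)`, which yields
-- `atSite_commute`.
theorem atSite_mul_ket_apply {i j : ι} (hij : i ≠ j) (A B : Op β) (a c : ι → β) :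
    (atSite i A * atSite j B) (ket a) c
      = if ∀ l, l ≠ i → l ≠ j → c l = a l then A (ket (a i)) (c i) * B (ket (a j)) (c j)
        else 0 := by
  rw [mul_apply_eq_comp, atSite_apply]
  have : slice i (atSite j B (ket a)) c
      = (if ∀ l, l ≠ i → l ≠ j → c l = a l then B (ket (a j)) (c j) else 0) • ket (a i) := by
    ext b
    rw [slice_apply, atSite_ket_apply]
    change _ = _ * ket (a i) b
    rw [ket_apply, Function.update_of_ne hij.symm]
    by_cases h : ∀ l, l ≠ i → l ≠ j → c l = a l
    · rw [if_pos h]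
      by_cases hb : b = a i
      · rw [if_pos hb, if_pos, mul_one]
        intro l hl
        by_cases hli : l = i
        · subst hli; simpa using hb
        · simpa [hli] using h l hli hl
      · rw [if_neg hb, if_neg, mul_zero]
        intro h'
        exact hb (by simpa using h' i hij)
    · rw [if_neg h, zero_mul, if_neg]
      intro h'
      refine h fun l hl hl' => ?_
      simpa [hl] using h' l hl'
  rw [this, map_smul]
  change _ * A (ket (a i)) (c i) = _
  split_ifs <;> ring

end Ket

theorem atSite_commute {i j : ι} (hij : i ≠ j) (A B : Op β) :
    Commute (atSite i A) (atSite j B) := by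
  classical
  refine op_ext fun a => ?_
  ext c
  rw [atSite_mul_ket_apply hij, atSite_mul_ket_apply hij.symm]
  refine if_congr ⟨fun h l h1 h2 => h l h2 h1, fun h l h1 h2 => h l h2 h1⟩ (mul_comm _ _) rfl

theorem atSite_star (i : ι) (A : Op β) : atSite i (star A) = star (atSite i A) := by
  classical
  refine op_ext fun a => ?_
  ext c
  rw [star_apply_ket, atSite_ket_apply, atSite_ket_apply, star_apply_ket, apply_ite (starRingEnd ℂ),
    map_zero]
  exact if_congr ⟨fun h j hj => (h j hj).symm, fun h j hj => (h j hj).symm⟩ rfl rfl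

section Hilbert

variable {H : Type} [NormedAddCommGroup H] [InnerProductSpace ℂ H] [CompleteSpace H]

theorem exists_nonneg_mul_self {A : H →L[ℂ] H} (hA : 0 ≤ A) :
    ∃ X : H →L[ℂ] H, 0 ≤ X ∧ A = X * X :=
  ⟨CFC.sqrt A, CFC.sqrt_nonneg A, (CFC.sqrt_mul_sqrt_self A hA).symm⟩

theorem commute_mul_nonneg {A B : H →L[ℂ] H} (hA : 0 ≤ A) (hB : 0 ≤ B) (h : Commute A B) :
    0 ≤ A * B := h.mul_nonneg hA hB

end Hilbert

/-- With `X = √A` the operator becomes `star Y * Y` for `Y = atSite i X`, as `atSite i` is a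
`*`-homomorphism. -/
theorem atSite_nonneg (i : ι) {A : Op β} (hA : 0 ≤ A) : 0 ≤ atSite i A := by
  obtain ⟨X, hX, rfl⟩ := exists_nonneg_mul_self hA
  nth_rewrite 1 [← hX.isSelfAdjoint.star_eq]
  rw [atSite_mul, atSite_star]
  exact star_mul_self_nonneg _

end Site

/-! ### Tensor products of operators -/

section Tensor

variable {n : ℕ} {β : Type}

/-- `tensorOp` as a multilinear map. -/
def tensorMultilinear (n : ℕ) (β : Type) :
    MultilinearMap ℂ (fun _ : Fin n => Op β) (Op (Fin n → β)) :=
  (MultilinearMap.mkPiAlgebraFin ℂ n (Op (Fin n → β))).compLinearMap fun i => atSiteLinear i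

theorem list_prod_nonneg {M : Type} (l : List (Op M)) (h : ∀ a ∈ l, 0 ≤ a)
    (hc : l.Pairwise Commute) : 0 ≤ l.prod := by
  induction l with
  | nil => simp
  | cons a l ih =>
    rw [List.pairwise_cons] at hc
    rw [List.prod_cons]
    refine commute_mul_nonneg (h a (by simp)) (ih (fun b hb => h b (by simp [hb])) hc.2) ?_
    exact Commute.list_prod_right _ _ hc.1

theorem pairwise_commute_ofFn_atSite (A : Fin n → Op β) (σ : Fin n → Fin n)
    (hσ : Function.Injective σ) :
    (List.ofFn fun i => atSite (σ i) (A i)).Pairwise Commute := by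
  rw [List.pairwise_ofFn]
  exact fun i j hij => atSite_commute (fun h => hij.ne (hσ h)) _ _

theorem tensorOp_nonneg {A : Fin n → Op β} (hA : ∀ i, 0 ≤ A i) : 0 ≤ tensorOp A := by
  refine list_prod_nonneg _ ?_ (pairwise_commute_ofFn_atSite A id Function.injective_id)
  intro a ha
  obtain ⟨i, rfl⟩ := (List.mem_ofFn' _ _).1 ha
  exact atSite_nonneg i (hA i)

theorem tensorOp_one : tensorOp (fun _ : Fin n => (1 : Op β)) = 1 := by
  simp only [tensorOp, atSite_one]
  rw [List.ofFn_const, List.prod_replicate, one_pow]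

theorem permOp_apply (π : Equiv.Perm (Fin n)) (ψ : FockSpace (Fin n → β)) (a : Fin n → β) :
    permOp π ψ a = ψ (a ∘ π) := rfl

theorem permOp_mul_atSite (π : Equiv.Perm (Fin n)) (i : Fin n) (A : Op β) :
    permOp π * atSite i A = atSite (π i) A * permOp π := by
  ext ψ a
  rw [mul_apply_eq_comp, mul_apply_eq_comp, permOp_apply, atSite_apply,
    atSite_apply]
  have : slice i ψ (a ∘ π) = slice (π i) (permOp π ψ) a := by
    ext b
    rw [slice_apply, slice_apply, permOp_apply]
    refine congrArg (fun t => ψ t) (funext fun l => ?_)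
    by_cases hl : l = i
    · subst hl; simp
    · simp [hl]
  rw [this]
  rfl

theorem permOp_mul_list_prod (π : Equiv.Perm (Fin n)) (l : List (Fin n × Op β)) :
    permOp π * (l.map fun x => atSite x.1 x.2).prod
      = (l.map fun x => atSite (π x.1) x.2).prod * permOp π := by
  induction l with
  | nil => simp
  | cons x l ih =>
    simp only [List.map_cons, List.prod_cons]
    rw [← mul_assoc, permOp_mul_atSite, mul_assoc, ih, mul_assoc]

/-- Moving `permOp π` through the product carries the factor at `i` to `π i`. The result is the
product for `A` in another order, which is harmless because operators on different sites commute. -/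
theorem permOp_mul_tensorOp (π : Equiv.Perm (Fin n)) (A : Fin n → Op β) :
    permOp π * tensorOp (A ∘ π) = tensorOp A * permOp π := by
  have h := permOp_mul_list_prod π (List.ofFn fun i => (i, A (π i)))
  rw [List.map_ofFn, List.map_ofFn] at h
  have e1 : tensorOp (A ∘ π)
      = (List.ofFn ((fun x : Fin n × Op β => atSite x.1 x.2) ∘ fun i => (i, A (π i)))).prod := rfl
  rw [e1, h]
  congr 1
  refine List.Perm.prod_eq' ?_ ?_
  · exact (π.ofFn_comp_perm fun i => atSite i (A i))
  · exact pairwise_commute_ofFn_atSite (A ∘ π) π π.injective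

end Tensor

/-! ### The expectation functional of a state -/

section State

variable {β : Type} [DecidableEq β]

/-- The square root of a state is Hilbert–Schmidt: `‖S|b⟩‖² = ⟨b|ρ|b⟩`. -/
theorem summable_sq_sqrt {ρ S : Op β} (hρ : IsState ρ) (hS : 0 ≤ S) (hSS : ρ = S * S) :
    Summable fun b => ‖S (ket b)‖ ^ 2 := by
  have h := (Complex.hasSum_re hρ.hasTrace_one).summable
  refine h.congr fun b => ?_
  have hsa : star S = S := hS.isSelfAdjoint.star_eq
  rw [hSS, mul_apply_eq_comp]
  nth_rewrite 1 [← hsa]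
  rw [ContinuousLinearMap.star_eq_adjoint, ContinuousLinearMap.adjoint_inner_right,
    inner_self_eq_norm_sq_to_K]
  norm_cast

theorem summable_sq_comp {S : Op β} (T : Op β) (h : Summable fun b => ‖S (ket b)‖ ^ 2) :
    Summable fun b => ‖T (S (ket b))‖ ^ 2 := by
  refine Summable.of_nonneg_of_le (fun b => sq_nonneg _) (fun b => ?_) (h.mul_left (‖T‖ ^ 2))
  rw [← mul_pow]
  exact pow_le_pow_left₀ (norm_nonneg _) (T.le_opNorm _) 2

theorem summable_prod_coord {S : Op β} (h : Summable fun b => ‖S (ket b)‖ ^ 2) :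
    Summable fun p : β × β => ‖S (ket p.1) p.2‖ ^ 2 := by
  refine (summable_prod_of_nonneg (f := fun p : β × β => ‖S (ket p.1) p.2‖ ^ 2)
    (fun p => sq_nonneg _)).2 ⟨fun b => summable_sq (S (ket b)), ?_⟩
  exact h.congr fun b => norm_sq_eq (S (ket b))

/-- Cyclicity, `tr(SST) = tr(STS)`. Both sides are iterated sums of the same matrix elements, and
Fubini applies because `S` and `star T * S` are Hilbert–Schmidt. Linearity and positivity of `T ↦
tr(ρT)` are read off from the right side. -/
theorem trace_mul_eq {ρ S : Op β} (hρ : IsState ρ) (hS : 0 ≤ S) (hSS : ρ = S * S) (T : Op β) :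
    trace (ρ * T) = ∑' b, inner ℂ (S (ket b)) (T (S (ket b))) := by
  have hsa : star S = S := hS.isSelfAdjoint.star_eq
  have hsum := summable_sq_sqrt hρ hS hSS
  have hsum' := summable_sq_comp (star T) hsum
  have h1 := summable_prod_coord hsum
  have h2 : Summable fun p : β × β => ‖(star T * S) (ket p.1) p.2‖ ^ 2 :=
    summable_prod_coord (S := star T * S) hsum'
  have hF : Summable fun p : β × β =>
      (starRingEnd ℂ) ((star T * S) (ket p.1) p.2) * S (ket p.1) p.2 := by
    refine Summable.of_norm_bounded (h1.add h2) fun p => ?_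
    rw [norm_mul, RCLike.norm_conj]
    nlinarith [sq_nonneg (‖(star T * S) (ket p.1) p.2‖ - ‖S (ket p.1) p.2‖),
      sq_nonneg (‖(star T * S) (ket p.1) p.2‖), sq_nonneg (‖S (ket p.1) p.2‖)]
  have inner_sum : ∀ ψ φ : FockSpace β,
      inner ℂ ψ φ = ∑' c, (starRingEnd ℂ) (ψ c) * φ c := by
    intro ψ φ
    rw [lp.inner_eq_tsum]
    refine tsum_congr fun c => ?_
    simp [mul_comm]
  have lhs : trace (ρ * T)
      = ∑' a, ∑' b, (starRingEnd ℂ) ((star T * S) (ket b) a) * S (ket b) a := by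
    refine tsum_congr fun a => ?_
    rw [hSS, mul_assoc, mul_apply_eq_comp]
    nth_rewrite 1 [← hsa]
    rw [ContinuousLinearMap.star_eq_adjoint, ContinuousLinearMap.adjoint_inner_right, inner_sum]
    refine tsum_congr fun b => ?_
    rw [← star_apply_ket S, hsa, mul_comm]
    congr 1
    rw [← star_apply_ket, star_mul, star_star, hsa]
  have rhs : ∑' b, inner ℂ (S (ket b)) (T (S (ket b)))
      = ∑' b, ∑' a, (starRingEnd ℂ) ((star T * S) (ket b) a) * S (ket b) a := by
    refine tsum_congr fun b => ?_
    rw [← inner_sum, mul_apply_eq_comp, ContinuousLinearMap.star_eq_adjoint,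
      ContinuousLinearMap.adjoint_inner_left]
  rw [lhs, rhs]
  exact hF.tsum_comm

theorem summable_inner_sqrt {S : Op β} (h : Summable fun b => ‖S (ket b)‖ ^ 2) (T : Op β) :
    Summable fun b => inner ℂ (S (ket b)) (T (S (ket b))) := by
  refine Summable.of_norm_bounded (h.mul_left ‖T‖) fun b => ?_
  refine (norm_inner_le_norm _ _).trans ?_
  have := T.le_opNorm (S (ket b))
  nlinarith [norm_nonneg (S (ket b))]

theorem exists_sqrt {ρ : Op β} (hρ : IsState ρ) : ∃ S : Op β, 0 ≤ S ∧ ρ = S * S :=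
  exists_nonneg_mul_self ((ContinuousLinearMap.nonneg_iff_isPositive ρ).2 hρ.isPositive)

/-- `T ↦ tr(ρ T)` as a linear functional. -/
def expectation {ρ : Op β} (hρ : IsState ρ) : Op β →ₗ[ℂ] ℂ where
  toFun T := trace (ρ * T)
  map_add' T T' := by
    obtain ⟨S, hS, hSS⟩ := exists_sqrt hρ
    have h := summable_sq_sqrt hρ hS hSS
    rw [trace_mul_eq hρ hS hSS, trace_mul_eq hρ hS hSS, trace_mul_eq hρ hS hSS,
      ← (summable_inner_sqrt h T).tsum_add (summable_inner_sqrt h T')]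
    exact tsum_congr fun b => by rw [add_apply, inner_add_right]
  map_smul' c T := by
    obtain ⟨S, hS, hSS⟩ := exists_sqrt hρ
    rw [trace_mul_eq hρ hS hSS, trace_mul_eq hρ hS hSS, RingHom.id_apply, smul_eq_mul,
      ← tsum_mul_left]
    exact tsum_congr fun b => by rw [smul_apply, inner_smul_right]

theorem expectation_apply {ρ : Op β} (hρ : IsState ρ) (T : Op β) :
    expectation hρ T = trace (ρ * T) := rfl

theorem expectation_nonneg {ρ : Op β} (hρ : IsState ρ) {T : Op β} (hT : 0 ≤ T) :
    0 ≤ (expectation hρ T).re := by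
  obtain ⟨S, hS, hSS⟩ := exists_sqrt hρ
  have h := summable_sq_sqrt hρ hS hSS
  rw [expectation_apply, trace_mul_eq hρ hS hSS, Complex.re_tsum (summable_inner_sqrt h T)]
  refine tsum_nonneg fun b => ?_
  rw [ContinuousLinearMap.nonneg_iff_isPositive] at hT
  exact hT.re_inner_nonneg_right _

theorem expectation_one {ρ : Op β} (hρ : IsState ρ) : expectation hρ 1 = 1 := by
  rw [expectation_apply, mul_one]
  exact hρ.hasTrace_one.tsum_eq

end State

/-! ### Invariance of expectations under permutations of the registers. -/

section Perm

variable {n : ℕ} {β : Type}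

theorem permOp_mul_permOp (π σ : Equiv.Perm (Fin n)) :
    (permOp π * permOp σ : Op (Fin n → β)) = permOp (π * σ) := by
  ext ψ a
  rfl

theorem permOp_one : (permOp (1 : Equiv.Perm (Fin n)) : Op (Fin n → β)) = 1 := by
  ext ψ a
  rfl

variable [DecidableEq β]

theorem permOp_ket (π : Equiv.Perm (Fin n)) (a : Fin n → β) :
    permOp π (ket a) = ket (a ∘ π.symm) := by
  ext c
  rw [permOp_apply, ket_apply, ket_apply]
  refine if_congr ⟨fun h => ?_, fun h => ?_⟩ rfl rfl
  · rw [← h]; funext i; simp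
  · rw [h]; funext i; simp

theorem trace_permOp_conj (π : Equiv.Perm (Fin n)) (T : Op (Fin n → β)) :
    trace (permOp π * T * permOp π.symm) = trace T := by
  unfold trace
  rw [← (Equiv.arrowCongr π (Equiv.refl β)).symm.tsum_eq fun a => inner ℂ (ket a) (T (ket a))]
  refine tsum_congr fun a => ?_
  rw [inner_ket, inner_ket, mul_apply_eq_comp, mul_apply_eq_comp, permOp_apply, permOp_ket]
  rfl

theorem expectation_tensorOp_perm {ρ : Op (Fin n → β)} (hρ : IsState ρ)
    (hperm : IsPermInvariant ρ) (π : Equiv.Perm (Fin n)) (A : Fin n → Op β) :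
    expectation hρ (tensorOp (A ∘ π)) = expectation hρ (tensorOp A) := by
  have hinv : (permOp π * permOp π.symm : Op (Fin n → β)) = 1 := by
    rw [permOp_mul_permOp, ← permOp_one]
    congr 1
    exact mul_inv_cancel π
  rw [expectation_apply, expectation_apply, ← trace_permOp_conj π]
  rw [← mul_assoc, hperm π, mul_assoc ρ, permOp_mul_tensorOp, mul_assoc, mul_assoc, hinv, mul_one]

end Perm

/-! ### Positive symmetric multilinear functionals of operators -/

section Functional

variable {n : ℕ} {β : Type}

/-- A functional `A ↦ Φ(A₀ ⊗ ⋯ ⊗ A_{n-1})` which is positive, symmetric and normalised. -/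
structure IsSymmetricState (Φ : MultilinearMap ℂ (fun _ : Fin n => Op β) ℂ) : Prop where
  nonneg : ∀ A : Fin n → Op β, (∀ i, 0 ≤ A i) → 0 ≤ (Φ A).re
  symm : ∀ (π : Equiv.Perm (Fin n)) (A : Fin n → Op β), Φ (A ∘ π) = Φ A
  one : Φ (fun _ => 1) = 1

/-- The multilinear functional `A ↦ tr(ρ A₀ ⊗ ⋯ ⊗ A_{n-1})`. -/
def productExpectation [DecidableEq β] {ρ : Op (Fin n → β)} (hρ : IsState ρ) :
    MultilinearMap ℂ (fun _ : Fin n => Op β) ℂ :=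
  (expectation hρ).compMultilinearMap (tensorMultilinear n β)

theorem isSymmetricState_productExpectation [DecidableEq β] {ρ : Op (Fin n → β)}
    (hρ : IsState ρ) (hperm : IsPermInvariant ρ) :
    IsSymmetricState (productExpectation hρ) where
  nonneg A hA := expectation_nonneg hρ (tensorOp_nonneg hA)
  symm π A := expectation_tensorOp_perm hρ hperm π A
  one := by
    change expectation hρ (tensorOp fun _ : Fin n => (1 : Op β)) = 1
    rw [tensorOp_one, expectation_one]

/-- Expand `B = A + (B - A)` in every slot: all terms are nonnegative, and one of them is `Φ A`. -/
theorem IsSymmetricState.mono {Φ : MultilinearMap ℂ (fun _ : Fin n => Op β) ℂ}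
    (hΦ : IsSymmetricState Φ) {A B : Fin n → Op β} (hA : ∀ i, 0 ≤ A i) (hAB : ∀ i, A i ≤ B i) :
    (Φ A).re ≤ (Φ B).re := by
  classical
  have h : B = A + (B - A) := by abel
  rw [h, Φ.map_add_univ, Complex.re_sum]
  have := Finset.single_le_sum (f := fun s : Finset (Fin n) => (Φ (s.piecewise A (B - A))).re)
    (fun s _ => hΦ.nonneg _ fun i => ?_) (Finset.mem_univ Finset.univ)
  · simpa using this
  · by_cases hi : i ∈ s
    · simpa [hi] using hA i
    · simpa [hi] using hAB i

end Functional

/-! ### Symmetric averages of products -/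

section Average

variable {ι : Type} [Fintype ι] [DecidableEq ι]

/-- For `i ∉ J` exchanging `i` and `l` gives equality. For `i ∈ J` the difference of the two sides,
symmetrised in `i` and `l`, is half of a sum of `(c (π i) - c (π l))²` times nonnegative products.
-/
theorem sum_perm_mul_prod_le (c : ι → ℝ) (hc : ∀ i, 0 ≤ c i) (J : Finset ι) {l : ι}
    (hl : l ∉ J) (i : ι) :
    ∑ π : Equiv.Perm ι, c (π l) * ∏ j ∈ J, c (π j)
      ≤ ∑ π : Equiv.Perm ι, c (π i) * ∏ j ∈ J, c (π j) := by
  by_cases hil : i = l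
  · rw [hil]
  have swap : ∀ f : Equiv.Perm ι → ℝ, ∑ π, f π = ∑ π, f (π * Equiv.swap i l) := fun f =>
    (Equiv.sum_comp (Equiv.mulRight (Equiv.swap i l)) f).symm
  by_cases hi : i ∈ J
  · have hprod : ∀ π : Equiv.Perm ι, ∏ j ∈ J, c (π j) = c (π i) * ∏ j ∈ J.erase i, c (π j) :=
      fun π => (Finset.mul_prod_erase J _ hi).symm
    have hinv : ∀ π : Equiv.Perm ι, ∏ j ∈ J.erase i, c ((π * Equiv.swap i l) j)
        = ∏ j ∈ J.erase i, c (π j) := by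
      refine fun π => Finset.prod_congr rfl fun j hj => ?_
      rw [Equiv.Perm.mul_apply, Equiv.swap_apply_of_ne_of_ne (Finset.ne_of_mem_erase hj)
        (by rintro rfl; exact hl (Finset.mem_of_mem_erase hj))]
    have h1 : ∑ π : Equiv.Perm ι, c (π i) * ∏ j ∈ J, c (π j)
        = ∑ π : Equiv.Perm ι, c (π l) * (c (π l) * ∏ j ∈ J.erase i, c (π j)) := by
      rw [swap]
      refine Finset.sum_congr rfl fun π _ => ?_
      rw [hprod, hinv]
      simp
    have h2 : 0 ≤ ∑ π : Equiv.Perm ι, (c (π i) - c (π l)) ^ 2 * ∏ j ∈ J.erase i, c (π j) :=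
      Finset.sum_nonneg fun π _ => mul_nonneg (sq_nonneg _) (Finset.prod_nonneg fun j _ => hc _)
    have h3 : ∑ π : Equiv.Perm ι, (c (π i) - c (π l)) ^ 2 * ∏ j ∈ J.erase i, c (π j)
        = (∑ π : Equiv.Perm ι, c (π i) * ∏ j ∈ J, c (π j))
          + (∑ π : Equiv.Perm ι, c (π l) * (c (π l) * ∏ j ∈ J.erase i, c (π j)))
          - 2 * ∑ π : Equiv.Perm ι, c (π l) * ∏ j ∈ J, c (π j) := by
      rw [Finset.mul_sum, ← Finset.sum_add_distrib, ← Finset.sum_sub_distrib]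
      refine Finset.sum_congr rfl fun π _ => ?_
      rw [hprod]
      ring
    rw [← h1] at h3
    linarith
  · refine le_of_eq ?_
    rw [swap]
    refine Finset.sum_congr rfl fun π _ => ?_
    congr 1
    · simp
    · refine Finset.prod_congr rfl fun j hj => ?_
      rw [Equiv.Perm.mul_apply, Equiv.swap_apply_of_ne_of_ne (by rintro rfl; exact hi hj)
        (by rintro rfl; exact hl hj)]

/-- Sampling without replacement: a form of Maclaurin's inequality for symmetric means. -/
theorem sum_perm_prod_le (c : ι → ℝ) (hc : ∀ i, 0 ≤ c i) (J : Finset ι) :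
    ∑ π : Equiv.Perm ι, ∏ j ∈ J, c (π j)
      ≤ (Fintype.card (Equiv.Perm ι) : ℝ) * ((∑ i, c i) / Fintype.card ι) ^ J.card := by
  induction J using Finset.induction_on with
  | empty => simp
  | insert l J hl ih =>
    have hcard : (0 : ℝ) < Fintype.card ι := by
      have : Nonempty ι := ⟨l⟩
      exact_mod_cast Fintype.card_pos
    have hS : 0 ≤ ∑ i, c i := Finset.sum_nonneg fun i _ => hc i
    -- Averaging over `i` replaces the new position `l` by a uniform one, for which `∑ i, c (π i)`
    -- no longer depends on `π`.
    have key : (Fintype.card ι : ℝ) * ∑ π : Equiv.Perm ι, c (π l) * ∏ j ∈ J, c (π j)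
        ≤ (∑ i, c i) * ∑ π : Equiv.Perm ι, ∏ j ∈ J, c (π j) := by
      calc (Fintype.card ι : ℝ) * ∑ π : Equiv.Perm ι, c (π l) * ∏ j ∈ J, c (π j)
          = ∑ _i : ι, ∑ π : Equiv.Perm ι, c (π l) * ∏ j ∈ J, c (π j) := by
            rw [Finset.sum_const, Finset.card_univ, nsmul_eq_mul]
        _ ≤ ∑ i : ι, ∑ π : Equiv.Perm ι, c (π i) * ∏ j ∈ J, c (π j) :=
            Finset.sum_le_sum fun i _ => sum_perm_mul_prod_le c hc J hl i
        _ = _ := by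
            rw [Finset.sum_comm, Finset.mul_sum]
            refine Finset.sum_congr rfl fun π _ => ?_
            rw [← Finset.sum_mul, Equiv.sum_comp π c]
    simp only [Finset.prod_insert hl]
    rw [Finset.card_insert_of_notMem hl, pow_succ, ← mul_assoc]
    calc _ ≤ (∑ i, c i) / Fintype.card ι * ∑ π : Equiv.Perm ι, ∏ j ∈ J, c (π j) := by
          rw [div_mul_eq_mul_div, le_div_iff₀ hcard]
          linarith
      _ ≤ _ := by
          rw [mul_comm]
          exact mul_le_mul_of_nonneg_right ih (by positivity)

end Average

/-! ### Weighted sums over outcome strings. -/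

section Weights

variable {n : ℕ} {β : Type}

/-- Multilinearity absorbs a product weight into the operators. It is used in both directions: from
outcome sums to tensor products, and back after the tests have been exchanged. -/
theorem sum_weight_mul_re (Φ : MultilinearMap ℂ (fun _ : Fin n => Op β) ℂ)
    (c : Fin n → Fin 2 → ℝ) (G : Fin n → Fin 2 → Op β) :
    ∑ w : Fin n → Fin 2, (∏ i, c i (w i)) * (Φ fun i => G i (w i)).re
      = (Φ fun i => ∑ j, (c i j : ℂ) • G i j).re := by
  rw [Φ.map_sum, Complex.re_sum]
  refine Finset.sum_congr rfl fun w _ => ?_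
  rw [Φ.map_smul_univ, smul_eq_mul, ← Complex.ofReal_prod, Complex.re_ofReal_mul]

theorem binaryPOVM_nonneg {E : Op β} (h0 : 0 ≤ E) (h1 : E ≤ 1) (j : Fin 2) :
    0 ≤ binaryPOVM E j := by
  fin_cases j
  · exact sub_nonneg.2 h1
  · exact h0

/-- When the same POVM is measured on every register, the outcomes have an exchangeable probability
distribution, so `g` may be replaced by its average over permutations. -/
theorem IsSymmetricState.sum_weight_le {Φ : MultilinearMap ℂ (fun _ : Fin n => Op β) ℂ}
    (hΦ : IsSymmetricState Φ) {F : Op β} (h0 : 0 ≤ F) (h1 : F ≤ 1)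
    (g : (Fin n → Fin 2) → ℝ) (M : ℝ)
    (hg : ∀ w, ∑ π : Equiv.Perm (Fin n), g (w ∘ π) ≤ Fintype.card (Equiv.Perm (Fin n)) * M) :
    ∑ w, g w * (Φ fun i => binaryPOVM F (w i)).re ≤ M := by
  set P : (Fin n → Fin 2) → ℝ := fun w => (Φ fun i => binaryPOVM F (w i)).re with hP
  have hP0 : ∀ w, 0 ≤ P w := fun w => hΦ.nonneg _ fun i => binaryPOVM_nonneg h0 h1 _
  have hPsymm : ∀ (π : Equiv.Perm (Fin n)) w, P (w ∘ π) = P w := fun π w => by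
    rw [hP]
    exact congrArg Complex.re (hΦ.symm π fun i => binaryPOVM F (w i))
  have hP1 : ∑ w, P w = 1 := by
    have h := sum_weight_mul_re Φ (fun _ _ => 1) (fun _ => binaryPOVM F)
    simp only [Finset.prod_const_one, one_mul, Complex.ofReal_one, one_smul, Fin.sum_univ_two] at h
    rw [hP, h]
    have : (fun _ : Fin n => binaryPOVM F 0 + binaryPOVM F 1) = fun _ => 1 := by
      funext i
      simp [binaryPOVM]
    rw [this, hΦ.one, Complex.one_re]
  have hcard : (0 : ℝ) < Fintype.card (Equiv.Perm (Fin n)) := by exact_mod_cast Fintype.card_pos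
  have hsum : ∀ π : Equiv.Perm (Fin n), ∑ w, g w * P w = ∑ w, g (w ∘ π) * P w := fun π => by
    rw [← Equiv.sum_comp (Equiv.arrowCongr π.symm (Equiv.refl (Fin 2))) fun w => g w * P w]
    refine Finset.sum_congr rfl fun w _ => ?_
    change g (w ∘ π) * P (w ∘ π) = _
    rw [hPsymm]
  refine le_of_mul_le_mul_left ?_ hcard
  calc (Fintype.card (Equiv.Perm (Fin n)) : ℝ) * ∑ w, g w * P w
      = ∑ _π : Equiv.Perm (Fin n), ∑ w, g w * P w := by
        rw [Finset.sum_const, Finset.card_univ, nsmul_eq_mul]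
    _ = ∑ π : Equiv.Perm (Fin n), ∑ w, g (w ∘ π) * P w :=
        Finset.sum_congr rfl fun π _ => hsum π
    _ = ∑ w, (∑ π : Equiv.Perm (Fin n), g (w ∘ π)) * P w := by
        rw [Finset.sum_comm]
        exact Finset.sum_congr rfl fun w _ => (Finset.sum_mul _ _ _).symm
    _ ≤ ∑ w, (Fintype.card (Equiv.Perm (Fin n)) * M) * P w :=
        Finset.sum_le_sum fun w _ => mul_le_mul_of_nonneg_right (hg w) (hP0 w)
    _ = _ := by rw [← Finset.mul_sum, hP1, mul_one]

theorem vec_exp_apply (a : ℝ) (j : Fin 2) : ![1, Real.exp a] j = Real.exp (a * (j : ℕ)) := by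
  fin_cases j <;> simp

end Weights

section Append

variable {K N : ℕ} {α γ : Type}

theorem append_apply_append (G : α → γ) (H : α → γ) (z : Fin K → α) (y : Fin N → α) :
    (fun i => Fin.append (fun _ : Fin K => G) (fun _ : Fin N => H) i (Fin.append z y i))
      = Fin.append (fun i => G (z i)) (fun i => H (y i)) := by
  funext i
  refine Fin.addCases (fun i => ?_) (fun i => ?_) i <;> simp

end Append

/-! ### Sampling without replacement for a fixed binary string. -/

section Sampling

variable {K N : ℕ}

/-- The symmetrised weight of a binary string, when the first `K` letters carry the weights
`a, a s e^μ` and the others `1, e^μ`. -/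
theorem sum_perm_weight_le (hK : 0 < K) {a s μ : ℝ} (ha : 1 ≤ a) (hs0 : 0 ≤ s)
    (hμ : μ * (K + N) ≤ K * (1 - s)) (w : Fin (K + N) → Fin 2) :
    ∑ π : Equiv.Perm (Fin (K + N)), ∏ i, Fin.append (fun _ : Fin K => ![a, a * s * Real.exp μ])
        (fun _ : Fin N => ![1, Real.exp μ]) i ((w ∘ π) i)
      ≤ Fintype.card (Equiv.Perm (Fin (K + N))) * Real.exp (K * (a - 1)) := by
  have hn : (0 : ℝ) < K + N := by
    have : (0 : ℝ) < K := by exact_mod_cast hK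
    positivity
  set T : ℝ := ∑ i, ((w i : ℕ) : ℝ) with hT
  have hT0 : 0 ≤ T := Finset.sum_nonneg fun i _ => Nat.cast_nonneg _
  have hTn : T ≤ K + N := by
    have : T ≤ ∑ _i : Fin (K + N), (1 : ℝ) := Finset.sum_le_sum fun i _ => by
      exact_mod_cast Nat.le_of_lt_succ (w i).2
    simpa using this
  set J : Finset (Fin (K + N)) := Finset.univ.map (Fin.castAddEmb N) with hJ
  have hJcard : J.card = K := by simp [hJ]
  set c : Fin (K + N) → ℝ := fun i => ![1, s] (w i) with hc
  have hc0 : ∀ i, 0 ≤ c i := by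
    intro i
    simp only [hc]
    generalize w i = j
    fin_cases j <;> simp [hs0]
  have hcsum : ∑ i, c i = (K + N) - T * (1 - s) := by
    have h : ∀ i, c i = 1 - ((w i : ℕ) : ℝ) * (1 - s) := by
      intro i
      simp only [hc]
      generalize w i = j
      fin_cases j <;> simp
    simp only [h, Finset.sum_sub_distrib, ← Finset.sum_mul]
    simp [hT]
  have hprod : ∀ π : Equiv.Perm (Fin (K + N)),
      ∏ i, Fin.append (fun _ : Fin K => ![a, a * s * Real.exp μ])
        (fun _ : Fin N => ![1, Real.exp μ]) i ((w ∘ π) i)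
      = a ^ K * Real.exp (μ * T) * ∏ j ∈ J, c (π j) := by
    intro π
    have hTπ : T = ∑ i, ((w (π i) : ℕ) : ℝ) := by
      rw [hT]
      exact (Equiv.sum_comp π fun i => ((w i : ℕ) : ℝ)).symm
    have h1 : Real.exp (μ * T) = ∏ i, ![1, Real.exp μ] (w (π i)) := by
      simp only [vec_exp_apply]
      rw [← Real.exp_sum, hTπ, Finset.mul_sum]
    have h2 : ∏ j ∈ J, c (π j) = ∏ i : Fin K, ![1, s] (w (π (Fin.castAdd N i))) := by
      rw [hJ, Finset.prod_map]
      rfl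
    rw [h1, h2, Fin.prod_univ_add, Fin.prod_univ_add]
    simp only [Fin.append_left, Fin.append_right, Function.comp_apply]
    -- Both letter weights factor as `a · e^{μ j} · s^j`. The factor `e^{μ j}` occurs at all
    -- positions and gives the permutation invariant `exp(μT)`; only the powers of `s` on the first
    -- `K` positions are averaged.
    have h3 : ∀ j : Fin 2, ![a, a * s * Real.exp μ] j = a * ![1, Real.exp μ] j * ![1, s] j := by
      intro j
      fin_cases j
      · simp
      · simp only [Fin.mk_one, Matrix.cons_val_one, Matrix.cons_val_fin_one]
        ring
    simp only [h3, Finset.prod_mul_distrib, Finset.prod_const, Finset.card_univ, Fintype.card_fin]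
    ring
  simp only [hprod]
  rw [← Finset.mul_sum]
  have hM := sum_perm_prod_le c hc0 J
  rw [hJcard, hcsum, Fintype.card_fin] at hM
  push_cast at hM
  set τ := T / (K + N) with hτ
  have hτ0 : 0 ≤ τ := by positivity
  have hτ1 : τ ≤ 1 := by rw [hτ, div_le_one hn]; exact hTn
  have e1 : ((K : ℝ) + N - T * (1 - s)) / (K + N) = 1 - τ * (1 - s) := by
    rw [hτ]
    field_simp
  have hb0 : 0 ≤ 1 - τ * (1 - s) := by nlinarith
  have e2 : (1 - τ * (1 - s)) ^ K ≤ Real.exp (-(K * (τ * (1 - s)))) := by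
    have : 1 - τ * (1 - s) ≤ Real.exp (-(τ * (1 - s))) := by
      have := Real.add_one_le_exp (-(τ * (1 - s)))
      linarith
    calc _ ≤ Real.exp (-(τ * (1 - s))) ^ K := pow_le_pow_left₀ hb0 this K
      _ = _ := by rw [← Real.exp_nat_mul]; ring_nf
  have e3 : a ^ K ≤ Real.exp (K * (a - 1)) := by
    have : a ≤ Real.exp (a - 1) := by
      have := Real.add_one_le_exp (a - 1)
      linarith
    calc _ ≤ Real.exp (a - 1) ^ K := pow_le_pow_left₀ (by linarith) this K
      _ = _ := by rw [← Real.exp_nat_mul]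
  -- The condition on `μ` says that the growth `exp(μT)` never exceeds the decay `exp(-Kτ(1-s))` of
  -- the sampled product, whatever the density `τ` of ones.
  have e4 : μ * T ≤ K * (τ * (1 - s)) := by
    have : T = τ * (K + N) := by rw [hτ]; field_simp
    rw [this]
    nlinarith [mul_le_mul_of_nonneg_left hμ hτ0]
  rw [e1] at hM
  set C : ℝ := (Fintype.card (Equiv.Perm (Fin (K + N))) : ℝ) with hC
  have hC0 : 0 ≤ C := Nat.cast_nonneg _
  calc a ^ K * Real.exp (μ * T) * ∑ π : Equiv.Perm (Fin (K + N)), ∏ j ∈ J, c (π j)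
      ≤ a ^ K * Real.exp (μ * T) * (C * (1 - τ * (1 - s)) ^ K) := by
        refine mul_le_mul_of_nonneg_left hM ?_
        positivity
    _ ≤ Real.exp (K * (a - 1)) * Real.exp (K * (τ * (1 - s)))
        * (C * Real.exp (-(K * (τ * (1 - s))))) := by
        gcongr
    _ = C * Real.exp (K * (a - 1)) := by
        have : Real.exp (K * (τ * (1 - s))) * Real.exp (-(K * (τ * (1 - s)))) = 1 := by
          rw [← Real.exp_add]; simp
        linear_combination (C * Real.exp (K * (a - 1))) * this

end Sampling

/-! ### Chernoff bound for the joint test. -/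

section Joint

variable {K N : ℕ} {β : Type} [DecidableEq β]

/-- Exponential Markov inequality: on the event, `exp(λ(R - ∑ zᵢ) + μ(∑ yᵢ - Q)) ≥ 1`, and elsewhere
this weight is nonnegative. -/
theorem jointProb_le_exp_mul {ρ : Op (Fin (K + N) → β)} (hρ : IsState ρ)
    (hperm : IsPermInvariant ρ) {E F : Op β} (hE0 : 0 ≤ E) (hE1 : E ≤ 1) (hF0 : 0 ≤ F)
    (hF1 : F ≤ 1) {lam μ : ℝ} (hlam : 0 ≤ lam) (hμ : 0 ≤ μ) (R Q : ℕ) :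
    jointProb ρ E F R Q ≤ Real.exp (lam * R - μ * Q)
      * (productExpectation hρ fun i => ∑ j, (Fin.append (fun _ : Fin K => ![1, Real.exp (-lam)])
          (fun _ : Fin N => ![1, Real.exp μ]) i j : ℂ)
          • Fin.append (fun _ : Fin K => binaryPOVM E) (fun _ : Fin N => binaryPOVM F) i j).re := by
  have hΦ := isSymmetricState_productExpectation hρ hperm
  set Φ := productExpectation hρ
  rw [← sum_weight_mul_re, Finset.mul_sum,
    ← (Fin.appendEquiv K N).sum_comp, jointProb]
  have hterm : ∀ zy : (Fin K → Fin 2) × (Fin N → Fin 2),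
      (Φ fun i => Fin.append (fun _ : Fin K => binaryPOVM E) (fun _ : Fin N => binaryPOVM F) i
        ((Fin.appendEquiv K N) zy i)).re = outcomeProb ρ E F zy.1 zy.2 := by
    intro zy
    have := append_apply_append (binaryPOVM E) (binaryPOVM F) zy.1 zy.2
    rw [outcomeProb, ← this]
    rfl
  have hnonneg : ∀ zy : (Fin K → Fin 2) × (Fin N → Fin 2),
      0 ≤ outcomeProb ρ E F zy.1 zy.2 := by
    intro zy
    rw [← hterm]
    refine hΦ.nonneg _ fun i => ?_
    refine Fin.addCases (fun i => ?_) (fun i => ?_) i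
    · simpa using binaryPOVM_nonneg hE0 hE1 _
    · simpa using binaryPOVM_nonneg hF0 hF1 _
  have hweight : ∀ zy : (Fin K → Fin 2) × (Fin N → Fin 2),
      Real.exp (lam * R - μ * Q) * ∏ i, Fin.append (fun _ : Fin K => ![1, Real.exp (-lam)])
          (fun _ : Fin N => ![1, Real.exp μ]) i ((Fin.appendEquiv K N) zy i)
        = Real.exp (lam * (R - ((∑ i, (zy.1 i : ℕ) : ℕ) : ℝ))
          + μ * (((∑ i, (zy.2 i : ℕ) : ℕ) : ℝ) - Q)) := by
    intro zy
    rw [Fin.prod_univ_add]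
    simp only [Fin.appendEquiv, Equiv.coe_fn_mk, Fin.append_left, Fin.append_right, vec_exp_apply]
    rw [← Real.exp_sum, ← Real.exp_sum, ← Real.exp_add, ← Real.exp_add, ← Finset.mul_sum,
      ← Finset.mul_sum]
    congr 1
    push_cast
    ring
  rw [Finset.sum_filter]
  refine Finset.sum_le_sum fun zy _ => ?_
  rw [hterm, ← mul_assoc, hweight]
  split_ifs with h
  · refine le_mul_of_one_le_left (hnonneg zy) (Real.one_le_exp ?_)
    have h1 : ((∑ i, (zy.1 i : ℕ) : ℕ) : ℝ) ≤ R := by exact_mod_cast h.1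
    have h2 : (Q : ℝ) ≤ ((∑ i, (zy.2 i : ℕ) : ℕ) : ℝ) := by exact_mod_cast h.2.le
    have := mul_nonneg hlam (sub_nonneg.2 h1)
    have := mul_nonneg hμ (sub_nonneg.2 h2)
    linarith
  · exact mul_nonneg (Real.exp_pos _).le (hnonneg zy)

/-- The inequality `hEF` trades the test `E` for `F` on the first `K` registers, after which the
problem is one of classical sampling. The term with `e / (1 - e)` is the price of the additive error
in `hEF`. -/
theorem jointProb_le {ρ : Op (Fin (K + N) → β)} (hρ : IsState ρ) (hperm : IsPermInvariant ρ)
    {E F : Op β} (hE0 : 0 ≤ E) (hE1 : E ≤ 1) (hF0 : 0 ≤ F) (hF1 : F ≤ 1) (hK : 0 < K)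
    {p e lam μ : ℝ} (hp0 : 0 ≤ p) (hp1 : p ≤ 1) (he0 : 0 ≤ e) (he1 : e < 1)
    (hEF : (p : ℂ) • F ≤ ((2 * (1 - e) : ℝ) : ℂ) • E + ((2 * e : ℝ) : ℂ) • 1)
    (hlam : 0 ≤ lam) (hμ0 : 0 ≤ μ)
    (hμ : μ * (K + N) ≤ K * (1 - (1 - (1 - Real.exp (-lam)) * p
      / (2 * (1 - e * Real.exp (-lam)))) * Real.exp (-μ))) (R Q : ℕ) :
    jointProb ρ E F R Q
      ≤ Real.exp (lam * R - μ * Q + K * ((1 - Real.exp (-lam)) * e / (1 - e))) := by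
  have hΦ := isSymmetricState_productExpectation hρ hperm
  refine (jointProb_le_exp_mul hρ hperm hE0 hE1 hF0 hF1 hlam hμ0 R Q).trans ?_
  rw [Real.exp_add]
  refine mul_le_mul_of_nonneg_left ?_ (Real.exp_pos _).le
  set Φ := productExpectation hρ
  set x := Real.exp (-lam) with hx
  have hx0 : 0 < x := Real.exp_pos _
  have hx1 : x ≤ 1 := Real.exp_le_one_iff.2 (by linarith)
  have h1e : 0 < 1 - e := by linarith
  have h1ex : 0 < 1 - e * x := by nlinarith
  set a : ℝ := 1 + (1 - x) * e / (1 - e) with ha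
  set kt : ℝ := (1 - x) * p / (2 * (1 - e * x)) with hkt
  have hkt0 : 0 ≤ kt := by
    rw [hkt]
    exact div_nonneg (mul_nonneg (by linarith) hp0) (by linarith)
  have hkt1 : kt ≤ 1 := by
    rw [hkt, div_le_one (by linarith)]
    nlinarith
  have ha1 : 1 ≤ a := by
    have : 0 ≤ (1 - x) * e / (1 - e) := div_nonneg (mul_nonneg (by linarith) he0) h1e.le
    linarith
  have hakt : a * kt = (1 - x) / (2 * (1 - e)) * p := by
    have ha2 : a = (1 - e * x) / (1 - e) := by
      rw [ha]
      field_simp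
      ring
    rw [ha2, hkt]
    generalize 1 - e * x = D at h1ex
    have := h1ex.ne'
    field_simp
  set s : ℝ := (1 - kt) * Real.exp (-μ) with hs
  have hs0 : 0 ≤ s := mul_nonneg (by linarith) (Real.exp_pos _).le
  have hsμ : s * Real.exp μ = 1 - kt := by
    rw [hs, mul_assoc, ← Real.exp_add]
    simp
  have hpovm : ∀ (A : Op β) (c d : ℝ), ∑ j, ((![c, d] j : ℝ) : ℂ) • binaryPOVM A j
      = (c : ℂ) • (1 - A) + (d : ℂ) • A := by
    intro A c d
    simp [Fin.sum_univ_two, binaryPOVM]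
  have hsmul : ∀ (A : Op β) (c : ℝ), 0 ≤ A → 0 ≤ c → 0 ≤ (c : ℂ) • A := by
    intro A c hA hc
    rw [ContinuousLinearMap.nonneg_iff_isPositive] at hA ⊢
    exact hA.smul_of_nonneg (by exact_mod_cast hc)
  -- Inserting `E ≥ (pF - 2e) / (2(1 - e))` in `1 - (1 - x)E` gives the upper bound `a(1 - kt F)`.
  -- By the choice of `s` this equals the right side, since `s e^μ = 1 - kt`.
  have hstep : ((1 : ℝ) : ℂ) • (1 - E) + (x : ℂ) • E
      ≤ (a : ℂ) • (1 - F) + ((a * s * Real.exp μ : ℝ) : ℂ) • F := by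
    have h1 := hsmul _ ((1 - x) / (2 * (1 - e))) (sub_nonneg.2 hEF)
      (div_nonneg (by linarith) (by linarith))
    rw [← sub_nonneg]
    convert h1 using 1
    rw [mul_assoc, hsμ, mul_sub, hakt, ha]
    have h1e' : ((1 : ℂ) - e) ≠ 0 := by exact_mod_cast h1e.ne'
    ext ψ b
    simp only [sub_apply, add_apply, smul_apply, one_apply_eq_self,
      lp.coeFn_sub, lp.coeFn_add, lp.coeFn_smul, Pi.sub_apply, Pi.add_apply, Pi.smul_apply,
      smul_eq_mul]
    push_cast
    field_simp
    ring
  have hmono : (Φ fun i => ∑ j, (Fin.append (fun _ : Fin K => ![1, x])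
          (fun _ : Fin N => ![1, Real.exp μ]) i j : ℂ)
          • Fin.append (fun _ : Fin K => binaryPOVM E) (fun _ : Fin N => binaryPOVM F) i j).re
      ≤ (Φ fun i => ∑ j, (Fin.append (fun _ : Fin K => ![a, a * s * Real.exp μ])
          (fun _ : Fin N => ![1, Real.exp μ]) i j : ℂ) • binaryPOVM F j).re := by
    refine hΦ.mono (fun i => ?_) (fun i => ?_)
    · refine Fin.addCases (fun i => ?_) (fun i => ?_) i
      · simp only [Fin.append_left, hpovm]
        exact add_nonneg (hsmul _ _ (sub_nonneg.2 hE1) zero_le_one) (hsmul _ _ hE0 hx0.le)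
      · simp only [Fin.append_right, hpovm]
        exact add_nonneg (hsmul _ _ (sub_nonneg.2 hF1) zero_le_one)
          (hsmul _ _ hF0 (Real.exp_pos _).le)
    · refine Fin.addCases (fun i => ?_) (fun i => ?_) i
      · simp only [Fin.append_left, hpovm]
        exact hstep
      · simp only [Fin.append_right]
        exact le_rfl
  refine hmono.trans ?_
  rw [← sum_weight_mul_re Φ _ fun _ => binaryPOVM F]
  have ha' : a - 1 = (1 - x) * e / (1 - e) := by rw [ha]; ring
  rw [← ha']
  exact hΦ.sum_weight_le hF0 hF1 _ _ fun w =>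
    sum_perm_weight_le hK ha1 hs0 hμ w

end Joint

/-! ### Plancherel's identity -/

open scoped FourierTransform in
-- Moving one transform to the other factor of the inner product makes it an inverse transform, and
-- inversion returns `f`.
theorem integral_norm_sq_fourier {f : ℝ → ℂ} (hc : Continuous f) (hf : Integrable f)
    (hF : Integrable (𝓕 f)) : ∫ ξ, ‖𝓕 f ξ‖ ^ 2 = ∫ x, ‖f x‖ ^ 2 := by
  have h1 : ∫ ξ, inner ℂ (𝓕 f ξ) (𝓕 f ξ) = ∫ x, inner ℂ (f x) (𝓕⁻ (𝓕 f) x) := by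
    have h := VectorFourier.integral_sesq_fourierIntegral_eq_neg_flip (innerSL ℂ)
      (L := innerₗ ℝ) Real.continuous_fourierChar continuous_inner hf hF
    rw [flip_innerₗ] at h
    exact h
  rw [hc.fourierInv_fourier_eq hf hF] at h1
  apply Complex.ofRealLI.injective
  simpa [← LinearIsometry.integral_comp_comm, inner_self_eq_norm_sq_to_K] using h1

/-! ### Integrability of polynomials times Gaussians -/

theorem integrable_poly_mul_exp (P : Polynomial ℂ) {c : ℝ} (hc : 0 < c) :
    Integrable fun x : ℝ => P.eval (x : ℂ) * (Real.exp (-c * x ^ 2) : ℂ) := by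
  induction P using Polynomial.induction_on' with
  | add P P' h h' =>
    refine (h.add h').congr (Filter.Eventually.of_forall fun x => ?_)
    simp [add_mul]
  | monomial n a =>
    have h := ((integrable_rpow_mul_exp_neg_mul_sq hc (s := (n : ℝ))
      (by have : (0 : ℝ) ≤ n := n.cast_nonneg
          linarith)).ofReal (𝕜 := ℂ)).const_mul a
    refine h.congr (Filter.Eventually.of_forall fun x => ?_)
    simp [mul_assoc]

theorem hermiteFun_eq_cpoly (n : ℕ) : ∃ P : Polynomial ℂ, ∀ x : ℝ,
    (hermiteFun n x : ℂ) = P.eval (x : ℂ) * (Real.exp (-(1 / 2) * x ^ 2) : ℂ) := by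
  obtain ⟨p, hp⟩ := hermiteFun_eq_poly n
  refine ⟨p.map Complex.ofRealHom, fun x => ?_⟩
  have : (p.map Complex.ofRealHom).eval (x : ℂ) = ((p.eval x : ℝ) : ℂ) := by
    rw [Polynomial.eval_map]
    exact Polynomial.eval₂_at_apply Complex.ofRealHom x
  rw [hp, this]
  push_cast
  ring_nf

theorem integrable_hermiteFun (n : ℕ) : Integrable fun x : ℝ => (hermiteFun n x : ℂ) := by
  obtain ⟨P, hP⟩ := hermiteFun_eq_cpoly n
  simp only [hP]
  exact integrable_poly_mul_exp P (by norm_num)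

/-! ### Gabor transforms of Hermite functions -/

/-- The Gaussian wave packet `x ↦ e^{-(x-q)²/2 - i p x}`. -/
def wavePacket (q p : ℝ) (x : ℝ) : ℂ :=
  Complex.exp (-((x : ℂ) - q) ^ 2 / 2 - Complex.I * p * x)

theorem hasDerivAt_wavePacket (q p x : ℝ) :
    HasDerivAt (wavePacket q p) ((-((x : ℂ) - q) - Complex.I * p) * wavePacket q p x) x := by
  have h1 : HasDerivAt (fun z : ℂ => -(z - q) ^ 2 / 2 - Complex.I * p * z)
      (-((x : ℂ) - q) - Complex.I * p) (x : ℂ) := by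
    have ha := ((((hasDerivAt_id (x : ℂ)).sub_const (q : ℂ)).pow 2).neg.div_const 2).sub
      ((hasDerivAt_id (x : ℂ)).const_mul (Complex.I * p))
    refine ha.congr_deriv ?_
    simp only [id, Nat.cast_ofNat]
    ring
  have h2 := h1.cexp.comp_ofReal
  refine h2.congr_deriv ?_
  rw [wavePacket]
  ring

theorem continuous_wavePacket (q p : ℝ) : Continuous (wavePacket q p) :=
  continuous_iff_continuousAt.2 fun x => (hasDerivAt_wavePacket q p x).continuousAt

theorem norm_wavePacket (q p x : ℝ) : ‖wavePacket q p x‖ = Real.exp (-(x - q) ^ 2 / 2) := by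
  rw [wavePacket, Complex.norm_exp]
  congr 1
  have : (-((x : ℂ) - q) ^ 2 / 2 - Complex.I * p * x)
      = ((-(x - q) ^ 2 / 2 : ℝ) : ℂ) - Complex.I * ((p * x : ℝ) : ℂ) := by push_cast; ring
  rw [this, Complex.sub_re, Complex.ofReal_re, Complex.I_mul_re, Complex.ofReal_im]
  ring

theorem norm_wavePacket_le_one (q p x : ℝ) : ‖wavePacket q p x‖ ≤ 1 := by
  rw [norm_wavePacket]
  apply Real.exp_le_one_iff.2
  nlinarith [sq_nonneg (x - q)]

theorem Integrable.mul_wavePacket {f : ℝ → ℂ} (hf : Integrable f) (q p : ℝ) :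
    Integrable fun x => f x * wavePacket q p x :=
  hf.mul_bdd (c := 1) (continuous_wavePacket q p).aestronglyMeasurable
    (Filter.Eventually.of_forall fun x => norm_wavePacket_le_one q p x)

/-- The overlap `∫ hₙ(x) e^{-(x-q)²/2 - i p x} dx`. -/
def gabor (n : ℕ) (q p : ℝ) : ℂ := ∫ x : ℝ, (hermiteFun n x : ℂ) * wavePacket q p x

/-- The function `√(n+1) hₙ₊₁` is `(x - d/dx) hₙ / √2`. Integration by parts moves this operator to
the wave packet, which satisfies `(x + d/dx) w = (q - ip) w`. -/
theorem gabor_succ (n : ℕ) (q p : ℝ) :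
    (√((n : ℝ) + 1) : ℂ) * gabor (n + 1) q p = ((q - Complex.I * p) / (√2 : ℂ)) * gabor n q p := by
  have h2 : (√2 : ℂ) * (√2 : ℂ) = 2 := by
    exact_mod_cast Real.mul_self_sqrt (by norm_num : (0 : ℝ) ≤ 2)
  have h0 : (√2 : ℂ) ≠ 0 := by
    exact_mod_cast (by positivity : (√2 : ℝ) ≠ 0)
  set d : ℝ → ℝ := fun x =>
    (√(n : ℝ) * hermiteFun (n - 1) x - √((n : ℝ) + 1) * hermiteFun (n + 1) x) / √2 with hd
  have hdint : Integrable fun x => (d x : ℂ) := by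
    have := (((integrable_hermiteFun (n - 1)).const_mul (√(n : ℝ) : ℂ)).sub
      ((integrable_hermiteFun (n + 1)).const_mul (√((n : ℝ) + 1) : ℂ))).div_const (√2 : ℂ)
    refine this.congr (Filter.Eventually.of_forall fun x => ?_)
    simp [hd]
  have hxint : Integrable fun x : ℝ => (x : ℂ) * (hermiteFun n x : ℂ) := by
    have := (((integrable_hermiteFun (n - 1)).const_mul (√(n : ℝ) : ℂ)).add
      ((integrable_hermiteFun (n + 1)).const_mul (√((n : ℝ) + 1) : ℂ))).div_const (√2 : ℂ)
    refine this.congr (Filter.Eventually.of_forall fun x => ?_)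
    simp only [Pi.add_apply]
    rw [← Complex.ofReal_mul x, mul_hermiteFun]
    push_cast
    ring
  have hder : ∀ x : ℝ, HasDerivAt (fun y : ℝ => (hermiteFun n y : ℂ)) (d x : ℂ) x :=
    fun x => (hasDerivAt_hermiteFun n x).ofReal_comp
  have hI := Integrable.mul_wavePacket (integrable_hermiteFun n) q p
  have hD := Integrable.mul_wavePacket hdint q p
  have hX := Integrable.mul_wavePacket hxint q p
  have hG : Integrable fun x : ℝ => (hermiteFun n x : ℂ)
      * ((-((x : ℂ) - q) - Complex.I * p) * wavePacket q p x) := by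
    refine ((hI.const_mul ((q : ℂ) - Complex.I * p)).sub hX).congr
      (Filter.Eventually.of_forall fun x => ?_)
    simp only [Pi.sub_apply]
    ring
  have parts := integral_mul_deriv_eq_deriv_mul_of_integrable
    (fun x _ => hder x) (fun x _ => hasDerivAt_wavePacket q p x) hG hD hI
  have e1 : ∫ x : ℝ, (hermiteFun n x : ℂ) * ((-((x : ℂ) - q) - Complex.I * p) * wavePacket q p x)
      = ((q : ℂ) - Complex.I * p) * gabor n q p
        - ∫ x : ℝ, ((x : ℂ) * (hermiteFun n x : ℂ)) * wavePacket q p x := by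
    rw [gabor, ← integral_const_mul, ← integral_sub (hI.const_mul _) hX]
    refine integral_congr_ae (Filter.Eventually.of_forall fun x => ?_)
    simp only
    ring
  have e2 : (∫ x : ℝ, ((x : ℂ) * (hermiteFun n x : ℂ)) * wavePacket q p x)
      - ∫ x : ℝ, (d x : ℂ) * wavePacket q p x
      = ((√2 : ℂ) * √((n : ℝ) + 1)) * gabor (n + 1) q p := by
    rw [gabor, ← integral_const_mul, ← integral_sub hX hD]
    refine integral_congr_ae (Filter.Eventually.of_forall fun x => ?_)
    simp only
    rw [← Complex.ofReal_mul, mul_hermiteFun, hd]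
    push_cast
    field_simp
    linear_combination (-(hermiteFun (n + 1) x : ℂ) * √((n : ℝ) + 1) * wavePacket q p x) * h2
  rw [e1] at parts
  field_simp
  linear_combination -e2 - parts

theorem gabor_eq (n : ℕ) (q p : ℝ) :
    gabor n q p = (((q : ℂ) - Complex.I * p) / (√2 : ℂ)) ^ n / (√(n.factorial : ℝ) : ℂ)
      * gabor 0 q p := by
  induction n with
  | zero => simp
  | succ n ih =>
    have h := gabor_succ n q p
    have h0 : (√((n : ℝ) + 1) : ℂ) ≠ 0 := by
      exact_mod_cast (by positivity : √((n : ℝ) + 1) ≠ 0)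
    have h1 : (√(n.factorial : ℝ) : ℂ) ≠ 0 := by
      exact_mod_cast (by positivity : √(n.factorial : ℝ) ≠ 0)
    have hf : (√((n + 1).factorial : ℝ) : ℂ) = √((n : ℝ) + 1) * √(n.factorial : ℝ) := by
      rw [← Complex.ofReal_mul, ← Real.sqrt_mul (by positivity), Nat.factorial_succ]
      push_cast
      rfl
    rw [ih] at h
    rw [hf]
    refine mul_left_cancel₀ h0 ?_
    rw [h, pow_succ]
    field_simp

theorem gabor_zero (q p : ℝ) :
    gabor 0 q p = ((Real.pi : ℂ) / -(-1)) ^ (1 / 2 : ℂ)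
      * Complex.exp (-(q : ℂ) ^ 2 / 2 - ((q : ℂ) - Complex.I * p) ^ 2 / (4 * (-1)))
      / ((√(√Real.pi) : ℝ) : ℂ) := by
  have h1 : gabor 0 q p = (∫ x : ℝ, Complex.exp ((-1) * (x : ℂ) ^ 2 + (q - Complex.I * p) * x
      + (-(q : ℂ) ^ 2 / 2))) / (√(√Real.pi) : ℂ) := by
    rw [gabor, ← integral_div]
    refine integral_congr_ae (Filter.Eventually.of_forall fun x => ?_)
    simp only [hermiteFun, Polynomial.hermite_zero, Nat.factorial_zero, Nat.cast_one, one_mul,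
      map_one, wavePacket]
    push_cast
    rw [div_mul_eq_mul_div, ← Complex.exp_add]
    congr 2
    ring
  rw [h1, integral_cexp_quadratic (by norm_num)]

theorem norm_sq_gabor_zero (q p : ℝ) :
    ‖gabor 0 q p‖ ^ 2 = √Real.pi * Real.exp (-(q ^ 2 + p ^ 2) / 2) := by
  have hpi : (0 : ℝ) < √(√Real.pi) := by positivity
  rw [gabor_zero, norm_div, norm_mul, div_pow, mul_pow]
  have h2 : ‖((√(√Real.pi) : ℝ) : ℂ)‖ ^ 2 = √Real.pi := by
    rw [Complex.norm_real, Real.norm_of_nonneg hpi.le, Real.sq_sqrt (by positivity)]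
  have h3 : ‖((Real.pi : ℂ) / -(-1)) ^ (1 / 2 : ℂ)‖ ^ 2 = Real.pi := by
    have : ((Real.pi : ℂ) / -(-1)) ^ (1 / 2 : ℂ) = ((Real.pi ^ (1 / 2 : ℝ) : ℝ) : ℂ) := by
      rw [neg_neg, div_one, Complex.ofReal_cpow Real.pi_pos.le]
      push_cast
      rfl
    rw [this, Complex.norm_real, Real.norm_of_nonneg (by positivity), ← Real.sqrt_eq_rpow,
      Real.sq_sqrt Real.pi_pos.le]
  have h4 : ‖Complex.exp (-(q : ℂ) ^ 2 / 2 - ((q : ℂ) - Complex.I * p) ^ 2 / (4 * (-1)))‖ ^ 2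
      = Real.exp (-(q ^ 2 + p ^ 2) / 2) := by
    rw [Complex.norm_exp, ← Real.exp_nat_mul]
    congr 1
    have : (-(q : ℂ) ^ 2 / 2 - ((q : ℂ) - Complex.I * p) ^ 2 / (4 * (-1)))
        = ((-(q ^ 2 + p ^ 2) / 4 : ℝ) : ℂ) - Complex.I * ((q * p / 2 : ℝ) : ℂ) := by
      push_cast
      linear_combination ((p : ℂ) ^ 2 / 4) * Complex.I_sq
    rw [this, Complex.sub_re, Complex.ofReal_re, Complex.I_mul_re, Complex.ofReal_im]
    push_cast
    ring
  rw [h2, h3, h4, div_eq_iff (by positivity)]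
  have h5 : √Real.pi * √Real.pi = Real.pi := Real.mul_self_sqrt Real.pi_pos.le
  linear_combination (-Real.exp (-(q ^ 2 + p ^ 2) / 2)) * h5

/-! ### The Husimi function of a finite superposition of number states -/

/-- The position wave function of `∑_{n<M} ψₙ|n⟩`. -/
def waveFun (ψ : ℕ → ℂ) (M : ℕ) (x : ℝ) : ℂ := ∑ n ∈ Finset.range M, ψ n * (hermiteFun n x : ℂ)

/-- The Bargmann function of `∑_{n<M} ψₙ|n⟩`. -/
def bargmann (ψ : ℕ → ℂ) (M : ℕ) (z : ℂ) : ℂ :=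
  ∑ n ∈ Finset.range M, ψ n * (z ^ n / (√(n.factorial : ℝ) : ℂ))

/-- The Husimi function of `∑_{n<M} ψₙ|n⟩`, as a density in `(q, p)`. -/
def husimi (ψ : ℕ → ℂ) (M : ℕ) (q p : ℝ) : ℝ :=
  ‖bargmann ψ M (((q : ℂ) - Complex.I * p) / (√2 : ℂ))‖ ^ 2 * Real.exp (-(q ^ 2 + p ^ 2) / 2)
    / (2 * Real.pi)

theorem continuous_waveFun (ψ : ℕ → ℂ) (M : ℕ) : Continuous (waveFun ψ M) := by
  unfold waveFun
  exact continuous_finsetSum _ fun n _ =>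
    continuous_const.mul (Complex.continuous_ofReal.comp (continuous_hermiteFun n))

theorem integrable_waveFun (ψ : ℕ → ℂ) (M : ℕ) : Integrable (waveFun ψ M) := by
  unfold waveFun
  exact integrable_finsetSum _ fun n _ => (integrable_hermiteFun n).const_mul _

theorem integral_waveFun_mul_wavePacket (ψ : ℕ → ℂ) (M : ℕ) (q p : ℝ) :
    ∫ x, waveFun ψ M x * wavePacket q p x
      = bargmann ψ M (((q : ℂ) - Complex.I * p) / (√2 : ℂ)) * gabor 0 q p := by
  simp only [waveFun, bargmann, Finset.sum_mul]
  rw [integral_finsetSum]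
  · refine Finset.sum_congr rfl fun n _ => ?_
    simp only [mul_assoc]
    rw [integral_const_mul, ← gabor_eq]
    rfl
  · intro n _
    exact Integrable.mul_wavePacket ((integrable_hermiteFun n).const_mul _) q p

theorem continuous_husimi (ψ : ℕ → ℂ) (M : ℕ) :
    Continuous fun x : ℝ × ℝ => husimi ψ M x.1 x.2 := by
  unfold husimi bargmann
  fun_prop

theorem husimi_nonneg (ψ : ℕ → ℂ) (M : ℕ) (q p : ℝ) : 0 ≤ husimi ψ M q p := by
  unfold husimi
  positivity

theorem norm_sq_overlap (ψ : ℕ → ℂ) (M : ℕ) (q p : ℝ) :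
    ‖∫ x, waveFun ψ M x * wavePacket q p x‖ ^ 2
      = 2 * Real.pi * √Real.pi * husimi ψ M q p := by
  rw [integral_waveFun_mul_wavePacket, norm_mul, mul_pow, norm_sq_gabor_zero, husimi]
  field_simp

/-! ### Marginals of the Husimi function -/

theorem integrable_norm_sq_poly_mul_exp (P : Polynomial ℂ) {c : ℝ} (hc : 0 < c) :
    Integrable fun x : ℝ => ‖P.eval (x : ℂ)‖ ^ 2 * Real.exp (-c * x ^ 2) := by
  refine (integrable_poly_mul_exp (P * P.map (starRingEnd ℂ)) hc).norm.congr
    (Filter.Eventually.of_forall fun x => ?_)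
  have h : (P.map (starRingEnd ℂ)).eval (x : ℂ) = (starRingEnd ℂ) (P.eval (x : ℂ)) := by
    rw [Polynomial.eval_map, ← Polynomial.eval₂_at_apply, Complex.conj_ofReal]
  simp only [Polynomial.eval_mul, h, norm_mul, RCLike.norm_conj, Complex.norm_real,
    Real.norm_of_nonneg (Real.exp_pos _).le]
  ring

theorem waveFun_eq_poly (ψ : ℕ → ℂ) (M : ℕ) : ∃ P : Polynomial ℂ, ∀ x : ℝ,
    waveFun ψ M x = P.eval (x : ℂ) * (Real.exp (-(1 / 2) * x ^ 2) : ℂ) := by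
  choose P hP using hermiteFun_eq_cpoly
  refine ⟨∑ n ∈ Finset.range M, Polynomial.C (ψ n) * P n, fun x => ?_⟩
  rw [waveFun, Polynomial.eval_finsetSum, Finset.sum_mul]
  refine Finset.sum_congr rfl fun n _ => ?_
  rw [hP, Polynomial.eval_mul, Polynomial.eval_C]
  ring

theorem integrable_norm_sq_waveFun (ψ : ℕ → ℂ) (M : ℕ) :
    Integrable fun x : ℝ => ‖waveFun ψ M x‖ ^ 2 := by
  obtain ⟨P, hP⟩ := waveFun_eq_poly ψ M
  refine (integrable_norm_sq_poly_mul_exp P one_pos).congr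
    (Filter.Eventually.of_forall fun x => ?_)
  simp only [hP, norm_mul, mul_pow, Complex.norm_real, Real.norm_of_nonneg (Real.exp_pos _).le]
  rw [← Real.exp_nat_mul]
  congr 2
  push_cast
  ring

theorem bargmann_eq_poly (ψ : ℕ → ℂ) (M : ℕ) (q : ℝ) : ∃ P : Polynomial ℂ, ∀ p : ℝ,
    bargmann ψ M (((q : ℂ) - Complex.I * p) / (√2 : ℂ)) = P.eval (p : ℂ) := by
  refine ⟨∑ n ∈ Finset.range M, Polynomial.C (ψ n)
    * ((Polynomial.C ((q : ℂ) / (√2 : ℂ)) - Polynomial.C (Complex.I / (√2 : ℂ))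
      * Polynomial.X) ^ n * Polynomial.C ((√(n.factorial : ℝ) : ℂ)⁻¹)), fun p => ?_⟩
  rw [bargmann, Polynomial.eval_finsetSum]
  refine Finset.sum_congr rfl fun n _ => ?_
  simp only [Polynomial.eval_mul, Polynomial.eval_C, Polynomial.eval_pow, Polynomial.eval_sub,
    Polynomial.eval_X]
  rw [div_eq_mul_inv (_ ^ n)]
  congr 3
  ring

theorem integrable_husimi (ψ : ℕ → ℂ) (M : ℕ) (q : ℝ) : Integrable fun p => husimi ψ M q p := by
  obtain ⟨P, hP⟩ := bargmann_eq_poly ψ M q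
  refine ((integrable_norm_sq_poly_mul_exp P (c := 1 / 2) (by norm_num)).mul_const
    (Real.exp (-q ^ 2 / 2) / (2 * Real.pi))).congr (Filter.Eventually.of_forall fun p => ?_)
  have : Real.exp (-(q ^ 2 + p ^ 2) / 2) = Real.exp (-(1 / 2) * p ^ 2) * Real.exp (-q ^ 2 / 2) := by
    rw [← Real.exp_add]
    congr 1
    ring
  simp only [husimi, hP, this]
  ring

theorem integrable_overlap (ψ : ℕ → ℂ) (M : ℕ) (q : ℝ) :
    Integrable fun p => ∫ x, waveFun ψ M x * wavePacket q p x := by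
  obtain ⟨P, hP⟩ := bargmann_eq_poly ψ M q
  simp only [integral_waveFun_mul_wavePacket]
  refine Integrable.mono' (((integrable_poly_mul_exp P (c := 1 / 4) (by norm_num)).norm).const_mul
    (√(√Real.pi))) ?_ (Filter.Eventually.of_forall fun p => ?_)
  · refine Continuous.aestronglyMeasurable ?_
    simp only [gabor_zero, hP]
    fun_prop
  · rw [hP, norm_mul, norm_mul]
    have h : ‖gabor 0 q p‖ ≤ √(√Real.pi) * Real.exp (-(1 / 4) * p ^ 2) := by
      refine le_of_sq_le_sq ?_ (by positivity)
      rw [norm_sq_gabor_zero, mul_pow, Real.sq_sqrt (by positivity), ← Real.exp_nat_mul]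
      refine mul_le_mul_of_nonneg_left (Real.exp_le_exp.2 ?_) (by positivity)
      push_cast
      nlinarith [sq_nonneg q]
    rw [Complex.norm_real, Real.norm_of_nonneg (Real.exp_pos _).le]
    calc ‖Polynomial.eval (p : ℂ) P‖ * ‖gabor 0 q p‖
        ≤ ‖Polynomial.eval (p : ℂ) P‖ * (√(√Real.pi) * Real.exp (-(1 / 4) * p ^ 2)) :=
          mul_le_mul_of_nonneg_left h (norm_nonneg _)
      _ = _ := by ring

open scoped FourierTransform in
-- As a function of `p`, the overlap with the wave packet is a rescaled Fourier transform of
-- `waveFun ψ M` times the Gaussian centred at `q`; Plancherel's identity does the rest.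
theorem integral_husimi (ψ : ℕ → ℂ) (M : ℕ) (q : ℝ) :
    ∫ p, husimi ψ M q p = ∫ x, ‖waveFun ψ M x‖ ^ 2 * (Real.exp (-(x - q) ^ 2) / √Real.pi) := by
  set u : ℝ → ℂ := fun x => waveFun ψ M x * wavePacket q 0 x with hu
  set G : ℝ → ℂ := fun p => ∫ x, waveFun ψ M x * wavePacket q p x with hG
  have hFu : 𝓕 u = fun ξ => G (2 * Real.pi * ξ) := by
    funext ξ
    rw [Real.fourier_real_eq_integral_exp_smul]
    refine integral_congr_ae (Filter.Eventually.of_forall fun x => ?_)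
    simp only [hu, smul_eq_mul, wavePacket]
    rw [mul_left_comm, ← Complex.exp_add]
    congr 2
    push_cast
    ring
  have hGint : Integrable G := integrable_overlap ψ M q
  have hpi : (0 : ℝ) < 2 * Real.pi := by positivity
  have h1 := integral_norm_sq_fourier (f := u)
    ((continuous_waveFun ψ M).mul (continuous_wavePacket q 0))
    (Integrable.mul_wavePacket (integrable_waveFun ψ M) q 0)
    (by rw [hFu]; exact hGint.comp_mul_left' hpi.ne')
  simp only [hFu] at h1
  rw [Measure.integral_comp_mul_left (fun p => ‖G p‖ ^ 2)] at h1
  have h2 : ∀ p, ‖G p‖ ^ 2 = 2 * Real.pi * √Real.pi * husimi ψ M q p := norm_sq_overlap ψ M q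
  have h3 : ∀ x, ‖u x‖ ^ 2
      = √Real.pi * (‖waveFun ψ M x‖ ^ 2 * (Real.exp (-(x - q) ^ 2) / √Real.pi)) := by
    intro x
    rw [hu, norm_mul, norm_wavePacket, mul_pow, ← Real.exp_nat_mul]
    have : ((2 : ℕ) : ℝ) * (-(x - q) ^ 2 / 2) = -(x - q) ^ 2 := by push_cast; ring
    rw [this]
    field_simp
  simp only [h2, h3] at h1
  rw [integral_const_mul, integral_const_mul, smul_eq_mul, abs_of_pos (by positivity)] at h1
  have hs : (0 : ℝ) < √Real.pi := by positivity
  field_simp at h1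
  simp only [mul_div_assoc] at h1 ⊢
  exact h1

theorem integrable_norm_sq_waveFun_mul (ψ : ℕ → ℂ) (M : ℕ) (q : ℝ) :
    Integrable fun x => ‖waveFun ψ M x‖ ^ 2 * (Real.exp (-(x - q) ^ 2) / √Real.pi) := by
  refine (integrable_norm_sq_waveFun ψ M).mul_bdd (c := 1 / √Real.pi) ?_
    (Filter.Eventually.of_forall fun x => ?_)
  · exact Continuous.aestronglyMeasurable (by fun_prop)
  · rw [Real.norm_of_nonneg (by positivity)]
    gcongr
    exact Real.exp_le_one_iff.2 (by nlinarith [sq_nonneg (x - q)])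

theorem lintegral_husimi (ψ : ℕ → ℂ) (M : ℕ) (q : ℝ) :
    ∫⁻ p, ENNReal.ofReal (husimi ψ M q p)
      = ∫⁻ x, ENNReal.ofReal (‖waveFun ψ M x‖ ^ 2)
          * ENNReal.ofReal (Real.exp (-(x - q) ^ 2) / √Real.pi) := by
  rw [← ofReal_integral_eq_lintegral_ofReal (integrable_husimi ψ M q)
    (Filter.Eventually.of_forall fun p => husimi_nonneg ψ M q p), integral_husimi,
    ofReal_integral_eq_lintegral_ofReal (integrable_norm_sq_waveFun_mul ψ M q)
    (Filter.Eventually.of_forall fun x => by positivity)]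
  exact lintegral_congr fun x => ENNReal.ofReal_mul (by positivity)

/-- The phases `(-i)ⁿ` of the momentum representation turn the argument of the Bargmann function by
a quarter circle, so the momentum marginal follows from the position marginal. -/
theorem husimi_rotate (ψ : ℕ → ℂ) (M : ℕ) (q p : ℝ) :
    husimi (fun n => (-Complex.I) ^ n * ψ n) M q p = husimi ψ M (-p) q := by
  have h : bargmann (fun n => (-Complex.I) ^ n * ψ n) M (((q : ℂ) - Complex.I * p) / (√2 : ℂ))
      = bargmann ψ M ((((-p : ℝ) : ℂ) - Complex.I * q) / (√2 : ℂ)) := by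
    unfold bargmann
    refine Finset.sum_congr rfl fun n _ => ?_
    have : (((-p : ℝ) : ℂ) - Complex.I * q) / (√2 : ℂ)
        = (-Complex.I) * (((q : ℂ) - Complex.I * p) / (√2 : ℂ)) := by
      push_cast
      linear_combination (-(p : ℂ) / (√2 : ℂ)) * Complex.I_sq
    rw [this, mul_pow]
    ring
  rw [husimi, husimi, h]
  congr 3
  ring

/-- The weight `x ↦ P(|x + g| ≥ b)`, for `g` centred Gaussian of variance `1/2`. -/
def gaussTail (b x : ℝ) : ENNReal :=
  ∫⁻ q in {q : ℝ | b ^ 2 ≤ q ^ 2}, ENNReal.ofReal (Real.exp (-(x - q) ^ 2) / √Real.pi)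

theorem measurableSet_sq_ge (c : ℝ) : MeasurableSet {q : ℝ | c ≤ q ^ 2} :=
  measurableSet_le measurable_const (by fun_prop)

theorem lintegral_husimi_position (ψ : ℕ → ℂ) (M : ℕ) (b : ℝ) :
    ∫⁻ q in {q : ℝ | b ^ 2 ≤ q ^ 2}, ∫⁻ p, ENNReal.ofReal (husimi ψ M q p)
      = ∫⁻ x, ENNReal.ofReal (‖waveFun ψ M x‖ ^ 2) * gaussTail b x := by
  simp only [lintegral_husimi]
  rw [lintegral_lintegral_swap]
  · refine lintegral_congr fun x => ?_
    rw [gaussTail, lintegral_const_mul]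
    fun_prop
  · refine Measurable.aemeasurable ?_
    have := (continuous_waveFun ψ M).measurable
    simp only [Function.uncurry_def]
    fun_prop

theorem lintegral_husimi_momentum (ψ : ℕ → ℂ) (M : ℕ) (b : ℝ) :
    ∫⁻ p in {p : ℝ | b ^ 2 ≤ p ^ 2}, ∫⁻ q, ENNReal.ofReal (husimi ψ M q p)
      = ∫⁻ x, ENNReal.ofReal (‖waveFun (fun n => (-Complex.I) ^ n * ψ n) M x‖ ^ 2)
          * gaussTail b x := by
  rw [← lintegral_husimi_position]
  refine lintegral_congr fun p => ?_
  simp only [husimi_rotate]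
  exact (lintegral_neg_eq_self (fun q => ENNReal.ofReal (husimi ψ M q p))).symm

/-- Union bound: `q² + p² ≥ 2b²` forces `q² ≥ b²` or `p² ≥ b²`, and each of these events concerns
one marginal only. -/
theorem lintegral_husimi_outside_le (ψ : ℕ → ℂ) (M : ℕ) (b : ℝ) :
    ∫⁻ x in {x : ℝ × ℝ | 2 * b ^ 2 ≤ x.1 ^ 2 + x.2 ^ 2}, ENNReal.ofReal (husimi ψ M x.1 x.2)
      ≤ (∫⁻ x, ENNReal.ofReal (‖waveFun ψ M x‖ ^ 2) * gaussTail b x)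
        + ∫⁻ x, ENNReal.ofReal (‖waveFun (fun n => (-Complex.I) ^ n * ψ n) M x‖ ^ 2)
          * gaussTail b x := by
  have hmeas : Measurable fun x : ℝ × ℝ => ENNReal.ofReal (husimi ψ M x.1 x.2) :=
    (continuous_husimi ψ M).measurable.ennreal_ofReal
  set B : Set ℝ := {q : ℝ | b ^ 2 ≤ q ^ 2} with hB
  have hsub : {x : ℝ × ℝ | 2 * b ^ 2 ≤ x.1 ^ 2 + x.2 ^ 2} ⊆ (B ×ˢ Set.univ) ∪ (Set.univ ×ˢ B) := by
    intro x hx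
    simp only [Set.mem_ofPred_eq] at hx
    by_cases h : b ^ 2 ≤ x.1 ^ 2
    · exact Or.inl ⟨h, trivial⟩
    · exact Or.inr ⟨trivial, by simp only [hB, Set.mem_ofPred_eq]; linarith⟩
  refine (lintegral_mono_set hsub).trans ((lintegral_union_le _ _ _).trans (add_le_add ?_ ?_))
  · rw [← lintegral_husimi_position, Measure.volume_eq_prod, ← Measure.prod_restrict,
      Measure.restrict_univ, lintegral_prod _ hmeas.aemeasurable]
  · rw [← lintegral_husimi_momentum, Measure.volume_eq_prod, ← Measure.prod_restrict,
      Measure.restrict_univ, lintegral_prod_symm _ hmeas.aemeasurable]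

/-! ### The Husimi function in polar coordinates -/

theorem integral_exp_int_mul {k : ℤ} (hk : k ≠ 0) :
    ∫ θ in (-Real.pi)..Real.pi, Complex.exp ((k * Complex.I) * θ) = 0 := by
  have hk' : ((k : ℂ) * Complex.I) ≠ 0 := mul_ne_zero (by exact_mod_cast hk) Complex.I_ne_zero
  rw [integral_exp_mul_complex hk']
  have : Complex.exp ((k * Complex.I) * Real.pi)
      = Complex.exp ((k * Complex.I) * ((-Real.pi : ℝ) : ℂ)) := by
    rw [Complex.exp_eq_exp_iff_exists_int]
    exact ⟨k, by push_cast; ring⟩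
  rw [this, sub_self, zero_div]

/-- Parseval's identity for trigonometric polynomials. -/
theorem integral_norm_sq_trig (c : ℕ → ℂ) (M : ℕ) :
    ∫ θ in (-Real.pi)..Real.pi,
        ‖∑ n ∈ Finset.range M, c n * Complex.exp (-(n * Complex.I) * θ)‖ ^ 2
      = 2 * Real.pi * ∑ n ∈ Finset.range M, ‖c n‖ ^ 2 := by
  have h1 : ∀ θ : ℝ, ((‖∑ n ∈ Finset.range M, c n * Complex.exp (-(n * Complex.I) * θ)‖ ^ 2 : ℝ) : ℂ)
      = ∑ n ∈ Finset.range M, ∑ m ∈ Finset.range M, c n * (starRingEnd ℂ) (c m)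
        * Complex.exp ((((m : ℤ) - (n : ℤ) : ℤ) * Complex.I) * θ) := by
    intro θ
    push_cast
    rw [← Complex.mul_conj', map_sum, Finset.sum_mul_sum]
    refine Finset.sum_congr rfl fun n _ => Finset.sum_congr rfl fun m _ => ?_
    rw [map_mul, ← Complex.exp_conj]
    simp only [map_mul, map_neg, Complex.conj_I, Complex.conj_ofReal, map_natCast]
    have : Complex.exp (((m : ℂ) - n) * Complex.I * θ) = Complex.exp (-(n * Complex.I) * θ)
        * Complex.exp (-(m * -Complex.I) * θ) := by
      rw [← Complex.exp_add]
      congr 1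
      ring
    rw [this]
    ring
  have h2 : ∫ θ in (-Real.pi)..Real.pi,
      ((‖∑ n ∈ Finset.range M, c n * Complex.exp (-(n * Complex.I) * θ)‖ ^ 2 : ℝ) : ℂ)
      = ((2 * Real.pi * ∑ n ∈ Finset.range M, ‖c n‖ ^ 2 : ℝ) : ℂ) := by
    simp only [h1]
    rw [intervalIntegral.integral_finsetSum
      fun n _ => Continuous.intervalIntegrable (by fun_prop) _ _]
    push_cast
    rw [Finset.mul_sum]
    refine Finset.sum_congr rfl fun n hn => ?_
    rw [intervalIntegral.integral_finsetSum
      fun m _ => Continuous.intervalIntegrable (by fun_prop) _ _]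
    rw [Finset.sum_eq_single n]
    · simp [← Complex.mul_conj']
      ring
    · intro m _ hmn
      rw [intervalIntegral.integral_const_mul]
      have := integral_exp_int_mul (k := (m : ℤ) - n) (by
        rw [sub_ne_zero]
        exact_mod_cast hmn)
      push_cast at this
      rw [this, mul_zero]
    · exact fun h => absurd hn h
  rw [intervalIntegral.integral_ofReal] at h2
  exact_mod_cast h2

/-- The weight of the number state `|n⟩` outside of the disc of radius `√2 b`. -/
def radialWeight (b : ℝ) (n : ℕ) : ENNReal :=
  ∫⁻ r in Set.Ioi (√2 * b), ENNReal.ofReal (r * ((r ^ 2 / 2) ^ n / n.factorial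
    * Real.exp (-r ^ 2 / 2)))

/-- On a circle the Bargmann function is a trigonometric polynomial, so the angular integral removes
all coherences between different photon numbers. -/
theorem integral_husimi_angle (ψ : ℕ → ℂ) (M : ℕ) (r : ℝ) :
    ∫ θ in (-Real.pi)..Real.pi, husimi ψ M (r * Real.cos θ) (r * Real.sin θ)
      = ∑ n ∈ Finset.range M, ‖ψ n‖ ^ 2 * ((r ^ 2 / 2) ^ n / n.factorial
        * Real.exp (-r ^ 2 / 2)) := by
  have h : ∀ θ : ℝ, husimi ψ M (r * Real.cos θ) (r * Real.sin θ)
      = ‖∑ n ∈ Finset.range M, (ψ n * (((r : ℂ) / √2) ^ n / (√(n.factorial : ℝ) : ℂ)))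
        * Complex.exp (-(n * Complex.I) * θ)‖ ^ 2 * (Real.exp (-r ^ 2 / 2) / (2 * Real.pi)) := by
    intro θ
    have hz : ((((r * Real.cos θ : ℝ) : ℂ)) - Complex.I * ((r * Real.sin θ : ℝ) : ℂ)) / (√2 : ℂ)
        = (r : ℂ) / √2 * Complex.exp (-(Complex.I * θ)) := by
      have : Complex.exp (-(Complex.I * θ)) = Real.cos θ - Real.sin θ * Complex.I := by
        have := Complex.exp_mul_I (-(θ : ℂ))
        rw [Complex.cos_neg, Complex.sin_neg] at this
        rw [Complex.ofReal_cos, Complex.ofReal_sin]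
        rw [show -(Complex.I * (θ : ℂ)) = -(θ : ℂ) * Complex.I by ring, this]
        ring
      rw [this]
      push_cast
      ring
    rw [husimi, hz, bargmann]
    have hr : (r * Real.cos θ) ^ 2 + (r * Real.sin θ) ^ 2 = r ^ 2 := by
      linear_combination r ^ 2 * Real.cos_sq_add_sin_sq θ
    rw [hr, mul_div_assoc]
    congr 3
    refine Finset.sum_congr rfl fun n _ => ?_
    rw [mul_pow, ← Complex.exp_nat_mul]
    have : (n : ℂ) * -(Complex.I * θ) = -(n * Complex.I) * θ := by ring
    rw [this]
    ring
  simp only [h]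
  rw [intervalIntegral.integral_mul_const, integral_norm_sq_trig, Finset.mul_sum, Finset.sum_mul]
  refine Finset.sum_congr rfl fun n _ => ?_
  have h2 : ‖ψ n * (((r : ℂ) / √2) ^ n / (√(n.factorial : ℝ) : ℂ))‖ ^ 2
      = ‖ψ n‖ ^ 2 * ((r ^ 2 / 2) ^ n / n.factorial) := by
    rw [norm_mul, norm_div, norm_pow, norm_div, Complex.norm_real, Complex.norm_real,
      Complex.norm_real, mul_pow, div_pow, ← pow_mul, mul_comm n 2, pow_mul, div_pow]
    simp only [Real.norm_eq_abs, sq_abs]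
    rw [Real.sq_sqrt (by norm_num), Real.sq_sqrt (by positivity)]
  rw [h2]
  field_simp

theorem lintegral_husimi_outside (ψ : ℕ → ℂ) (M : ℕ) {b : ℝ} (hb : 0 ≤ b) :
    ∑ n ∈ Finset.range M, ENNReal.ofReal (‖ψ n‖ ^ 2) * radialWeight b n
      ≤ ∫⁻ x in {x : ℝ × ℝ | 2 * b ^ 2 ≤ x.1 ^ 2 + x.2 ^ 2},
        ENNReal.ofReal (husimi ψ M x.1 x.2) := by
  have hcont := continuous_husimi ψ M
  have hms : MeasurableSet {x : ℝ × ℝ | 2 * b ^ 2 ≤ x.1 ^ 2 + x.2 ^ 2} :=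
    measurableSet_le measurable_const (by fun_prop)
  rw [← lintegral_indicator hms, ← lintegral_comp_polarCoord_symm]
  have htarget : polarCoord.target = Set.Ioi (0 : ℝ) ×ˢ Set.Ioo (-Real.pi) Real.pi := rfl
  have hsub : Set.Ioi (√2 * b) ×ˢ Set.Ioo (-Real.pi) Real.pi ⊆ polarCoord.target := by
    rw [htarget]
    exact Set.prod_mono (Set.Ioi_subset_Ioi (by positivity)) le_rfl
  refine le_trans ?_ (lintegral_mono_set hsub)
  have hmeas : Measurable fun x : ℝ × ℝ => ENNReal.ofReal x.1
      * ENNReal.ofReal (husimi ψ M (x.1 * Real.cos x.2) (x.1 * Real.sin x.2)) := by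
    have h1 : Continuous fun x : ℝ × ℝ => husimi ψ M (x.1 * Real.cos x.2) (x.1 * Real.sin x.2) :=
      hcont.comp (f := fun x : ℝ × ℝ => (x.1 * Real.cos x.2, x.1 * Real.sin x.2)) (by fun_prop)
    exact (measurable_fst.ennreal_ofReal).mul h1.measurable.ennreal_ofReal
  have hcongr : ∫⁻ x in Set.Ioi (√2 * b) ×ˢ Set.Ioo (-Real.pi) Real.pi, ENNReal.ofReal x.1 •
      ({x : ℝ × ℝ | 2 * b ^ 2 ≤ x.1 ^ 2 + x.2 ^ 2}.indicator
        (fun x => ENNReal.ofReal (husimi ψ M x.1 x.2))) (polarCoord.symm x)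
      = ∫⁻ x in Set.Ioi (√2 * b) ×ˢ Set.Ioo (-Real.pi) Real.pi, ENNReal.ofReal x.1
        * ENNReal.ofReal (husimi ψ M (x.1 * Real.cos x.2) (x.1 * Real.sin x.2)) := by
    refine setLIntegral_congr_fun (measurableSet_Ioi.prod measurableSet_Ioo) fun x hx => ?_
    have hx1 : √2 * b < x.1 := hx.1
    rw [polarCoord_symm_apply, Set.indicator_of_mem, smul_eq_mul]
    simp only [Set.mem_ofPred_eq]
    have h1 : (x.1 * Real.cos x.2) ^ 2 + (x.1 * Real.sin x.2) ^ 2 = x.1 ^ 2 := by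
      linear_combination x.1 ^ 2 * Real.cos_sq_add_sin_sq x.2
    have h2 : (√2 * b) ^ 2 = 2 * b ^ 2 := by rw [mul_pow, Real.sq_sqrt (by norm_num)]
    rw [h1, ← h2]
    exact pow_le_pow_left₀ (by positivity) hx1.le 2
  rw [hcongr, Measure.volume_eq_prod, ← Measure.prod_restrict, lintegral_prod _ hmeas.aemeasurable]
  have hinner : ∀ r ∈ Set.Ioi (√2 * b), ∫⁻ θ in Set.Ioo (-Real.pi) Real.pi, ENNReal.ofReal r
        * ENNReal.ofReal (husimi ψ M (r * Real.cos θ) (r * Real.sin θ))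
      = ∑ n ∈ Finset.range M, ENNReal.ofReal (‖ψ n‖ ^ 2)
        * ENNReal.ofReal (r * ((r ^ 2 / 2) ^ n / n.factorial * Real.exp (-r ^ 2 / 2))) := by
    intro r hr
    have hr0 : 0 ≤ r := (by positivity : 0 ≤ √2 * b).trans (le_of_lt hr)
    have hc : Continuous fun θ : ℝ => husimi ψ M (r * Real.cos θ) (r * Real.sin θ) :=
      hcont.comp (f := fun θ : ℝ => (r * Real.cos θ, r * Real.sin θ)) (by fun_prop)
    rw [lintegral_const_mul _ hc.measurable.ennreal_ofReal,
      ← ofReal_integral_eq_lintegral_ofReal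
        ((hc.integrableOn_Icc (a := -Real.pi) (b := Real.pi)).mono_set Set.Ioo_subset_Icc_self)
        (Filter.Eventually.of_forall fun θ => husimi_nonneg ψ M _ _),
      ← integral_Ioc_eq_integral_Ioo,
      ← intervalIntegral.integral_of_le (by linarith [Real.pi_pos]), integral_husimi_angle,
      ENNReal.ofReal_sum_of_nonneg (fun n _ => by positivity), Finset.mul_sum]
    refine Finset.sum_congr rfl fun n _ => ?_
    rw [ENNReal.ofReal_mul (by positivity), ENNReal.ofReal_mul hr0]
    ring
  rw [setLIntegral_congr_fun measurableSet_Ioi hinner, lintegral_finsetSum]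
  · refine le_of_eq (Finset.sum_congr rfl fun n _ => ?_)
    rw [lintegral_const_mul, radialWeight]
    fun_prop
  · intro n _
    fun_prop

/-! ### Quadratic forms of the effects -/

theorem op_nonneg_of_form {β : Type} {A : Op β} {a : FockSpace β → ℝ}
    (h : ∀ ψ, inner ℂ ψ (A ψ) = (a ψ : ℂ)) (ha : ∀ ψ, 0 ≤ a ψ) : 0 ≤ A := by
  rw [ContinuousLinearMap.nonneg_iff_isPositive, ContinuousLinearMap.isPositive_iff_complex]
  intro ψ
  have h' : inner ℂ (A ψ) ψ = (a ψ : ℂ) := by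
    rw [← inner_conj_symm, h, Complex.conj_ofReal]
  rw [h']
  exact ⟨by simp, by simpa using ha ψ⟩

/-- The probability that a wave function gives to a Borel set. -/
def bornProb (w : WaveFunctions) (B : Set ℝ) : ℝ := ∫ x in B, ‖w x‖ ^ 2

theorem integrable_norm_sq (w : WaveFunctions) : Integrable fun x => ‖w x‖ ^ 2 :=
  (memLp_two_iff_integrable_sq_norm (Lp.aestronglyMeasurable w)).1 (Lp.memLp w)

theorem bornProb_nonneg (w : WaveFunctions) (B : Set ℝ) : 0 ≤ bornProb w B :=
  integral_nonneg fun _ => sq_nonneg _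

theorem bornProb_univ (w : WaveFunctions) : ∫ x, ‖w x‖ ^ 2 = ‖w‖ ^ 2 := by
  have h : inner ℂ w w = ((‖w‖ ^ 2 : ℝ) : ℂ) := by
    rw [inner_self_eq_norm_sq_to_K]
    norm_cast
  rw [L2.inner_def] at h
  simp only [inner_self_eq_norm_sq_to_K] at h
  have h2 : ∫ x, ((‖w x‖ ^ 2 : ℝ) : ℂ) = ((‖w‖ ^ 2 : ℝ) : ℂ) := by
    rw [← h]
    exact integral_congr_ae (.of_forall fun x => by norm_cast)
  rw [integral_complex_ofReal] at h2
  exact_mod_cast h2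

theorem bornProb_le (w : WaveFunctions) (B : Set ℝ) : bornProb w B ≤ ‖w‖ ^ 2 := by
  rw [← bornProb_univ]
  exact setIntegral_le_integral (integrable_norm_sq w) (.of_forall fun x => sq_nonneg _)

theorem inner_spectralProj (W : FockSpace ℕ →ₗᵢ[ℂ] WaveFunctions) (B : Set ℝ) (ψ : FockSpace ℕ) :
    inner ℂ ψ (spectralProj W B ψ) = (bornProb (W ψ) B : ℂ) := by
  simp only [spectralProj, ContinuousLinearMap.comp_apply, ContinuousLinearMap.adjoint_inner_right]
  rw [L2.inner_def, bornProb, ← integral_complex_ofReal]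
  refine integral_congr_ae ?_
  filter_upwards [LpToLpRestrictCLM_coeFn (p := 2) (μ := volume) (F := ℂ) ℂ B (W ψ)] with x hx
  simp only [LinearIsometry.coe_toContinuousLinearMap]
  rw [hx, inner_self_eq_norm_sq_to_K]
  norm_cast

/-- The probability of at least `d₀` photons. -/
def photonProb (d₀ : ℝ) (ψ : FockSpace ℕ) : ℝ :=
  ∑' n : ℕ, {n : ℕ | d₀ ≤ n}.indicator (fun n => ‖ψ n‖ ^ 2) n

theorem summable_photonProb (d₀ : ℝ) (ψ : FockSpace ℕ) :
    Summable fun n => {n : ℕ | d₀ ≤ n}.indicator (fun n => ‖ψ n‖ ^ 2) n :=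
  (summable_sq ψ).indicator _

theorem photonProb_nonneg (d₀ : ℝ) (ψ : FockSpace ℕ) : 0 ≤ photonProb d₀ ψ :=
  tsum_nonneg fun _ => Set.indicator_nonneg (fun _ _ => sq_nonneg _) _

theorem photonProb_le (d₀ : ℝ) (ψ : FockSpace ℕ) : photonProb d₀ ψ ≤ ‖ψ‖ ^ 2 := by
  rw [norm_sq_eq]
  exact (summable_photonProb d₀ ψ).tsum_le_tsum
    (fun n => Set.indicator_le_self' (fun _ _ => sq_nonneg _) n) (summable_sq ψ)

theorem inner_photonEffect (d₀ : ℝ) (ψ : FockSpace ℕ) :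
    inner ℂ ψ (photonEffect d₀ ψ) = (photonProb d₀ ψ : ℂ) := by
  classical
  rw [lp.inner_eq_tsum, photonProb, Complex.ofReal_tsum]
  refine tsum_congr fun n => ?_
  have : photonEffect d₀ ψ n = if d₀ ≤ (n : ℝ) then ψ n else 0 := by
    simp only [photonEffect]
    change (if d₀ ≤ (n : ℝ) then ψ n else 0) = _
    congr
  rw [this, Set.indicator_apply]
  by_cases h : d₀ ≤ (n : ℝ)
  · simp only [h, if_true, Set.mem_ofPred_eq, inner_self_eq_norm_sq_to_K]
    norm_cast
  · simp [h]

theorem inner_one (β : Type) (ψ : FockSpace β) :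
    inner ℂ ψ ((1 : Op β) ψ) = ((‖ψ‖ ^ 2 : ℝ) : ℂ) := by
  rw [one_apply_eq_self, inner_self_eq_norm_sq_to_K]
  norm_cast

/-- The probability that the outcome of a random quadrature lies in `{x | d₀/2 ≤ x²}`. -/
def homodyneProb (d₀ : ℝ) (ψ : FockSpace ℕ) : ℝ :=
  (bornProb (positionRep ψ) {x | d₀ / 2 ≤ x ^ 2} + bornProb (momentumRep ψ) {x | d₀ / 2 ≤ x ^ 2}) / 2

theorem inner_homodyneEffect (d₀ : ℝ) (ψ : FockSpace ℕ) :
    inner ℂ ψ (homodyneEffect d₀ ψ) = (homodyneProb d₀ ψ : ℂ) := by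
  rw [homodyneEffect, add_apply, smul_apply,
    smul_apply, inner_add_right, inner_smul_right, inner_smul_right,
    inner_spectralProj, inner_spectralProj, homodyneProb]
  push_cast
  ring

theorem photonEffect_nonneg (d₀ : ℝ) : 0 ≤ photonEffect d₀ :=
  op_nonneg_of_form (inner_photonEffect d₀) (photonProb_nonneg d₀)

theorem photonEffect_le_one (d₀ : ℝ) : photonEffect d₀ ≤ 1 := by
  rw [← sub_nonneg]
  refine op_nonneg_of_form (a := fun ψ => ‖ψ‖ ^ 2 - photonProb d₀ ψ) (fun ψ => ?_)
    fun ψ => sub_nonneg.2 (photonProb_le d₀ ψ)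
  rw [sub_apply, inner_sub_right, inner_photonEffect, inner_one]
  push_cast
  rfl

theorem homodyneEffect_nonneg (d₀ : ℝ) : 0 ≤ homodyneEffect d₀ :=
  op_nonneg_of_form (inner_homodyneEffect d₀) fun _ =>
    div_nonneg (add_nonneg (bornProb_nonneg _ _) (bornProb_nonneg _ _)) zero_le_two

theorem homodyneEffect_le_one (d₀ : ℝ) : homodyneEffect d₀ ≤ 1 := by
  rw [← sub_nonneg]
  refine op_nonneg_of_form (a := fun ψ => ‖ψ‖ ^ 2 - homodyneProb d₀ ψ) (fun ψ => ?_) fun ψ => ?_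
  · rw [sub_apply, inner_sub_right, inner_homodyneEffect, inner_one]
    push_cast
    rfl
  · have h1 := bornProb_le (positionRep ψ) {x | d₀ / 2 ≤ x ^ 2}
    have h2 := bornProb_le (momentumRep ψ) {x | d₀ / 2 ≤ x ^ 2}
    rw [LinearIsometry.norm_map] at h1 h2
    rw [homodyneProb]
    linarith

/-! ### Comparison of the effects of one mode -/

/-- The projection of `ψ` to the span of the first `M` number states. -/
def fockTrunc (M : ℕ) (ψ : FockSpace ℕ) : FockSpace ℕ := ∑ n ∈ Finset.range M, ψ n • ket n

theorem tendsto_fockTrunc (ψ : FockSpace ℕ) :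
    Filter.Tendsto (fun M => fockTrunc M ψ) Filter.atTop (nhds ψ) := by
  have h := (lp.hasSum_single (p := 2) (by simp) ψ).tendsto_sum_nat
  refine h.congr fun M => Finset.sum_congr rfl fun n _ => ?_
  rw [ket, ← lp.single_smul]
  simp

theorem fockTrunc_apply (M : ℕ) (ψ : FockSpace ℕ) (n : ℕ) :
    fockTrunc M ψ n = if n < M then ψ n else 0 := by
  rw [fockTrunc, lp.coeFn_sum, Finset.sum_apply]
  simp only [lp.coeFn_smul, Pi.smul_apply, ket_apply, smul_eq_mul]
  simp

theorem positionRep_sum_ket (c : ℕ → ℂ) (M : ℕ) :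
    positionRep (∑ n ∈ Finset.range M, c n • ket n) =ᵐ[volume] waveFun c M := by
  induction M with
  | zero =>
    simp only [Finset.range_zero, Finset.sum_empty, map_zero]
    filter_upwards [Lp.coeFn_zero ℂ 2 (volume : Measure ℝ)] with x hx
    rw [hx]
    simp [waveFun]
  | succ M ih =>
    rw [Finset.sum_range_succ, map_add, map_smul, positionRep_ket]
    filter_upwards [ih, Lp.coeFn_add (positionRep (∑ n ∈ Finset.range M, c n • ket n))
      (c M • fockWave M), Lp.coeFn_smul (c M) (fockWave M), (memLp_hermiteFun M).coeFn_toLp]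
      with x h1 h2 h3 h4
    rw [h2, Pi.add_apply, h1, h3, Pi.smul_apply, fockWave, h4, waveFun, waveFun,
      Finset.sum_range_succ, smul_eq_mul]

theorem momentumRep_sum_ket (c : ℕ → ℂ) (M : ℕ) :
    momentumRep (∑ n ∈ Finset.range M, c n • ket n)
      =ᵐ[volume] waveFun (fun n => (-Complex.I) ^ n * c n) M := by
  have : momentumRep (∑ n ∈ Finset.range M, c n • ket n)
      = positionRep (∑ n ∈ Finset.range M, ((-Complex.I) ^ n * c n) • ket n) := by
    simp only [map_sum, map_smul, momentumRep_ket, positionRep_ket, smul_smul]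
    exact Finset.sum_congr rfl fun n _ => by rw [mul_comm]
  rw [this]
  exact positionRep_sum_ket _ M

theorem gaussTail_le_one (b x : ℝ) : gaussTail b x ≤ 1 := by
  refine (setLIntegral_le_lintegral _ _).trans ?_
  have hint : Integrable fun q : ℝ => Real.exp (-(x - q) ^ 2) / √Real.pi := by
    have h := ((integrable_exp_neg_mul_sq (b := 1) one_pos).comp_sub_left x).div_const (√Real.pi)
    simpa using h
  rw [← ofReal_integral_eq_lintegral_ofReal hint (.of_forall fun q => by positivity)]
  have h : ∫ q : ℝ, Real.exp (-(x - q) ^ 2) / √Real.pi = 1 := by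
    have h1 := integral_sub_left_eq_self (fun q : ℝ => Real.exp (-1 * q ^ 2)) volume x
    rw [integral_gaussian, div_one] at h1
    simp only [neg_one_mul] at h1
    rw [integral_div, h1, div_self (by positivity)]
  rw [h, ENNReal.ofReal_one]

/-- Points beyond the homodyne threshold get the trivial weight `1`, the others at most `e`. -/
theorem lintegral_mul_gaussTail_le {w : WaveFunctions} {f : ℝ → ℂ} (hw : w =ᵐ[volume] f)
    {d₀ b e : ℝ} (he : ∀ x : ℝ, x ^ 2 < d₀ / 2 → gaussTail b x ≤ ENNReal.ofReal e) (he0 : 0 ≤ e) :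
    ∫⁻ x, ENNReal.ofReal (‖f x‖ ^ 2) * gaussTail b x
      ≤ ENNReal.ofReal ((1 - e) * bornProb w {x | d₀ / 2 ≤ x ^ 2} + e * ‖w‖ ^ 2) := by
  set B : Set ℝ := {x | d₀ / 2 ≤ x ^ 2} with hB
  have hBm : MeasurableSet B := measurableSet_sq_ge _
  have h0 : ∫⁻ x, ENNReal.ofReal (‖f x‖ ^ 2) * gaussTail b x
      = ∫⁻ x, ENNReal.ofReal (‖w x‖ ^ 2) * gaussTail b x := by
    refine lintegral_congr_ae ?_
    filter_upwards [hw] with x hx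
    rw [hx]
  have hint := integrable_norm_sq w
  have hof : ∀ s : Set ℝ, ∫⁻ x in s, ENNReal.ofReal (‖w x‖ ^ 2) = ENNReal.ofReal (bornProb w s) :=
    fun s => (ofReal_integral_eq_lintegral_ofReal hint.integrableOn
      (.of_forall fun x => sq_nonneg _)).symm
  rw [h0, ← lintegral_add_compl _ hBm]
  have h1 : ∫⁻ x in B, ENNReal.ofReal (‖w x‖ ^ 2) * gaussTail b x
      ≤ ENNReal.ofReal (bornProb w B) := by
    rw [← hof]
    exact lintegral_mono fun x => mul_le_of_le_one_right' (gaussTail_le_one b x)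
  have h2 : ∫⁻ x in Bᶜ, ENNReal.ofReal (‖w x‖ ^ 2) * gaussTail b x
      ≤ ENNReal.ofReal (bornProb w Bᶜ * e) := by
    rw [ENNReal.ofReal_mul (bornProb_nonneg _ _), ← hof, ← lintegral_mul_const' _ _ (by simp)]
    refine setLIntegral_mono' hBm.compl fun x hx => mul_le_mul_right (he x ?_) _
    simpa [hB] using hx
  have h3 : bornProb w B + bornProb w Bᶜ = ‖w‖ ^ 2 := by
    rw [← bornProb_univ]
    exact integral_add_compl hBm hint
  refine (add_le_add h1 h2).trans ?_
  rw [← ENNReal.ofReal_add (bornProb_nonneg _ _) (mul_nonneg (bornProb_nonneg _ _) he0)]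
  refine ENNReal.ofReal_le_ofReal (le_of_eq ?_)
  linear_combination e * h3

/-- The Husimi weight outside the disc is estimated from below by photon numbers and from above by
the two quadratures. Truncation to finitely many number states keeps the wave functions polynomial
times Gaussian. -/
theorem photonProb_fockTrunc_le {d₀ b p e : ℝ} (hb : 0 ≤ b) (hp0 : 0 ≤ p)
    (hp : ∀ n : ℕ, d₀ ≤ n → ENNReal.ofReal p ≤ radialWeight b n)
    (he : ∀ x : ℝ, x ^ 2 < d₀ / 2 → gaussTail b x ≤ ENNReal.ofReal e) (he0 : 0 ≤ e) (he1 : e ≤ 1)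
    (M : ℕ) (ψ : FockSpace ℕ) :
    p * photonProb d₀ (fockTrunc M ψ)
      ≤ 2 * (1 - e) * homodyneProb d₀ (fockTrunc M ψ) + 2 * e * ‖fockTrunc M ψ‖ ^ 2 := by
  have h1 := lintegral_mul_gaussTail_le (positionRep_sum_ket ψ M) he he0
  have h2 := lintegral_mul_gaussTail_le (momentumRep_sum_ket ψ M) he he0
  rw [LinearIsometry.norm_map] at h1 h2
  have h3 := (lintegral_husimi_outside ψ M hb).trans
    ((lintegral_husimi_outside_le ψ M b).trans (add_le_add h1 h2))
  rw [← fockTrunc] at h3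
  have h4 : ENNReal.ofReal (p * photonProb d₀ (fockTrunc M ψ))
      ≤ ∑ n ∈ Finset.range M, ENNReal.ofReal (‖ψ n‖ ^ 2) * radialWeight b n := by
    rw [photonProb, tsum_eq_sum (s := Finset.range M), Finset.mul_sum,
      ENNReal.ofReal_sum_of_nonneg]
    · refine Finset.sum_le_sum fun n hn => ?_
      rw [Set.indicator_apply]
      split_ifs with h
      · rw [fockTrunc_apply, if_pos (Finset.mem_range.1 hn), mul_comm p,
          ENNReal.ofReal_mul (sq_nonneg _)]
        exact mul_le_mul_right (hp n h) _
      · simp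
    · exact fun n _ => mul_nonneg hp0 (Set.indicator_nonneg (fun _ _ => sq_nonneg _) _)
    · intro n hn
      have h0 : fockTrunc M ψ n = 0 := by
        rw [fockTrunc_apply, if_neg (by simpa using hn)]
      rw [Set.indicator_apply, h0]
      simp
  have h5 : ∀ w : WaveFunctions, 0 ≤ (1 - e) * bornProb w {x | d₀ / 2 ≤ x ^ 2}
      + e * ‖fockTrunc M ψ‖ ^ 2 := fun w =>
    add_nonneg (mul_nonneg (by linarith) (bornProb_nonneg _ _)) (by positivity)
  have h6 := h4.trans h3
  rw [← ENNReal.ofReal_add (h5 _) (h5 _), ENNReal.ofReal_le_ofReal_iff (add_nonneg (h5 _) (h5 _))]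
    at h6
  rw [homodyneProb]
  linarith

theorem continuous_form {β : Type} {A : Op β} {a : FockSpace β → ℝ}
    (h : ∀ ψ, inner ℂ ψ (A ψ) = (a ψ : ℂ)) : Continuous a := by
  have : a = fun ψ => (inner ℂ ψ (A ψ)).re := by
    funext ψ
    rw [h, Complex.ofReal_re]
  rw [this]
  exact Complex.continuous_re.comp (Continuous.inner continuous_id A.continuous)

/-- The quadratic forms are continuous, and the truncations are dense. -/
theorem smul_photonEffect_le {d₀ b p e : ℝ} (hb : 0 ≤ b) (hp0 : 0 ≤ p)
    (hp : ∀ n : ℕ, d₀ ≤ n → ENNReal.ofReal p ≤ radialWeight b n)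
    (he : ∀ x : ℝ, x ^ 2 < d₀ / 2 → gaussTail b x ≤ ENNReal.ofReal e)
    (he0 : 0 ≤ e) (he1 : e ≤ 1) :
    (p : ℂ) • photonEffect d₀
      ≤ ((2 * (1 - e) : ℝ) : ℂ) • homodyneEffect d₀ + ((2 * e : ℝ) : ℂ) • 1 := by
  rw [← sub_nonneg]
  have hc1 := continuous_form (inner_photonEffect d₀)
  have hc2 := continuous_form (inner_homodyneEffect d₀)
  refine op_nonneg_of_form (a := fun ψ => 2 * (1 - e) * homodyneProb d₀ ψ + 2 * e * ‖ψ‖ ^ 2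
    - p * photonProb d₀ ψ) (fun ψ => ?_) fun ψ => sub_nonneg.2 ?_
  · simp only [sub_apply, add_apply,
      smul_apply, inner_sub_right, inner_add_right, inner_smul_right,
      inner_photonEffect, inner_homodyneEffect, inner_one]
    push_cast
    rfl
  · refine le_of_tendsto_of_tendsto'
      (((continuous_const.mul hc1).tendsto ψ).comp (tendsto_fockTrunc ψ))
      ((((continuous_const.mul hc2).add (continuous_const.mul (continuous_norm.pow 2))).tendsto
        ψ).comp (tendsto_fockTrunc ψ)) fun M => ?_
    exact photonProb_fockTrunc_le hb hp0 hp he he0 he1 M ψ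

/-! ### Effects of a register -/

section Register

variable {k : ℕ} {U : Op (Fin k → ℕ)} (j : Fin k)

theorem registerEffect_nonneg {A : Op ℕ} (hA : 0 ≤ A) : 0 ≤ registerEffect U j A := by
  have h := atSite_nonneg j hA
  rw [ContinuousLinearMap.nonneg_iff_isPositive] at h ⊢
  exact h.conj_adjoint U

theorem registerEffect_one (hU : U ∈ unitary (Op (Fin k → ℕ))) : registerEffect U j 1 = 1 := by
  rw [registerEffect, atSite_one, mul_one, Unitary.mul_star_self_of_mem hU]

theorem registerEffect_add (A B : Op ℕ) :
    registerEffect U j (A + B) = registerEffect U j A + registerEffect U j B := by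
  simp only [registerEffect, atSite_add, mul_add, add_mul]

theorem registerEffect_smul (c : ℂ) (A : Op ℕ) :
    registerEffect U j (c • A) = c • registerEffect U j A := by
  simp only [registerEffect, atSite_smul, mul_smul_comm, smul_mul_assoc]

theorem registerEffect_mono {A B : Op ℕ} (h : A ≤ B) :
    registerEffect U j A ≤ registerEffect U j B := by
  have h1 : B = A + (B - A) := by abel
  rw [h1, registerEffect_add]
  exact le_add_of_nonneg_right (registerEffect_nonneg j (sub_nonneg.2 h))

end Register

/-! ### Radial weights of number states -/

/-- The radial density of the Husimi function of `|n⟩`. -/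
def radialDensity (n : ℕ) (r : ℝ) : ℝ := r * ((r ^ 2 / 2) ^ n / n.factorial * Real.exp (-r ^ 2 / 2))

theorem radialDensity_eq (n : ℕ) (r : ℝ) : radialDensity n r
    = r ^ (2 * n + 1) * Real.exp (-r ^ 2 / 2) / (2 ^ n * n.factorial) := by
  rw [radialDensity, div_pow, ← pow_mul]
  field_simp
  ring

theorem continuous_radialDensity (n : ℕ) : Continuous (radialDensity n) := by
  unfold radialDensity
  fun_prop

theorem radialDensity_nonneg (n : ℕ) {r : ℝ} (hr : 0 ≤ r) : 0 ≤ radialDensity n r := by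
  unfold radialDensity
  positivity

theorem radialDensity_eq_rpow (n : ℕ) {r : ℝ} : radialDensity n r
    = r ^ ((2 * n + 1 : ℕ) : ℝ) * Real.exp (-(1 / 2) * r ^ (2 : ℝ)) / (2 ^ n * n.factorial) := by
  rw [radialDensity_eq, Real.rpow_natCast, Real.rpow_two]
  congr 3
  ring

theorem integrableOn_radialDensity (n : ℕ) : IntegrableOn (radialDensity n) (Set.Ioi 0) := by
  have h := (integrableOn_rpow_mul_exp_neg_mul_rpow (p := 2) (s := ((2 * n + 1 : ℕ) : ℝ))
    (b := 1 / 2) (by have : (0 : ℝ) ≤ ((2 * n + 1 : ℕ) : ℝ) := Nat.cast_nonneg _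
                     linarith) (by norm_num) (by norm_num)).div_const (2 ^ n * n.factorial : ℝ)
  exact IntegrableOn.congr_fun h (fun r _ => (radialDensity_eq_rpow n).symm) measurableSet_Ioi

theorem integral_radialDensity (n : ℕ) : ∫ r in Set.Ioi 0, radialDensity n r = 1 := by
  simp only [radialDensity_eq_rpow]
  rw [integral_div, integral_rpow_mul_exp_neg_mul_rpow (by norm_num)
    (by have : (0 : ℝ) ≤ ((2 * n + 1 : ℕ) : ℝ) := Nat.cast_nonneg _
        linarith) (by norm_num)]
  have h1 : (((2 * n + 1 : ℕ) : ℝ) + 1) / 2 = n + 1 := by push_cast; ring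
  have h2 : -((((2 * n + 1 : ℕ) : ℝ) + 1) / 2) = -((n + 1 : ℕ) : ℝ) := by push_cast; ring
  rw [neg_div, h2, h1, Real.Gamma_nat_eq_factorial, Real.rpow_neg (by norm_num), Real.rpow_natCast]
  field_simp
  rw [pow_succ]
  ring_nf
  rw [← mul_pow]
  norm_num

theorem two_mul_le_log_sub_log {y : ℝ} (hy0 : 0 ≤ y) (hy1 : y < 1) :
    2 * y ≤ Real.log (1 + y) - Real.log (1 - y) := by
  have h := Real.hasSum_log_sub_log_of_abs_lt_one (x := y) (by rwa [abs_of_nonneg hy0])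
  have := le_hasSum h 0 fun k _ => by positivity
  simpa using this

theorem pow_eq_exp_mul_log {r : ℝ} (hr : 0 < r) (k : ℕ) : r ^ k = Real.exp (k * Real.log r) := by
  rw [Real.exp_nat_mul, Real.exp_log hr]

/-- The density `r^{2n+1} e^{-r²/2}` has its mode at `M`. With `y = x/M` the claim reduces to
`log(1+y) - log(1-y) ≥ 2y`. -/
theorem radialDensity_reflect {n : ℕ} {M x : ℝ} (hM0 : 0 < M) (hM : M ^ 2 = 2 * n + 1) (hx0 : 0 ≤ x)
    (hx : x ≤ M) : radialDensity n (M - x) ≤ radialDensity n (M + x) := by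
  -- At `x = M` the logarithm is not usable, but the density vanishes at `0`.
  rcases hx.eq_or_lt with rfl | hx
  · rw [sub_self, radialDensity, zero_mul]
    exact radialDensity_nonneg n (by positivity)
  rw [radialDensity_eq, radialDensity_eq]
  refine div_le_div_of_nonneg_right ?_ (by positivity)
  have hy0 : 0 ≤ x / M := by positivity
  have hy1 : x / M < 1 := (div_lt_one hM0).2 hx
  have h1 := two_mul_le_log_sub_log hy0 hy1
  have e1 : M - x = M * (1 - x / M) := by field_simp
  have e2 : M + x = M * (1 + x / M) := by field_simp
  have p1 : 0 < M - x := by linarith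
  have p2 : 0 < M + x := by linarith
  have h2 : 2 * (x / M) ≤ Real.log (M + x) - Real.log (M - x) := by
    rw [e1, e2, Real.log_mul hM0.ne' (by linarith), Real.log_mul hM0.ne' (by linarith)]
    linarith
  rw [pow_eq_exp_mul_log p1, pow_eq_exp_mul_log p2, ← Real.exp_add, ← Real.exp_add, Real.exp_le_exp]
  push_cast
  rw [← hM]
  have h3 : M ^ 2 * (2 * (x / M)) ≤ M ^ 2 * (Real.log (M + x) - Real.log (M - x)) :=
    mul_le_mul_of_nonneg_left h2 (by positivity)
  have h4 : M ^ 2 * (2 * (x / M)) = 2 * M * x := by field_simp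
  nlinarith

/-- By reflection at the mode, `(M, 2M)` carries at least as much mass as `(0, M)`, and the total is
`1`. -/
theorem half_le_integral_radialDensity {n : ℕ} {M : ℝ} (hM0 : 0 < M) (hM : M ^ 2 = 2 * n + 1) :
    1 / 2 ≤ ∫ r in Set.Ioi M, radialDensity n r := by
  have hint := integrableOn_radialDensity n
  have h1 : (∫ r in (0 : ℝ)..M, radialDensity n r) + ∫ r in Set.Ioi M, radialDensity n r = 1 := by
    rw [← integral_radialDensity n]
    exact intervalIntegral.integral_interval_add_Ioi hint (hint.mono_set (Set.Ioi_subset_Ioi hM0.le))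
  have h2 : (∫ r in M..(2 * M), radialDensity n r) ≤ ∫ r in Set.Ioi M, radialDensity n r := by
    rw [intervalIntegral.integral_of_le (by linarith)]
    refine setIntegral_mono_set (hint.mono_set (Set.Ioi_subset_Ioi hM0.le)) ?_
      Set.Ioc_subset_Ioi_self.eventuallyLE
    filter_upwards [ae_restrict_mem measurableSet_Ioi] with r hr
    exact radialDensity_nonneg n (hM0.trans hr).le
  have h3 : (∫ r in (0 : ℝ)..M, radialDensity n r) ≤ ∫ r in M..(2 * M), radialDensity n r := by
    have e1 := intervalIntegral.integral_comp_sub_left (a := 0) (b := M) (radialDensity n) M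
    have e2 := intervalIntegral.integral_comp_add_left (a := 0) (b := M) (radialDensity n) M
    rw [sub_self, sub_zero] at e1
    rw [add_zero, ← two_mul] at e2
    rw [← e1, ← e2]
    refine intervalIntegral.integral_mono_on hM0.le
      (((continuous_radialDensity n).comp (by fun_prop)).intervalIntegrable _ _)
      (((continuous_radialDensity n).comp (by fun_prop)).intervalIntegrable _ _) fun x hx => ?_
    exact radialDensity_reflect hM0 hM hx.1 hx.2
  linarith

/-- The Stirling sequence decreases to `√π`, so its fourth term controls all `n ≥ 4`; `0.5525` is
slightly below the limit `1/√π ≈ 0.564` of the density at the mode. -/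
theorem stirlingSeq_four_le : Stirling.stirlingSeq 4 ≤ 1 / 0.5525 := by
  have h8 : √(2 * ((4 : ℕ) : ℝ)) = 2 * √2 := by
    rw [show (2 * ((4 : ℕ) : ℝ)) = 2 ^ 2 * 2 by norm_num, Real.sqrt_mul (by norm_num),
      Real.sqrt_sq (by norm_num)]
  have h2 : 1.41421 ≤ √2 := Real.le_sqrt_of_sq_le (by norm_num)
  have he := Real.exp_one_lt_d9
  rw [Stirling.stirlingSeq, h8, div_pow, div_le_div_iff₀ (by positivity) (by norm_num)]
  have h4 : Real.exp 1 ^ 4 ≤ 2.7182818286 ^ 4 := pow_le_pow_left₀ (Real.exp_pos _).le he.le 4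
  have hf : ((Nat.factorial 4 : ℕ) : ℝ) = 24 := by norm_num [Nat.factorial]
  rw [hf, one_mul, mul_div_assoc', le_div_iff₀ (by positivity)]
  calc 24 * 0.5525 * Real.exp 1 ^ 4 ≤ 24 * 0.5525 * 2.7182818286 ^ 4 := by gcongr
    _ ≤ 2 * 1.41421 * ((4 : ℕ) : ℝ) ^ 4 := by norm_num
    _ ≤ _ := by gcongr

theorem factorial_le_stirling {n : ℕ} (hn : 4 ≤ n) :
    0.5525 * (n.factorial : ℝ) ≤ √(2 * n) * (n / Real.exp 1) ^ n := by
  have h : Stirling.stirlingSeq n ≤ Stirling.stirlingSeq 4 := by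
    have := Stirling.stirlingSeq'_antitone (show 3 ≤ n - 1 by omega)
    simp only [Function.comp_apply] at this
    rwa [show (n - 1).succ = n by omega] at this
  have h2 := h.trans stirlingSeq_four_le
  have hn0 : (0 : ℝ) < n := by exact_mod_cast (show 0 < n by omega)
  rw [Stirling.stirlingSeq, div_le_div_iff₀ (by positivity) (by norm_num)] at h2
  linarith

/-- The radial density at its mode. -/
theorem le_radialDensity_mode {n : ℕ} (hn : 4 ≤ n) {M : ℝ} (hM0 : 0 < M) (hM : M ^ 2 = 2 * n + 1) :
    0.5525 ≤ radialDensity n M := by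
  have hn0 : (0 : ℝ) < n := by exact_mod_cast (show 0 < n by omega)
  rw [radialDensity_eq, le_div_iff₀ (by positivity)]
  have h1 := factorial_le_stirling hn
  calc 0.5525 * (2 ^ n * (n.factorial : ℝ)) = 2 ^ n * (0.5525 * (n.factorial : ℝ)) := by ring
    _ ≤ 2 ^ n * (√(2 * n) * (n / Real.exp 1) ^ n) := by gcongr
    _ ≤ _ := ?_
  -- The factor `e^{-1/2}` lost in `e^{-M²/2} = e^{-n-1/2}` is regained from `M^{2n+1} =
  -- (2n)^{n+1/2} (1 + 1/(2n))^{n+1/2}`.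
  have hlog : 1 / 2 ≤ (n + 1 / 2 : ℝ) * Real.log (1 + 1 / (2 * n)) := by
    have := Real.one_sub_inv_le_log_of_pos (x := 1 + 1 / (2 * (n : ℝ))) (by positivity)
    have h2 : 1 - (1 + 1 / (2 * (n : ℝ)))⁻¹ = (1 / 2) / (n + 1 / 2) := by
      field_simp
      ring
    rw [h2, div_le_iff₀ (by positivity)] at this
    linarith
  have hMlog : Real.log M = (Real.log (2 * n) + Real.log (1 + 1 / (2 * n))) / 2 := by
    have : Real.log (M ^ 2) = Real.log (2 * n) + Real.log (1 + 1 / (2 * n)) := by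
      rw [← Real.log_mul (by positivity) (by positivity), hM]
      congr 1
      field_simp
    rw [Real.log_pow] at this
    push_cast at this
    linarith
  have hl : 2 ^ n * (√(2 * n) * (n / Real.exp 1) ^ n)
      = Real.exp ((n + 1 / 2) * Real.log (2 * n) - n) := by
    have h2n : (0 : ℝ) < 2 * n := by positivity
    rw [Real.sqrt_eq_rpow, Real.rpow_def_of_pos h2n]
    have : (2 : ℝ) ^ n * (Real.exp (Real.log (2 * n) * (1 / 2)) * (n / Real.exp 1) ^ n)
        = Real.exp (Real.log (2 * n) * (1 / 2)) * (2 * n / Real.exp 1) ^ n := by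
      rw [div_pow, div_pow, mul_pow]
      ring
    rw [this, ← Real.exp_log h2n, ← Real.exp_sub, ← Real.exp_nat_mul, ← Real.exp_add, Real.exp_log h2n]
    congr 1
    ring
  rw [hl, pow_eq_exp_mul_log hM0, ← Real.exp_add, Real.exp_le_exp, hMlog, hM]
  push_cast
  linarith

/-- Around the mode, `log` of the density ratio is `-x² - x³/(3M) - …`. For `M ≥ 7` and `x ≤ 0.66`
the terms after `-x²` cost less than `0.045 x²`. -/
theorem le_radialDensity_sub {n : ℕ} {M x : ℝ} (hM7 : 7 ≤ M) (hM : M ^ 2 = 2 * n + 1)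
    (hx0 : 0 ≤ x) (hx : x ≤ 0.66) :
    0.5525 * (1 - 1.045 * x ^ 2) ≤ radialDensity n (M - x) := by
  have hM0 : 0 < M := by linarith
  have hn : 4 ≤ n := by
    have : (4 : ℝ) ≤ n := by nlinarith
    exact_mod_cast this
  have hy0 : 0 ≤ x / M := by positivity
  have hy1 : x / M ≤ 0.66 / 7 := by gcongr
  have p1 : 0 < M - x := by linarith
  have h1 := (abs_le.1 (Real.abs_log_sub_add_sum_range_le (x := x / M)
    (by rw [abs_of_nonneg hy0]; linarith) 3)).1
  rw [abs_of_nonneg hy0] at h1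
  simp only [Finset.sum_range_succ, Finset.sum_range_zero] at h1
  norm_num at h1
  have hlog : Real.log (M - x) = Real.log M + Real.log (1 - x / M) := by
    rw [← Real.log_mul hM0.ne' (by linarith)]
    congr 1
    field_simp
  have h2 : -(1.045 * x ^ 2) ≤ M ^ 2 * Real.log (1 - x / M) + M * x - x ^ 2 / 2 := by
    have hq : (x / M) ^ 4 / (1 - x / M) ≤ (x / M) ^ 2 * 0.0099 := by
      rw [div_le_iff₀ (by linarith)]
      have h5 : (x / M) ^ 2 ≤ (0.66 / 7) ^ 2 := pow_le_pow_left₀ hy0 hy1 2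
      have h6 : (0.66 / 7 : ℝ) ^ 2 ≤ 0.0099 * (1 - x / M) := by linarith
      nlinarith [mul_le_mul_of_nonneg_left (h5.trans h6) (sq_nonneg (x / M))]
    have hc : (x / M) ^ 3 / 3 ≤ (x / M) ^ 2 * 0.0315 := by
      nlinarith [mul_le_mul_of_nonneg_left hy1 (sq_nonneg (x / M))]
    have h3 : -(x / M) - (x / M) ^ 2 / 2 - (x / M) ^ 2 * 0.0414 ≤ Real.log (1 - x / M) := by
      linarith
    have h4 := mul_le_mul_of_nonneg_left h3 (sq_nonneg M)
    have e1 : M ^ 2 * (-(x / M) - (x / M) ^ 2 / 2 - (x / M) ^ 2 * 0.0414)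
        = -(M * x) - x ^ 2 / 2 - x ^ 2 * 0.0414 := by
      field_simp
    rw [e1] at h4
    nlinarith [sq_nonneg x]
  have h3 : radialDensity n (M - x)
      = radialDensity n M * Real.exp (M ^ 2 * Real.log (1 - x / M) + M * x - x ^ 2 / 2) := by
    rw [radialDensity_eq, radialDensity_eq, div_mul_eq_mul_div]
    congr 1
    rw [pow_eq_exp_mul_log p1, pow_eq_exp_mul_log hM0, ← Real.exp_add, ← Real.exp_add,
      ← Real.exp_add]
    congr 1
    push_cast
    rw [← hM, hlog]
    ring
  rw [h3]
  have h4 : 1 - 1.045 * x ^ 2 ≤ Real.exp (M ^ 2 * Real.log (1 - x / M) + M * x - x ^ 2 / 2) := by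
    have := Real.add_one_le_exp (-(1.045 * x ^ 2))
    have := Real.exp_le_exp.2 h2
    linarith
  have h5 : 0 ≤ 1 - 1.045 * x ^ 2 := by nlinarith
  exact mul_le_mul (le_radialDensity_mode hn hM0 hM) h4 h5
    (radialDensity_nonneg n hM0.le)

/-- Half of the mass lies beyond the mode `M`; the rest of the bound is the integral of
`le_radialDensity_sub` over `[M - A, M]`, with `1.045/3` rounded up to `0.35`. -/
theorem ofReal_le_radialWeight {n : ℕ} {b M A : ℝ} (hM7 : 7 ≤ M) (hM : M ^ 2 = 2 * n + 1)
    (hA0 : 0 ≤ A) (hA : A ≤ 0.66) (hb : √2 * b ≤ M - A) :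
    ENNReal.ofReal (1 / 2 + 0.5525 * (A - 0.35 * A ^ 3)) ≤ radialWeight b n := by
  have hM0 : 0 < M := by linarith
  have hint := integrableOn_radialDensity n
  have hMA : Set.Ioi (M - A) ⊆ Set.Ioi (0 : ℝ) := Set.Ioi_subset_Ioi (by linarith)
  have h1 : radialWeight b n = ∫⁻ r in Set.Ioi (√2 * b), ENNReal.ofReal (radialDensity n r) := rfl
  rw [h1]
  refine le_trans ?_ (lintegral_mono_set (Set.Ioi_subset_Ioi hb))
  rw [← ofReal_integral_eq_lintegral_ofReal (hint.mono_set hMA)]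
  · refine ENNReal.ofReal_le_ofReal ?_
    rw [← intervalIntegral.integral_interval_add_Ioi (hint.mono_set hMA)
      (hint.mono_set (Set.Ioi_subset_Ioi hM0.le))]
    have h2 := half_le_integral_radialDensity hM0 hM
    have h3 : 0.5525 * (A - 0.35 * A ^ 3) ≤ ∫ r in (M - A)..M, radialDensity n r := by
      have e1 := intervalIntegral.integral_comp_sub_left (a := 0) (b := A) (radialDensity n) M
      rw [sub_zero] at e1
      rw [← e1]
      have h4 : ∫ x in (0 : ℝ)..A, 0.5525 * (1 - 1.045 * x ^ 2)
          = 0.5525 * (A - 1.045 / 3 * A ^ 3) := by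
        rw [intervalIntegral.integral_const_mul, intervalIntegral.integral_sub
          (by simp) (Continuous.intervalIntegrable (by fun_prop) _ _),
          intervalIntegral.integral_const_mul, integral_pow]
        norm_num
        ring
      have h5 : 0.5525 * (A - 0.35 * A ^ 3) ≤ 0.5525 * (A - 1.045 / 3 * A ^ 3) := by
        have : 0 ≤ A ^ 3 := by positivity
        linarith
      refine h5.trans (h4.symm.le.trans ?_)
      refine intervalIntegral.integral_mono_on hA0
        (Continuous.intervalIntegrable (by fun_prop) _ _)
        (((continuous_radialDensity n).comp (by fun_prop)).intervalIntegrable _ _) fun x hx => ?_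
      exact le_radialDensity_sub hM7 hM hx.1 (hx.2.trans hA)
    linarith
  · filter_upwards [ae_restrict_mem measurableSet_Ioi] with r hr
    exact radialDensity_nonneg n (hMA hr).le

/-! ### Gaussian tails -/

/-- The bound `e^{-y²} (y² + 1) / (√π y (2y² + 3))` for the upper Gaussian tail at `y`. -/
def millsBound (y : ℝ) : ℝ := Real.exp (-y ^ 2) * ((y ^ 2 + 1) / (y * (2 * y ^ 2 + 3))) / √Real.pi

/-- The upper tail at `y` of the centred Gaussian of variance `1/2`. -/
def upperTail (y : ℝ) : ENNReal := ∫⁻ u in Set.Ici y, ENNReal.ofReal (Real.exp (-u ^ 2) / √Real.pi)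

theorem upperTail_anti {y z : ℝ} (h : y ≤ z) : upperTail z ≤ upperTail y :=
  lintegral_mono_set (Set.Ici_subset_Ici.2 h)

/-- The derivative exceeds the Gaussian density by an explicit positive factor, so integrating it
bounds the tail (`upperTail_le`). -/
theorem hasDerivAt_millsBound {y : ℝ} (hy : 0 < y) :
    HasDerivAt (fun u => -millsBound u)
      (Real.exp (-y ^ 2) / √Real.pi * (1 + 3 / (y ^ 2 * (2 * y ^ 2 + 3) ^ 2))) y := by
  have h1 : HasDerivAt (fun u : ℝ => -u ^ 2) (-(2 * y)) y := by
    exact (hasDerivAt_pow 2 y).neg.congr_deriv (by norm_num)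
  have h2 : HasDerivAt (fun u : ℝ => u ^ 2 + 1) (2 * y) y := by
    simpa using (hasDerivAt_pow 2 y).add_const 1
  have h3 : HasDerivAt (fun u : ℝ => u * (2 * u ^ 2 + 3)) (6 * y ^ 2 + 3) y := by
    refine ((hasDerivAt_id y).mul (((hasDerivAt_pow 2 y).const_mul 2).add_const 3)).congr_deriv ?_
    simp
    ring
  have h4 := ((h1.exp.mul (h2.div h3 (by positivity))).div_const (√Real.pi)).neg
  refine h4.congr_deriv ?_
  have : 0 < √Real.pi := by positivity
  simp only [Pi.div_apply]
  field_simp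
  ring

theorem tendsto_millsBound : Filter.Tendsto (fun u => -millsBound u) Filter.atTop (nhds 0) := by
  have h1 : Filter.Tendsto (fun u : ℝ => Real.exp (-u) / √Real.pi) Filter.atTop (nhds 0) := by
    simpa using Real.tendsto_exp_neg_atTop_nhds_zero.div_const (√Real.pi)
  refine squeeze_zero_norm' ?_ h1
  filter_upwards [Filter.eventually_ge_atTop (1 : ℝ)] with u hu
  have h2 : 0 ≤ (u ^ 2 + 1) / (u * (2 * u ^ 2 + 3)) := by positivity
  have h3 : (u ^ 2 + 1) / (u * (2 * u ^ 2 + 3)) ≤ 1 := by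
    rw [div_le_one (by positivity)]
    nlinarith [sq_nonneg u]
  rw [norm_neg, millsBound, Real.norm_of_nonneg (by positivity)]
  refine div_le_div_of_nonneg_right ?_ (by positivity)
  have h4 : Real.exp (-u ^ 2) ≤ Real.exp (-u) := Real.exp_le_exp.2 (by nlinarith)
  calc _ ≤ Real.exp (-u) * 1 := mul_le_mul h4 h3 h2 (Real.exp_pos _).le
    _ = _ := mul_one _

theorem upperTail_le {y : ℝ} (hy : 0 < y) : upperTail y ≤ ENNReal.ofReal (millsBound y) := by
  set g : ℝ → ℝ := fun u =>
    Real.exp (-u ^ 2) / √Real.pi * (1 + 3 / (u ^ 2 * (2 * u ^ 2 + 3) ^ 2)) with hg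
  have hd : ∀ u ∈ Set.Ici y, HasDerivAt (fun u => -millsBound u) (g u) u := fun u hu =>
    hasDerivAt_millsBound (hy.trans_le hu)
  have hpos : ∀ u, 0 ≤ g u := fun u => by positivity
  have hint : IntegrableOn g (Set.Ioi y) :=
    integrableOn_Ioi_deriv_of_nonneg' hd (fun u _ => hpos u) tendsto_millsBound
  have hval : ∫ u in Set.Ioi y, g u = 0 - -millsBound y :=
    integral_Ioi_of_hasDerivAt_of_nonneg' hd (fun u _ => hpos u) tendsto_millsBound
  rw [zero_sub, neg_neg] at hval
  rw [← hval, ofReal_integral_eq_lintegral_ofReal hint (.of_forall hpos), upperTail,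
    setLIntegral_congr Ioi_ae_eq_Ici.symm]
  refine lintegral_mono fun u => ENNReal.ofReal_le_ofReal ?_
  rw [hg]
  refine le_mul_of_one_le_right (by positivity) ?_
  have : 0 ≤ 3 / (u ^ 2 * (2 * u ^ 2 + 3) ^ 2) := by positivity
  linarith

theorem gaussTail_le_add (b x : ℝ) (hb : 0 ≤ b) :
    gaussTail b x ≤ upperTail (b - x) + upperTail (b + x) := by
  have hsub : {q : ℝ | b ^ 2 ≤ q ^ 2} ⊆ Set.Ici b ∪ Set.Iic (-b) := by
    intro q hq
    rw [Set.mem_ofPred_eq] at hq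
    have hq : b ≤ |q| := by
      have := sq_le_sq.1 hq
      rwa [abs_of_nonneg hb] at this
    rcases le_abs.1 hq with h | h
    · exact Or.inl h
    · exact Or.inr (by simp only [Set.mem_Iic]; linarith)
  refine (lintegral_mono_set hsub).trans ((lintegral_union_le _ _ _).trans
    (add_le_add (le_of_eq ?_) (le_of_eq ?_)))
  · rw [upperTail, ← lintegral_indicator measurableSet_Ici, ← lintegral_indicator measurableSet_Ici,
      ← lintegral_sub_right_eq_self _ (-x)]
    refine lintegral_congr fun q => ?_
    simp only [Set.indicator_apply, Set.mem_Ici]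
    simp only [show b ≤ q - -x ↔ b - x ≤ q by constructor <;> intro <;> linarith,
      show -(x - (q - -x)) ^ 2 = -q ^ 2 by ring]
  · rw [upperTail, ← lintegral_indicator measurableSet_Iic, ← lintegral_indicator measurableSet_Ici,
      ← lintegral_sub_left_eq_self _ x]
    refine lintegral_congr fun q => ?_
    simp only [Set.indicator_apply, Set.mem_Ici, Set.mem_Iic]
    simp only [show x - q ≤ -b ↔ b + x ≤ q by constructor <;> intro <;> linarith,
      show -(x - (x - q)) ^ 2 = -q ^ 2 by ring]

/-- From `|x| ≤ x₀` the nearer of the points `±(x₀ + y)` is at distance at least `y` and the farther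
one at distance at least `x₀ + y`. -/
theorem gaussTail_le {x₀ y x : ℝ} (hx₀ : 0 ≤ x₀) (hy : 0 < y) (hx : x ^ 2 ≤ x₀ ^ 2) :
    gaussTail (x₀ + y) x ≤ ENNReal.ofReal (millsBound y + millsBound (x₀ + y)) := by
  have hb : 0 < x₀ + y := by linarith
  have hmb : ∀ {z : ℝ}, 0 < z → 0 ≤ millsBound z := fun {z} hz => by
    rw [millsBound]
    positivity
  have habs := abs_le_of_sq_le_sq' hx hx₀
  rw [ENNReal.ofReal_add (hmb hy) (hmb hb)]
  refine (gaussTail_le_add _ x hb.le).trans ?_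
  rcases le_total 0 x with h | h
  · exact add_le_add ((upperTail_anti (by linarith [habs.2])).trans (upperTail_le hy))
      ((upperTail_anti (by linarith)).trans (upperTail_le hb))
  · rw [add_comm]
    exact add_le_add ((upperTail_anti (by linarith [habs.1])).trans (upperTail_le hy))
      ((upperTail_anti (by linarith)).trans (upperTail_le hb))

/-! ### Numerical estimates -/

/-- A lower bound for the Husimi weight of high number states. -/
def weightBound (s : ℝ) : ℝ := 1 / 2 + 0.5525 * (0.9475 * s - 0.35 * (0.9475 * s) ^ 3)

/-- An upper bound for the leakage of the homodyne test, relative to the failure rate. -/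
def leakBound (s : ℝ) : ℝ := s * (0.472 - 0.035 * s)

/-- A lower bound for `(1 - e^{-s/4}) * weightBound s / 2`. -/
def gainBound (s : ℝ) : ℝ :=
  (s / 4 - (s / 4) ^ 2 / 2 + 0.157 * (s / 4) ^ 3) * (weightBound s / 2)

/-- An upper bound for `1 - e^{-s/4}`. -/
def rateBound (s : ℝ) : ℝ := s / 4 - (s / 4) ^ 2 / 2 + 0.177 * (s / 4) ^ 3

theorem one_sub_exp_neg_bounds {x : ℝ} (hx0 : 0 ≤ x) (hx : x ≤ 0.18) :
    x - x ^ 2 / 2 + 0.157 * x ^ 3 ≤ 1 - Real.exp (-x) ∧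
      1 - Real.exp (-x) ≤ x - x ^ 2 / 2 + 0.177 * x ^ 3 := by
  have h := abs_le.1 (Real.exp_bound (x := -x) (by rw [abs_neg, abs_of_nonneg hx0]; linarith)
    (n := 4) (by norm_num))
  rw [abs_neg, abs_of_nonneg hx0] at h
  simp only [Finset.sum_range_succ, Finset.sum_range_zero] at h
  norm_num [Nat.factorial] at h
  have h3 : 0 ≤ x ^ 3 := by positivity
  have h4 : x ^ 4 ≤ 0.18 * x ^ 3 := by
    have : x ^ 4 = x * x ^ 3 := by ring
    rw [this]
    exact mul_le_mul_of_nonneg_right hx h3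
  constructor
  · nlinarith [h.2]
  · nlinarith [h.1]

/-- Products of Bernstein type, from which the polynomial inequalities on `[0, 0.6935]` follow as
nonnegative combinations. The factor `s²` can be split off because the two sides agree to first
order. The endpoint is just above `1/√(3 ln 2)`, the largest `s` that occurs. -/
theorem bernstein_nonneg {s : ℝ} (hs0 : 0 ≤ s) (hs : s ≤ 0.6935) (i j : ℕ) :
    0 ≤ s ^ 2 * (s ^ i * (0.6935 - s) ^ j) :=
  mul_nonneg (sq_nonneg s) (mul_nonneg (pow_nonneg hs0 i) (pow_nonneg (by linarith) j))

theorem le_gainBound {s : ℝ} (hs0 : 0 ≤ s) (hs : s ≤ 0.6935) :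
    s * (0.0625 + 0.04 * s) ≤ gainBound s := by
  have h := bernstein_nonneg hs0 hs
  unfold gainBound weightBound
  linarith [h 0 4, h 1 3, h 2 2, h 3 1, h 4 0]

theorem leakage_le_gain_zero {s : ℝ} (hs0 : 0 ≤ s) (hs : s ≤ 0.6935) :
    s / 4 + rateBound s * leakBound s ≤ 4 * (gainBound s * (1 - 5 / 8 * gainBound s)) := by
  have h := bernstein_nonneg hs0 hs
  unfold rateBound leakBound gainBound weightBound
  linarith [h 0 10, h 1 9, h 2 8, h 3 7, h 4 6, h 5 5, h 6 4, h 7 3, h 8 2, h 9 1, h 10 0]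

/-- The case of maximal `r = 1.083 s⁴`. The term `s⁶(0.0254 + 0.016 s)` is a polynomial lower bound
for the correction `0.84 · r · leakBound s · gainBound s`. -/
theorem leakage_le_gain_max {s : ℝ} (hs0 : 0 ≤ s) (hs : s ≤ 0.6935) :
    s / 4 + rateBound s * leakBound s * (1 + 1.1 * (1.083 * s ^ 4 * leakBound s))
        + 0.1024 * (1.083 * s ^ 4)
      ≤ 4 * ((gainBound s + s ^ 6 * (0.0254 + 0.016 * s))
        * (1 - 5 / 8 * (gainBound s + s ^ 6 * (0.0254 + 0.016 * s)))) := by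
  have h := bernstein_nonneg hs0 hs
  unfold rateBound leakBound gainBound weightBound
  linarith [h 0 12, h 1 11, h 2 10, h 3 9, h 4 8, h 5 7, h 6 6, h 7 5, h 8 4, h 9 3, h 10 2, h 11 1,
    h 12 0]

theorem gainBound_le {s : ℝ} (hs0 : 0 ≤ s) (hs : s ≤ 0.6935) : gainBound s ≤ 0.2 := by
  have h1 : (s / 4) ^ 3 ≤ s / 4 * 1 := by
    rw [pow_succ']
    exact mul_le_mul_of_nonneg_left (by nlinarith) (by linarith)
  have h2 : weightBound s ≤ 1 := by
    unfold weightBound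
    have : 0 ≤ (0.9475 * s) ^ 3 := by positivity
    linarith
  have h3 : 0 ≤ weightBound s := by
    have h4 : (0.9475 * s) ^ 3 ≤ 0.9475 * s * 1 := by
      rw [pow_succ']
      exact mul_le_mul_of_nonneg_left (by nlinarith) (by linarith)
    unfold weightBound
    linarith
  have h5 : s / 4 - (s / 4) ^ 2 / 2 + 0.157 * (s / 4) ^ 3 ≤ 0.4 := by nlinarith
  unfold gainBound
  nlinarith

theorem leakBound_nonneg {s : ℝ} (hs0 : 0 ≤ s) (hs : s ≤ 0.6935) : 0 ≤ leakBound s :=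
  mul_nonneg hs0 (by linarith)

theorem leakBound_le (s : ℝ) : leakBound s ≤ 0.472 * s := by
  unfold leakBound
  nlinarith [sq_nonneg s]

/-- The parabola has its maximum at `0.8`. -/
theorem logistic_mono {x y : ℝ} (hxy : x ≤ y) (hy : x + y ≤ 1.6) :
    x * (1 - 5 / 8 * x) ≤ y * (1 - 5 / 8 * y) := by
  nlinarith [mul_nonneg (sub_nonneg.2 hxy) (sub_nonneg.2 hy)]

theorem leakage_le_gain {s r : ℝ} (hs0 : 0 ≤ s) (hs : s ≤ 0.6935) (hr0 : 0 ≤ r)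
    (hr : r ≤ 1.083 * s ^ 4) :
    s / 4 + rateBound s * leakBound s * (1 + 1.1 * (r * leakBound s)) + 0.1024 * r
      ≤ 4 * (gainBound s * (1 + 0.84 * (r * leakBound s))
        * (1 - 5 / 8 * (gainBound s * (1 + 0.84 * (r * leakBound s))))) := by
  have hg := le_gainBound hs0 hs
  have hg2 := gainBound_le hs0 hs
  have hE := leakBound_nonneg hs0 hs
  have hE1 := leakBound_le s
  have h0 := leakage_le_gain_zero hs0 hs
  have hg0 : 0 ≤ gainBound s := (by positivity : 0 ≤ s * (0.0625 + 0.04 * s)).trans hg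
  have h1 : s / 4 + rateBound s * leakBound s * (1 + 1.1 * (1.083 * s ^ 4 * leakBound s))
        + 0.1024 * (1.083 * s ^ 4)
      ≤ 4 * (gainBound s * (1 + 0.84 * (1.083 * s ^ 4 * leakBound s))
        * (1 - 5 / 8 * (gainBound s * (1 + 0.84 * (1.083 * s ^ 4 * leakBound s))))) := by
    refine (leakage_le_gain_max hs0 hs).trans (mul_le_mul_of_nonneg_left (logistic_mono ?_ ?_)
      (by norm_num))
    · have h2 : s * (0.0625 + 0.04 * s) * (0.84 * (1.083 * s ^ 4 * leakBound s))
          ≤ gainBound s * (0.84 * (1.083 * s ^ 4 * leakBound s)) :=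
        mul_le_mul_of_nonneg_right hg (by positivity)
      have h3 : s ^ 6 * (0.0254 + 0.016 * s)
          ≤ s * (0.0625 + 0.04 * s) * (0.84 * (1.083 * s ^ 4 * leakBound s)) := by
        have : s * (0.0625 + 0.04 * s) * (0.84 * (1.083 * s ^ 4 * leakBound s))
            = s ^ 6 * ((0.0625 + 0.04 * s) * (0.84 * 1.083 * (0.472 - 0.035 * s))) := by
          unfold leakBound
          ring
        rw [this]
        refine mul_le_mul_of_nonneg_left ?_ (by positivity)
        nlinarith
      linarith
    · have hs4 : s ^ 4 ≤ 0.6935 ^ 4 := pow_le_pow_left₀ hs0 hs 4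
      have hs6 : s ^ 6 ≤ 0.6935 ^ 6 := pow_le_pow_left₀ hs0 hs 6
      have h2 : s ^ 6 * (0.0254 + 0.016 * s) ≤ 0.6935 ^ 6 * (0.0254 + 0.016 * 0.6935) := by
        gcongr
      have h3 : 1.083 * s ^ 4 * leakBound s ≤ 1.083 * 0.6935 ^ 4 * (0.472 * 0.6935) :=
        mul_le_mul (by linarith) (by linarith) hE (by norm_num)
      have h4 : gainBound s * (1 + 0.84 * (1.083 * s ^ 4 * leakBound s))
          ≤ 0.2 * (1 + 0.84 * (1.083 * 0.6935 ^ 4 * (0.472 * 0.6935))) :=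
        mul_le_mul hg2 (by linarith) (by positivity) (by norm_num)
      norm_num at h2 h4 ⊢
      linarith
  -- both sides are compared at the ends of the range of `r`; the difference is concave in `r`
  rcases hr0.eq_or_lt with rfl | hr0
  · simpa using h0
  set ρ : ℝ := 1.083 * s ^ 4 with hρ
  have hρ0 : 0 < ρ := hr0.trans_le hr
  set g := gainBound s
  set E := leakBound s
  set c := rateBound s
  have hc : 0 ≤ (ρ - r) * r * (g * E) ^ 2 := by
    have := sub_nonneg.2 hr
    positivity
  have h2 := mul_nonneg (sub_nonneg.2 hr) (sub_nonneg.2 h0)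
  have h3 := mul_nonneg hr0.le (sub_nonneg.2 h1)
  rw [← sub_nonneg]
  refine nonneg_of_mul_nonneg_right (a := ρ) ?_ hρ0
  have h4 : 0 ≤ 2.5 * 0.84 ^ 2 * (ρ * ((ρ - r) * r * (g * E) ^ 2)) := by positivity
  linarith

theorem weightBound_bounds {s : ℝ} (hs0 : 0 ≤ s) (hs : s ≤ 0.6935) :
    1 / 2 ≤ weightBound s ∧ weightBound s ≤ 1 := by
  have h1 : (0.9475 * s) ^ 3 ≤ 0.9475 * s * 1 := by
    rw [pow_succ']
    exact mul_le_mul_of_nonneg_left (by nlinarith) (by linarith)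
  have h2 : 0 ≤ (0.9475 * s) ^ 3 := by positivity
  unfold weightBound
  constructor <;> linarith

theorem leak_le {s r : ℝ} (hs0 : 0 ≤ s) (hs : s ≤ 0.6935)
    (hr : r ≤ 1.083 * s ^ 4) : r * leakBound s ≤ 1 / 11 := by
  have hs4 : s ^ 4 ≤ 0.6935 ^ 4 := pow_le_pow_left₀ hs0 hs 4
  have hE := leakBound_nonneg hs0 hs
  have hE1 := leakBound_le s
  have h3 : r * leakBound s ≤ 1.083 * 0.6935 ^ 4 * (0.472 * 0.6935) :=
    mul_le_mul (by linarith) (by linarith) hE (by norm_num)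
  refine h3.trans ?_
  norm_num

/-- The exponent obtained with the parameter `s / 4`. -/
theorem exists_gain {s r : ℝ} (hs0 : 0 ≤ s) (hs : s ≤ 0.6935) (hr0 : 0 ≤ r)
    (hr : r ≤ 1.083 * s ^ 4) : ∃ κ, 0 ≤ κ ∧ κ ≤ 1 ∧
      κ ≤ (1 - Real.exp (-(s / 4))) * weightBound s
        / (2 * (1 - r * leakBound s * Real.exp (-(s / 4)))) ∧
      s / 4 + (1 - Real.exp (-(s / 4))) * leakBound s / (1 - r * leakBound s) + 0.1024 * r
        ≤ 4 * (κ * (1 - 5 / 8 * κ)) := by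
  have hE := leakBound_nonneg hs0 hs
  have he := leak_le hs0 hs hr
  have hg := le_gainBound hs0 hs
  have hg2 := gainBound_le hs0 hs
  have hmain := leakage_le_gain hs0 hs hr0 hr
  obtain ⟨hw1, hw2⟩ := weightBound_bounds hs0 hs
  obtain ⟨hk1, hk2⟩ := one_sub_exp_neg_bounds (x := s / 4) (by positivity) (by linarith)
  have hg0 : 0 ≤ gainBound s := (by positivity : 0 ≤ s * (0.0625 + 0.04 * s)).trans hg
  have he0 : 0 ≤ r * leakBound s := mul_nonneg hr0 hE
  set e := r * leakBound s with he_def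
  set q := Real.exp (-(s / 4)) with hq
  have hq1 : q ≤ 1 := Real.exp_le_one_iff.2 (by linarith)
  have hq0 : 0.84 ≤ q := by
    have h3 : (s / 4) ^ 3 ≤ (0.6935 / 4) ^ 3 := by gcongr
    have h4 : s / 4 - (s / 4) ^ 2 / 2 ≤ 0.6935 / 4 - (0.6935 / 4) ^ 2 / 2 := by nlinarith
    norm_num at h3 h4
    linarith
  -- The factor `1 + 0.84 e` is a lower bound for `1 / (1 - e q)`, as `q ≥ 0.84`.
  refine ⟨gainBound s * (1 + 0.84 * e), by positivity, ?_, ?_, ?_⟩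
  · nlinarith
  · have hden : 0 < 1 - e * q := by nlinarith
    rw [le_div_iff₀ (by linarith)]
    have h1 : 2 * gainBound s ≤ (1 - q) * weightBound s := by
      have := mul_le_mul_of_nonneg_right hk1 (by linarith : 0 ≤ weightBound s)
      unfold gainBound
      linarith
    have h2 : (1 + 0.84 * e) * (1 - e * q) ≤ 1 := by
      have : e * 0.84 ≤ e * q := mul_le_mul_of_nonneg_left hq0 he0
      nlinarith [sq_nonneg e]
    calc gainBound s * (1 + 0.84 * e) * (2 * (1 - e * q))
        = 2 * gainBound s * ((1 + 0.84 * e) * (1 - e * q)) := by ring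
      _ ≤ 2 * gainBound s * 1 := mul_le_mul_of_nonneg_left h2 (by positivity)
      _ ≤ _ := by linarith
  · refine le_trans ?_ hmain
    have h1 : (1 - q) * leakBound s / (1 - e) ≤ rateBound s * leakBound s * (1 + 1.1 * e) := by
      rw [div_le_iff₀ (by linarith)]
      -- This is where `e ≤ 1/11` is needed: the product is `1 + 0.1 e - 1.1 e²`.
      have h2 : 1 ≤ (1 + 1.1 * e) * (1 - e) := by nlinarith
      have h3 : (1 - q) * leakBound s ≤ rateBound s * leakBound s :=
        mul_le_mul_of_nonneg_right hk2 hE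
      have h4 : 0 ≤ (1 - q) * leakBound s := mul_nonneg (by linarith) hE
      have h5 : rateBound s * leakBound s * 1
          ≤ rateBound s * leakBound s * ((1 + 1.1 * e) * (1 - e)) :=
        mul_le_mul_of_nonneg_left h2 (h4.trans h3)
      linarith
    linarith

/-- The exponent obtained with the parameter `1 / 2`, for small failure rates. -/
theorem gain_half {s r : ℝ} (hs0 : 0 ≤ s) (hs : s ≤ 0.25) (hr0 : 0 ≤ r)
    (hr : r ≤ 1.083 * s ^ 4) :
    0.09 ≤ (1 - Real.exp (-(1 / 2))) * weightBound s
        / (2 * (1 - r * leakBound s * Real.exp (-(1 / 2)))) ∧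
      1 / 2 + (1 - Real.exp (-(1 / 2))) * leakBound s / (1 - r * leakBound s) + 0.0256 * r
        ≤ 8 * (0.09 * (1 - 5 / 8 * 0.09)) := by
  have hs' : s ≤ 0.6935 := by linarith
  have hE := leakBound_nonneg hs0 hs'
  have hE1 := leakBound_le s
  have he := leak_le hs0 hs' hr
  obtain ⟨hw1, hw2⟩ := weightBound_bounds hs0 hs'
  have he0 : 0 ≤ r * leakBound s := mul_nonneg hr0 hE
  set e := r * leakBound s with he_def
  set q := Real.exp (-(1 / 2)) with hq
  have hq0 : 0 < q := Real.exp_pos _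
  have hq1 : q ≤ 0.62 := by
    have h := Real.quadratic_le_exp_of_nonneg (x := 1 / 2) (by norm_num)
    rw [hq, Real.exp_neg, inv_le_comm₀ (Real.exp_pos _) (by norm_num)]
    norm_num at h ⊢
    linarith
  have hq2 : 1 / 2 ≤ q := by
    have := Real.add_one_le_exp (-(1 / 2 : ℝ))
    linarith
  constructor
  · rw [le_div_iff₀ (by nlinarith)]
    nlinarith
  · have hs4 : s ^ 4 ≤ 0.25 ^ 4 := pow_le_pow_left₀ hs0 hs 4
    have h1 : (1 - q) * leakBound s / (1 - e) ≤ 0.1 := by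
      rw [div_le_iff₀ (by linarith)]
      have : (1 - q) * leakBound s ≤ 1 / 2 * (0.472 * 0.25) :=
        mul_le_mul (by linarith) (by linarith) hE (by norm_num)
      linarith
    norm_num at hs4 ⊢
    linarith

/-- The inequality is checked at `t = 4r` (where `0.04 (0.6t - 4r)² = 0.1024 r²`) or at `t = 8r`
(where it is `0.0256 r²`) and then extended to larger `t`. The choice `λ = s/4` suffices for `t ≤
8r` or `s ≥ 0.25`; otherwise its slope `m` may be too small, and `λ = 1/2` takes over. -/
theorem exists_exponent {s r t : ℝ} (hs0 : 0 ≤ s) (hs : s ≤ 0.6935) (hr0 : 0 ≤ r)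
    (hr : r ≤ 1.083 * s ^ 4) (ht : 4 * r ≤ t) (ht1 : t ≤ 1) : ∃ lam κ, 0 ≤ lam ∧ 0 ≤ κ ∧ κ ≤ 1 ∧
      κ ≤ (1 - Real.exp (-lam)) * weightBound s
        / (2 * (1 - r * leakBound s * Real.exp (-lam))) ∧
      lam * r + (1 - Real.exp (-lam)) * (r * leakBound s) / (1 - r * leakBound s)
        - κ * (1 - 5 / 8 * κ) * t ≤ -(0.04 * (0.6 * t - 4 * r) ^ 2) := by
  have hE := leakBound_nonneg hs0 hs
  have he := leak_le hs0 hs hr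
  have hdiv : ∀ q : ℝ, (1 - q) * (r * leakBound s) / (1 - r * leakBound s)
      = r * ((1 - q) * leakBound s / (1 - r * leakBound s)) := fun q => by ring
  by_cases hc : t ≤ 8 * r ∨ 0.25 ≤ s
  · obtain ⟨κ, h0, h1, h2, h3⟩ := exists_gain hs0 hs hr0 hr
    refine ⟨s / 4, κ, by positivity, h0, h1, h2, ?_⟩
    rw [hdiv]
    set m := κ * (1 - 5 / 8 * κ) with hm
    set X := (1 - Real.exp (-(s / 4))) * leakBound s / (1 - r * leakBound s) with hX
    have hX0 : 0 ≤ X := div_nonneg (mul_nonneg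
      (sub_nonneg.2 (Real.exp_le_one_iff.2 (by linarith))) hE) (by linarith)
    have h4 := mul_le_mul_of_nonneg_left h3 hr0
    -- The growth of `0.04 (0.6t - 4r)²` from its value at `t = 4r` is `(t - 4r)(0.0144 t - 0.1344
    -- r)`; here `m` is shown to dominate the second factor.
    have h5 : 0 ≤ m - 0.0144 * t + 0.1344 * r := by
      rcases hc with hc | hc
      · linarith
      · linarith
    nlinarith [mul_nonneg (sub_nonneg.2 ht) h5]
  · push Not at hc
    obtain ⟨hc1, hc2⟩ := hc
    obtain ⟨h2, h3⟩ := gain_half hs0 hc2.le hr0 hr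
    refine ⟨1 / 2, 0.09, by norm_num, by norm_num, by norm_num, h2, ?_⟩
    rw [hdiv]
    set X := (1 - Real.exp (-(1 / 2))) * leakBound s / (1 - r * leakBound s) with hX
    have h4 := mul_le_mul_of_nonneg_left h3 hr0
    have h5 : 0 ≤ 0.09 * (1 - 5 / 8 * 0.09) - 0.0144 * t + 0.0768 * r := by
      norm_num
      linarith
    nlinarith [mul_nonneg (sub_nonneg.2 hc1.le) h5]

/-- The parameter of the Chernoff bound for the test registers. -/
theorem chernoff_parameter {κ k m u : ℝ} (hκ0 : 0 ≤ κ) (hκ1 : κ ≤ 1) (hκ : κ ≤ k)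
    (hm : m = κ * (1 - 5 / 8 * κ)) (hu0 : 0 ≤ u) (hu : u ≤ 1 / 2) :
    m * (1 + u) ≤ 1 - (1 - k) * Real.exp (-(m * u)) := by
  have hm0 : 0 ≤ m := by
    rw [hm]
    exact mul_nonneg hκ0 (by linarith)
  have hmκ : m ≤ κ := by
    rw [hm]
    nlinarith [sq_nonneg κ]
  set v := m * u with hv
  have hv0 : 0 ≤ v := mul_nonneg hm0 hu0
  have hv1 : v ≤ κ / 2 := by nlinarith
  have h1 : Real.exp (-v) ≤ 1 - v + v ^ 2 / 2 := by
    have h := Real.quadratic_le_exp_of_nonneg hv0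
    have hpos : 0 < 1 - v + v ^ 2 / 2 := by nlinarith [sq_nonneg (v - 1)]
    rw [Real.exp_neg, inv_le_comm₀ (Real.exp_pos _) hpos]
    refine le_trans ?_ h
    rw [inv_le_iff_one_le_mul₀ hpos]
    nlinarith [sq_nonneg (v ^ 2)]
  have h2 : (1 - k) * Real.exp (-v) ≤ (1 - κ) * (1 - v + v ^ 2 / 2) :=
    (mul_le_mul_of_nonneg_right (by linarith) (Real.exp_pos _).le).trans
      (mul_le_mul_of_nonneg_left h1 (by linarith))
  -- Origin of `5/8`: with `v ≤ κ/2` the losses are `κv ≤ κ²/2` and `v²/2 ≤ κ²/8`.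
  have h3 : κ * v ≤ κ * (κ / 2) := mul_le_mul_of_nonneg_left hv1 hκ0
  have h4 : v ^ 2 ≤ (κ / 2) ^ 2 := pow_le_pow_left₀ hv0 hv1 2
  have h5 : 0 ≤ κ * v ^ 2 := by positivity
  have h6 : m * (1 + u) = m + v := by rw [hv]; ring
  rw [h6]
  nlinarith

theorem exp_six_fifths_le : Real.exp 1.2 ≤ 3.3202 := by
  refine le_of_lt (lt_of_pow_lt_pow_left₀ 5 (by norm_num) ?_)
  rw [← Real.exp_nat_mul, show ((5 : ℕ) : ℝ) * 1.2 = ((6 : ℕ) : ℝ) * 1 by norm_num,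
    Real.exp_nat_mul]
  calc Real.exp 1 ^ 6 < 2.7182818286 ^ 6 :=
        pow_lt_pow_left₀ Real.exp_one_lt_d9 (Real.exp_pos _).le (by norm_num)
    _ < _ := by norm_num

theorem sqrt_pi_ge : 1.7724 ≤ √Real.pi :=
  Real.le_sqrt_of_sq_le (by linarith [Real.pi_gt_d6])

theorem millsBound_le_of_le {y b : ℝ} (hy : 0 < y) (hyb : y ≤ b) (h : y ^ 2 + 12 ≤ b ^ 2) :
    millsBound b ≤ 0.0004 * millsBound y := by
  have hb : 0 < b := hy.trans_le hyb
  have h1 : Real.exp (-b ^ 2) ≤ 0.00025 * Real.exp (-y ^ 2) := by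
    have h2 : Real.exp (-b ^ 2) ≤ Real.exp (-y ^ 2 + (12 : ℕ) * (-1)) :=
      Real.exp_le_exp.2 (by push_cast; linarith)
    rw [Real.exp_add, Real.exp_nat_mul] at h2
    have h3 : Real.exp (-1) ≤ 1 / 2 := by
      rw [Real.exp_neg, inv_le_comm₀ (Real.exp_pos _) (by norm_num)]
      have := Real.add_one_le_exp (1 : ℝ)
      norm_num at this ⊢
      linarith
    have h4 : Real.exp (-1) ^ 12 ≤ (1 / 2) ^ 12 := pow_le_pow_left₀ (Real.exp_pos _).le h3 12
    have h5 : Real.exp (-1) ^ 12 ≤ 0.00025 := h4.trans (by norm_num)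
    calc _ ≤ _ := h2
      _ ≤ Real.exp (-y ^ 2) * 0.00025 := mul_le_mul_of_nonneg_left h5 (Real.exp_pos _).le
      _ = _ := mul_comm _ _
  have h6 : (b ^ 2 + 1) / (b * (2 * b ^ 2 + 3)) ≤ 1.5 * ((y ^ 2 + 1) / (y * (2 * y ^ 2 + 3))) := by
    have h7 : (b ^ 2 + 1) / (b * (2 * b ^ 2 + 3)) ≤ 1 / (2 * b) := by
      rw [div_le_div_iff₀ (by positivity) (by positivity)]
      nlinarith
    have h8 : 1 / (2 * b) ≤ 1 / (2 * y) := by gcongr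
    have h9 : 1 / (2 * y) ≤ 1.5 * ((y ^ 2 + 1) / (y * (2 * y ^ 2 + 3))) := by
      rw [mul_div_assoc', div_le_div_iff₀ (by positivity) (by positivity)]
      nlinarith [pow_pos hy 3]
    linarith
  unfold millsBound
  rw [← mul_div_assoc 0.0004]
  refine div_le_div_of_nonneg_right ?_ (Real.sqrt_nonneg _)
  have h10 : 0 ≤ (y ^ 2 + 1) / (y * (2 * y ^ 2 + 3)) := by positivity
  have h11 : 0 ≤ (b ^ 2 + 1) / (b * (2 * b ^ 2 + 3)) := by positivity
  calc Real.exp (-b ^ 2) * ((b ^ 2 + 1) / (b * (2 * b ^ 2 + 3)))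
      ≤ 0.00025 * Real.exp (-y ^ 2) * (1.5 * ((y ^ 2 + 1) / (y * (2 * y ^ 2 + 3)))) :=
        mul_le_mul h1 h6 h11 (by positivity)
    _ = 0.000375 * (Real.exp (-y ^ 2) * ((y ^ 2 + 1) / (y * (2 * y ^ 2 + 3)))) := by ring
    _ ≤ _ := mul_le_mul_of_nonneg_right (by norm_num) (by positivity)

theorem leakage_ratio {s : ℝ} (hs0 : 0 ≤ s) (hs : s ≤ 0.6935) :
    0.9371 * ((1 - 0.6 * s ^ 2) ^ 2 + s ^ 2)
      ≤ (0.472 - 0.035 * s) * (1 + 0.36 * s ^ 2 + 0.0648 * s ^ 4) * ((1 - 0.6 * s ^ 2)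
        * (2 * (1 - 0.6 * s ^ 2) ^ 2 + 3 * s ^ 2)) := by
  have h : ∀ i j : ℕ, 0 ≤ s ^ i * (0.6935 - s) ^ j := fun i j =>
    mul_nonneg (pow_nonneg hs0 i) (pow_nonneg (by linarith) j)
  linarith [h 0 11, h 1 10, h 2 9, h 3 8, h 4 7, h 5 6, h 6 5, h 7 4, h 8 3, h 9 2, h 10 1, h 11 0]

/-- Since `(1/s - 0.6s)² = 1/s² - 1.2 + 0.36 s²`, the tail is `exp(-1/s²)` times `e^{1.2}` and a
rational function of `s`; the leading coefficient `e^{1.2}/(4√π) ≈ 0.468` explains `0.472`. The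
factor `1.0004` leaves room for the far tail in `leak_total`. -/
theorem millsBound_le_leak {s : ℝ} (hs0 : 0 < s) (hs : s ≤ 0.6935) :
    1.0004 * millsBound (1 / s - 0.6 * s) ≤ 2 * Real.exp (-(1 / s) ^ 2) * leakBound s := by
  have hz : 0 < 1 - 0.6 * s ^ 2 := by nlinarith
  have hratio := leakage_ratio hs0.le hs
  set z := 1 - 0.6 * s ^ 2 with hzdef
  have hy : 1 / s - 0.6 * s = z / s := by
    rw [hzdef]
    field_simp
  have hexp : Real.exp (-(z / s) ^ 2)
      = Real.exp (-(1 / s) ^ 2) * (Real.exp 1.2 * (Real.exp (0.36 * s ^ 2))⁻¹) := by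
    rw [← Real.exp_neg, ← Real.exp_add, ← Real.exp_add]
    congr 1
    rw [hzdef]
    field_simp
    ring
  have hfrac : ((z / s) ^ 2 + 1) / (z / s * (2 * (z / s) ^ 2 + 3))
      = s * ((z ^ 2 + s ^ 2) / (z * (2 * z ^ 2 + 3 * s ^ 2))) := by
    field_simp
  have hq : 1 + 0.36 * s ^ 2 + 0.0648 * s ^ 4 ≤ Real.exp (0.36 * s ^ 2) := by
    have := Real.quadratic_le_exp_of_nonneg (x := 0.36 * s ^ 2) (by positivity)
    nlinarith
  have h1 : 1.0004 * (Real.exp 1.2 * (Real.exp (0.36 * s ^ 2))⁻¹)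
      * ((z ^ 2 + s ^ 2) / (z * (2 * z ^ 2 + 3 * s ^ 2))) / √Real.pi
      ≤ 2 * (0.472 - 0.035 * s) := by
    have hpi := sqrt_pi_ge
    have he := exp_six_fifths_le
    have hc : 0 < 0.472 - 0.035 * s := by linarith
    set c := 0.472 - 0.035 * s
    set D := z * (2 * z ^ 2 + 3 * s ^ 2) with hD
    have hD0 : 0 < D := by positivity
    have hG : 0 < Real.exp (0.36 * s ^ 2) := Real.exp_pos _
    set G := Real.exp (0.36 * s ^ 2)
    have e1 : 1.0004 * (Real.exp 1.2 * G⁻¹) * ((z ^ 2 + s ^ 2) / D) / √Real.pi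
        = 1.0004 * Real.exp 1.2 * (z ^ 2 + s ^ 2) / (G * D * √Real.pi) := by
      field_simp
    rw [e1, div_le_iff₀ (by positivity)]
    calc 1.0004 * Real.exp 1.2 * (z ^ 2 + s ^ 2) ≤ 1.0004 * 3.3202 * (z ^ 2 + s ^ 2) := by gcongr
      _ ≤ 2 * 1.7724 * (0.9371 * (z ^ 2 + s ^ 2)) := by nlinarith [sq_nonneg z, sq_nonneg s]
      _ ≤ 2 * 1.7724 * (c * (1 + 0.36 * s ^ 2 + 0.0648 * s ^ 4) * D) := by gcongr
      _ ≤ 2 * √Real.pi * (c * G * D) := by gcongr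
      _ = _ := by ring
  unfold millsBound leakBound
  rw [hy, hexp, hfrac]
  calc _ = Real.exp (-(1 / s) ^ 2) * s * (1.0004 * (Real.exp 1.2 * (Real.exp (0.36 * s ^ 2))⁻¹)
        * ((z ^ 2 + s ^ 2) / (z * (2 * z ^ 2 + 3 * s ^ 2))) / √Real.pi) := by ring
    _ ≤ Real.exp (-(1 / s) ^ 2) * s * (2 * (0.472 - 0.035 * s)) :=
        mul_le_mul_of_nonneg_left h1 (by positivity)
    _ = _ := by ring

theorem leak_total {s L : ℝ} (hs0 : 0 < s) (hs : s ≤ 0.6935) (hL : 1 / s ≤ L) :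
    millsBound (1 / s - 0.6 * s) + millsBound ((1 + √2) * L + (1 / s - 0.6 * s))
      ≤ 2 * Real.exp (-(1 / s) ^ 2) * leakBound s := by
  refine le_trans ?_ (millsBound_le_leak hs0 hs)
  set l := 1 / s with hl
  have hls : l * s = 1 := by rw [hl]; field_simp
  have hl1 : 1.44 ≤ l := by
    rw [hl, le_div_iff₀ hs0]
    linarith
  have hy : 1 ≤ l - 0.6 * s := by linarith
  have h2 : 1.4 ≤ √2 := Real.le_sqrt_of_sq_le (by norm_num)
  have hx : 2.4 * l ≤ (1 + √2) * L := mul_le_mul (by linarith) hL (by linarith) (by positivity)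
  have := millsBound_le_of_le (y := l - 0.6 * s) (b := (1 + √2) * L + (l - 0.6 * s)) (by linarith)
    (by linarith) (by nlinarith)
  linarith

/-- The mode `√(2n+1)` is at least `√(2d₀) = (2 + 2√2)L`, which exceeds `√2 b` by `√2(L - 1/s) +
0.6√2 s`. Lowering the noise margin from `1/s` to `1/s - 0.6s` thus gains mass at first order in
`s`, while the leakage only grows by a constant factor. -/
theorem ofReal_weightBound_le {s L : ℝ} {n : ℕ} (hs0 : 0 < s) (hs : s ≤ 0.6935) (hL : 1 / s ≤ L)
    (hn : (2 + √2) ^ 2 * L ^ 2 ≤ n) :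
    ENNReal.ofReal (weightBound s) ≤ radialWeight ((1 + √2) * L + (1 / s - 0.6 * s)) n := by
  set l := 1 / s with hl
  have hls : l * s = 1 := by rw [hl]; field_simp
  have hl1 : 1.44 ≤ l := by
    rw [hl, le_div_iff₀ hs0]
    linarith
  have h2l : 1.414 ≤ √2 := Real.le_sqrt_of_sq_le (by norm_num)
  have h2u : √2 ≤ 1.41422 := Real.sqrt_le_iff.2 (by norm_num)
  have h2 : √2 * √2 = 2 := Real.mul_self_sqrt (by norm_num)
  have hL0 : 0 < L := by linarith
  have hLi : L * L⁻¹ = 1 := mul_inv_cancel₀ hL0.ne'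
  have hLi0 : 0 < L⁻¹ := inv_pos.2 hL0
  have hM : √(2 * (n : ℝ) + 1) ^ 2 = 2 * n + 1 := Real.sq_sqrt (by positivity)
  -- The `+1` in `2n + 1` shifts the mode by a further `0.1/L`.
  have hMlow : (2 + 2 * √2) * L + 0.1 * L⁻¹ ≤ √(2 * (n : ℝ) + 1) := by
    refine Real.le_sqrt_of_sq_le ?_
    have hLi1 : L⁻¹ ≤ 0.7 := by
      rw [inv_le_comm₀ hL0 (by norm_num)]
      norm_num
      linarith
    have e1 : ((2 + 2 * √2) * L + 0.1 * L⁻¹) ^ 2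
        = 2 * ((2 + √2) ^ 2 * L ^ 2) + 0.2 * (2 + 2 * √2) + 0.01 * L⁻¹ ^ 2 := by
      linear_combination (0.2 * (2 + 2 * √2)) * hLi + 2 * L ^ 2 * h2
    rw [e1]
    nlinarith
  have hM7 : 7 ≤ √(2 * (n : ℝ) + 1) := by
    refine Real.le_sqrt_of_sq_le ?_
    nlinarith
  -- `0.9475` is just below `0.6√2 + 0.1`; replacing `0.1/L` by `0.1 s` is paid for by the surplus
  -- `√2(L - 1/s)`.
  have hb : √2 * ((1 + √2) * L + (l - 0.6 * s)) ≤ √(2 * (n : ℝ) + 1) - 0.9475 * s := by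
    have h3 : s - L⁻¹ = (L - l) * (s * L⁻¹) := by
      linear_combination (-s) * hLi + L⁻¹ * hls
    have h4 : (L - l) * (s * L⁻¹) ≤ (L - l) * 1 := by
      refine mul_le_mul_of_nonneg_left ?_ (by linarith)
      have hLi1 : L⁻¹ ≤ 1 := inv_le_one_of_one_le₀ (by linarith)
      nlinarith
    nlinarith
  exact ofReal_le_radialWeight hM7 hM (by positivity) (by linarith) hb

theorem c₀_eq_inv : c₀ = (2 + √2)⁻¹ := by
  have h2 : √2 * √2 = (2 : ℝ) := Real.mul_self_sqrt (by norm_num)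
  have h0 : 0 < √2 := by positivity
  rw [c₀]
  field_simp
  linarith

/-- The rate obtained is `K/25`, which is at least `K²/(25(K+1))`. -/
theorem chernoff_exponent {K N R Q r t x y m lam : ℝ} (hK : 0 < K) (hN : 0 < N) (hr : r = R / K)
    (ht : t = Q / N) (h : lam * r + x / y - m * t ≤ -(0.04 * (0.6 * t - 4 * r) ^ 2)) :
    lam * R - m * (K / N) * Q + K * (x / y)
      ≤ -(K ^ 2 / (25 * (K + 1))) * (3 * Q / (5 * N) - 4 * R / K) ^ 2 := by
  have e1 : lam * R - m * (K / N) * Q + K * (x / y) = K * (lam * r + x / y - m * t) := by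
    rw [hr, ht]
    field_simp
    ring
  have e2 : 3 * Q / (5 * N) - 4 * R / K = 0.6 * t - 4 * r := by
    rw [ht, hr]
    field_simp
    ring
  have h3 := mul_le_mul_of_nonneg_left h hK.le
  have h4 : K ^ 2 / (25 * (K + 1)) ≤ K * 0.04 := by
    rw [div_le_iff₀ (by positivity)]
    have h6 : K * 0.04 * (25 * (K + 1)) = K ^ 2 + K := by ring
    linarith
  have h5 := mul_le_mul_of_nonneg_right h4 (sq_nonneg (0.6 * t - 4 * r))
  rw [e1, e2]
  linarith

/-- The tests of a register, compared as operators. -/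
theorem registerEffect_photon_le {k : ℕ} {U : Op (Fin k → ℕ)}
    (hU : U ∈ unitary (Op (Fin k → ℕ))) (j : Fin k) {s L d₀ : ℝ} (hs0 : 0 < s) (hs : s ≤ 0.6935)
    (hL : 1 / s ≤ L) (hd₀ : d₀ = (2 + √2) ^ 2 * L ^ 2)
    (he1 : 2 * Real.exp (-(1 / s) ^ 2) * leakBound s ≤ 1) :
    (weightBound s : ℂ) • registerEffect U j (photonEffect d₀)
      ≤ ((2 * (1 - 2 * Real.exp (-(1 / s) ^ 2) * leakBound s) : ℝ) : ℂ)
          • registerEffect U j (homodyneEffect d₀)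
        + ((2 * (2 * Real.exp (-(1 / s) ^ 2) * leakBound s) : ℝ) : ℂ) • 1 := by
  have hls : 1 / s * s = 1 := by field_simp
  have hl1 : 1 ≤ 1 / s := by
    rw [le_div_iff₀ hs0]
    linarith
  have hL0 : 0 < L := by linarith
  have hy : 0 < 1 / s - 0.6 * s := by linarith
  -- `(1 + √2)L` is the homodyne threshold `√(d₀/2)`, to which the noise margin `1/s - 0.6s` is
  -- added.
  have hx₀ : 0 ≤ (1 + √2) * L := by positivity
  have h := smul_photonEffect_le (d₀ := d₀) (b := (1 + √2) * L + (1 / s - 0.6 * s))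
    (p := weightBound s) (e := 2 * Real.exp (-(1 / s) ^ 2) * leakBound s) (by linarith)
    ((by norm_num : (0 : ℝ) ≤ 1 / 2).trans (weightBound_bounds hs0.le hs).1)
    (fun n hn => ofReal_weightBound_le hs0 hs hL (hd₀ ▸ hn))
    (fun x hx => (gaussTail_le hx₀ hy ?_).trans
      (ENNReal.ofReal_le_ofReal (leak_total hs0 hs hL)))
    (mul_nonneg (by positivity) (leakBound_nonneg hs0.le hs)) he1
  · have h2 := registerEffect_mono (U := U) j h
    rwa [registerEffect_smul, registerEffect_add, registerEffect_smul, registerEffect_smul,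
      registerEffect_one j hU] at h2
  · have h2 : √2 * √2 = (2 : ℝ) := Real.mul_self_sqrt (by norm_num)
    refine hx.le.trans (le_of_eq ?_)
    rw [hd₀]
    linear_combination (-(L ^ 2) / 2) * h2

/-- The square of `e^{v-1} ≥ v` at `v = 1/(2s²)`; the constant is `8/e² ≈ 1.0827`. -/
theorem two_mul_exp_neg_le {s : ℝ} (hs0 : 0 < s) :
    2 * Real.exp (-(1 / s) ^ 2) ≤ 1.083 * s ^ 4 := by
  have h1 := Real.add_one_le_exp ((1 / s) ^ 2 / 2 - 1)
  rw [sub_add_cancel] at h1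
  have h2 : ((1 / s) ^ 2 / 2) ^ 2 ≤ Real.exp ((1 / s) ^ 2 / 2 - 1) ^ 2 :=
    pow_le_pow_left₀ (by positivity) h1 2
  rw [← Real.exp_nat_mul] at h2
  have h3 : Real.exp (((2 : ℕ) : ℝ) * ((1 / s) ^ 2 / 2 - 1)) * Real.exp (-(1 / s) ^ 2)
      = Real.exp (-1) ^ 2 := by
    rw [← Real.exp_add, ← Real.exp_nat_mul]
    congr 1
    push_cast
    ring
  have h4 : Real.exp (-1) ≤ 0.36788 := by
    rw [Real.exp_neg, inv_le_comm₀ (Real.exp_pos _) (by norm_num)]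
    refine le_trans (by norm_num) Real.exp_one_gt_d9.le
  have h5 : Real.exp (-1) ^ 2 ≤ 0.36788 ^ 2 := pow_le_pow_left₀ (Real.exp_pos _).le h4 2
  have h6 := mul_le_mul_of_nonneg_right h2 (Real.exp_pos (-(1 / s) ^ 2)).le
  rw [h3] at h6
  have h7 : Real.exp (-(1 / s) ^ 2)
      = 4 * s ^ 4 * (((1 / s) ^ 2 / 2) ^ 2 * Real.exp (-(1 / s) ^ 2)) := by
    field_simp
    norm_num
  rw [h7]
  have h8 : 0 ≤ s ^ 4 := by positivity
  have h9 : ((1 / s) ^ 2 / 2) ^ 2 * Real.exp (-(1 / s) ^ 2) ≤ 0.13534 :=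
    h6.trans (h5.trans (by norm_num))
  nlinarith [mul_le_mul_of_nonneg_left h9 h8]

end CVVerification

end

/-! ### The verification bound: choice of the parameters. -/

theorem mainTheorem5 (k K N R Q : ℕ) (j : Fin k)
    (U : CVVerification.Op (Fin k → ℕ)) (hU : U ∈ unitary (CVVerification.Op (Fin k → ℕ)))
    (ρ : CVVerification.Op (Fin (K + N) → Fin k → ℕ)) (hρ : CVVerification.IsState ρ)
    (hperm : CVVerification.IsPermInvariant ρ)
    (d₀ : ℝ) (hd₀ : d₀ = 1 / CVVerification.c₀ ^ 2 * Real.log ((N : ℝ) / (R : ℝ)))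
    (hN : 2 * K ≤ N) (hR : 0 < R) (hRK : R < K)
    (hQ : (N : ℝ) * (4 * (R : ℝ) / (K : ℝ)
      + 1 / (CVVerification.c₀ * √(Real.pi * d₀)) * ((R : ℝ) / (N : ℝ))) < (Q : ℝ))
    (hQN : Q < N) :
    CVVerification.jointProb ρ
        (CVVerification.registerEffect U j (CVVerification.homodyneEffect d₀))
        (CVVerification.registerEffect U j (CVVerification.photonEffect d₀)) R Q
      ≤ 4 * Real.exp (-((K : ℝ) ^ 2 / (25 * ((K : ℝ) + 1)))
          * (3 * (Q : ℝ) / (5 * (N : ℝ)) - 4 * (R : ℝ) / (K : ℝ)) ^ 2) := by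
  open CVVerification in
  have hK : 0 < K := by omega
  have hRr : (0 : ℝ) < R := by exact_mod_cast hR
  have hKr : (0 : ℝ) < K := by exact_mod_cast hK
  have hNr : (0 : ℝ) < N := by exact_mod_cast (show 0 < N by omega)
  have hNK : 2 * (K : ℝ) ≤ N := by exact_mod_cast hN
  have hQr : (Q : ℝ) < N := by exact_mod_cast hQN
  have hc : 0 < c₀ := by
    rw [c₀_eq_inv]
    positivity
  obtain ⟨r, hr⟩ : ∃ r : ℝ, r = R / K := ⟨_, rfl⟩
  obtain ⟨t, ht⟩ : ∃ t : ℝ, t = Q / N := ⟨_, rfl⟩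
  have hr0 : 0 < r := by rw [hr]; positivity
  have ht1 : t ≤ 1 := by
    rw [ht, div_le_one hNr]
    exact hQr.le
  have hrt : 4 * r ≤ t := by
    have h1 : 0 ≤ 1 / (c₀ * √(Real.pi * d₀)) * ((R : ℝ) / (N : ℝ)) := by positivity
    rw [ht, le_div_iff₀ hNr, hr]
    have h2 : (N : ℝ) * (4 * (R : ℝ) / (K : ℝ)) ≤ Q :=
      (mul_le_mul_of_nonneg_left (le_add_of_nonneg_right h1) hNr.le).trans hQ.le
    calc 4 * ((R : ℝ) / K) * N = (N : ℝ) * (4 * (R : ℝ) / (K : ℝ)) := by ring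
      _ ≤ _ := h2
  -- From `4r ≤ t ≤ 1` it follows that `2/r ≥ 8`, which bounds `s` by `1/√(ln 8)`.
  have hlog8 : 2.07944 ≤ Real.log (2 / r) := by
    have h8 : Real.log 8 = 3 * Real.log 2 := by
      rw [show (8 : ℝ) = 2 ^ 3 by norm_num, Real.log_pow]
      norm_num
    have : Real.log 8 ≤ Real.log (2 / r) := by
      refine Real.log_le_log (by norm_num) ?_
      rw [le_div_iff₀ hr0]
      linarith
    linarith [Real.log_two_gt_d9]
  have hlogs : Real.log (2 / r) ≤ Real.log ((N : ℝ) / R) := by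
    refine Real.log_le_log (by positivity) ?_
    rw [hr, div_div_eq_mul_div]
    gcongr
  -- `s` is defined by `2 exp(-1/s²) = r`, so that the leakage is `r · leakBound s`, proportional to
  -- the failure rate. The bound `1/s ≤ L` is `2K ≤ N`.
  obtain ⟨s, hs_def⟩ : ∃ s : ℝ, s = 1 / √(Real.log (2 / r)) := ⟨_, rfl⟩
  obtain ⟨L, hL_def⟩ : ∃ L : ℝ, L = √(Real.log ((N : ℝ) / R)) := ⟨_, rfl⟩
  have hs0 : 0 < s := by
    rw [hs_def]
    exact one_div_pos.2 (Real.sqrt_pos.2 (by linarith))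
  have hsl : 1 / s = √(Real.log (2 / r)) := by rw [hs_def, one_div_one_div]
  have hs : s ≤ 0.6935 := by
    rw [hs_def, div_le_iff₀ (Real.sqrt_pos.2 (by linarith))]
    have : 1 / 0.6935 ≤ √(Real.log (2 / r)) := Real.le_sqrt_of_sq_le (by norm_num at hlog8 ⊢; linarith)
    norm_num at this ⊢
    linarith
  have hL : 1 / s ≤ L := by
    rw [hsl, hL_def]
    exact Real.sqrt_le_sqrt hlogs
  have hrs : 2 * Real.exp (-(1 / s) ^ 2) = r := by
    rw [hsl, Real.sq_sqrt (by linarith), Real.exp_neg, Real.exp_log (by positivity)]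
    field_simp
  have hd : d₀ = (2 + √2) ^ 2 * L ^ 2 := by
    rw [hd₀, hL_def, Real.sq_sqrt (by linarith), c₀_eq_inv, inv_pow, one_div, inv_inv]
  have hr4 : r ≤ 1.083 * s ^ 4 := hrs ▸ two_mul_exp_neg_le hs0
  have he := leak_le hs0.le hs hr4
  have hE := leakBound_nonneg hs0.le hs
  have hEF := registerEffect_photon_le hU j hs0 hs hL hd (by rw [hrs]; linarith)
  rw [hrs] at hEF
  obtain ⟨hw1, hw2⟩ := weightBound_bounds hs0.le hs
  obtain ⟨lam, κ, hlam, hκ0, hκ1, hκ, hexp⟩ := exists_exponent hs0.le hs hr0.le hr4 hrt ht1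
  obtain ⟨m, hm⟩ : ∃ m : ℝ, m = κ * (1 - 5 / 8 * κ) := ⟨_, rfl⟩
  have hm0 : 0 ≤ m := by
    rw [hm]
    exact mul_nonneg hκ0 (by linarith)
  have hu : (K : ℝ) / N ≤ 1 / 2 := by
    rw [div_le_iff₀ hNr]
    linarith
  -- The Chernoff parameter of the `N` registers is `μ = m K/N`, for which `μQ = K m t`.
  have hch := chernoff_parameter hκ0 hκ1 hκ hm (u := K / N) (by positivity) hu
  have hμ : m * (K / N) * (K + N) ≤ K * (1 - (1 - (1 - Real.exp (-lam)) * weightBound s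
      / (2 * (1 - r * leakBound s * Real.exp (-lam)))) * Real.exp (-(m * (K / N)))) := by
    have : m * (K / N) * ((K : ℝ) + N) = K * (m * (1 + K / N)) := by
      field_simp
      ring
    rw [this]
    exact mul_le_mul_of_nonneg_left hch hKr.le
  have hfinal := jointProb_le hρ hperm (registerEffect_nonneg j (homodyneEffect_nonneg d₀))
    ((registerEffect_mono j (homodyneEffect_le_one d₀)).trans_eq (registerEffect_one j hU))
    (registerEffect_nonneg j (photonEffect_nonneg d₀))
    ((registerEffect_mono j (photonEffect_le_one d₀)).trans_eq (registerEffect_one j hU))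
    hK (by linarith) hw2 (mul_nonneg hr0.le hE) (by linarith) hEF hlam
    (mul_nonneg hm0 (by positivity)) hμ R Q
  refine hfinal.trans ?_
  rw [← hm] at hexp
  have hexp2 := chernoff_exponent hKr hNr hr ht hexp
  have h6 := Real.exp_le_exp.2 hexp2
  have h7 := Real.exp_pos (-((K : ℝ) ^ 2 / (25 * ((K : ℝ) + 1)))
          * (3 * (Q : ℝ) / (5 * (N : ℝ)) - 4 * (R : ℝ) / (K : ℝ)) ^ 2)
  -- The estimate holds with prefactor `1`, hence with `4`.
  linarith
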